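/- Let $\Gamma\rightrightarrows M$ be a Lie groupoid with source, target and unit maps $s,t:\Gamma\to M$, $\varepsilon:M\to\Gamma$, all of whose source fibres are connected. Let $\Gamma_2$ and $\Gamma_3$ be the manifolds of composable pairs and triples of arrows, and let $\partial:\Omega^k(\Gamma_p)\to\Omega^k(\Gamma_{p+1})$ be the alternating sum of the pullbacks along the face maps; thus $\partial\alpha=\mathrm{pr}_2^*\alpha-m^*\alpha+\mathrm{pr}_1^*\alpha$ on $\Omega^k(\Gamma)$, where $m$ is the multiplication. Put $\delta=(-1)^pd+\partial$ on $\Omega^k(\Gamma_p)$. Let $\eta\in\Omega^1(\Gamma_2)$ and $\omega\in\Omega^2(\Gamma)$ be such that $\eta+\omega$ is a $3$-cocycle, $\delta(\eta+\omega)=0$, that is, $\partial\eta=0$, $d\eta+\partial\omega=0$ and $d\omega=0$. Let $\pi:R\to\Gamma$ be a principal $S^1$-bundle with a connection form $\theta\in\Omega^1(R)$ of curvature $\omega$, that is, $d\theta=\pi^*\omega$. Here $S^1=\mathbb R/\mathbb Z$ and $\theta$ is normalised by $\theta(\partial_t)=1$ for the generator $\partial_t$ of the action of $\mathbb R/\mathbb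 Z$ (so $\omega$ represents an integral class). Let $\varepsilon_2:M\to\Gamma_2$, $x\mapsto(\varepsilon(x),\varepsilon(x))$, and suppose that $\varepsilon^*R\to M$ with the flat connection $\varepsilon^*\theta+\pi^*\varepsilon_2^*\eta$ has no holonomy. Then $\varepsilon^*R$ has a smooth global section that is horizontal for this connection, and for every such section, viewed as a map $e:M\to R$ with $\pi\circ e=\varepsilon$, there is exactly one Lie groupoid structure $R\rightrightarrows M$ with unit map $e$ such that 1. $R\rightrightarrows M$ is an $S^1$-central extension of $\Gamma\rightrightarrows M$, that is, $(\pi,\mathrm{id}_M)$ is a morphism of Lie groupoids, $\pi$ is a principal $S^1$-bundle, and $(z\cdot x)(w\cdot y)=zw\cdot(xy)$ for all $z,w\in S^1$ and all composable $x,y\in R$; 2. $\eta+\omega$ is the pseudo-curvature of $\theta$, with the sign for which its component in $\Omega^2(\Gamma)$ is the curvature of $\theta$: $\pi^*(\eta+\omega)=-\delta\theta$, that is, $\pi^*\omega=d\theta$ on $R$ and $\pi^*\eta=-\partial\theta$ on the manifold $R_2$ of composable pairs of $R$. -/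

import Mathlib

open scoped Manifold ContDiff

noncomputable section

/-! ## Smooth spaces

Manifolds, fibre products of manifolds and restrictions of bundles are all treated as spaces with a
set of smooth parametrizations `ℝⁿ → X` (a diffeology). A submanifold of a manifold (such as a fibre
product along a submersion) carries exactly the parametrizations that are smooth into the ambient
manifold. -/

/-- The diffeology of a smooth manifold: the plots are the smooth maps `ℝⁿ → X`. -/
abbrev manifoldDiffeology (E : Type*) [NormedAddCommGroup E] [NormedSpace ℝ E]
    (X : Type*) [TopologicalSpace X] [ChartedSpace E X] : DiffeologicalSpace X where
  plots n := {p | ContMDiff 𝓘(ℝ, EuclideanSpace ℝ (Fin n)) 𝓘(ℝ, E) ∞ p}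
  constant_plots _ := contMDiff_const
  plot_reparam hp hf := ContMDiff.comp hp hf.contMDiff
  locality {n p} hp := by
    intro x
    obtain ⟨u, hu, hxu, h⟩ := hp x
    obtain ⟨r, hr, hru⟩ := Metric.isOpen_iff.1 hu x hxu
    -- a smooth map into the ball that is the identity near its centre
    let b : ContDiffBump x := ⟨r / 4, r / 2, by positivity, by linarith⟩
    let f : EuclideanSpace ℝ (Fin n) → EuclideanSpace ℝ (Fin n) := fun y => x + b y • (y - x)
    have hf : ContDiff ℝ ∞ f :=
      contDiff_const.add (b.contDiff.smul (contDiff_id.sub contDiff_const))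
    have hfu : ∀ y, f y ∈ u := by
      intro y
      apply hru
      rw [Metric.mem_ball, dist_eq_norm]
      have h1 : f y - x = b y • (y - x) := by simp [f]
      rw [h1, norm_smul, Real.norm_of_nonneg b.nonneg]
      by_cases hy : dist y x < r / 2
      · rw [dist_eq_norm] at hy
        calc b y * ‖y - x‖ ≤ 1 * ‖y - x‖ := by
              gcongr
              exact b.le_one
          _ < r := by linarith
      · have : b y = 0 := b.zero_of_le_dist (not_lt.1 hy)
        simpa [this] using hr
    have hpf := h hfu hf
    have hev : p =ᶠ[nhds x] p ∘ f := by
      filter_upwards [b.eventuallyEq_one] with y hy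
      have : f y = y := by simp [f, hy]
      simp [this]
    exact (hpf x).congr_of_eventuallyEq hev

/-- The product diffeology. -/
abbrev prodDiffeology {X Y : Type*} (D : DiffeologicalSpace X) (D' : DiffeologicalSpace Y) :
    DiffeologicalSpace (X × Y) where
  plots n := {p | (fun x => (p x).1) ∈ D.plots n ∧ (fun x => (p x).2) ∈ D'.plots n}
  constant_plots z := ⟨D.constant_plots z.1, D'.constant_plots z.2⟩
  plot_reparam hp hf := ⟨D.plot_reparam hp.1 hf, D'.plot_reparam hp.2 hf⟩
  locality hp := by
    constructor
    · refine D.locality fun x => ?_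
      obtain ⟨u, hu, hx, h⟩ := hp x
      exact ⟨u, hu, hx, fun hf hf' => (h hf hf').1⟩
    · refine D'.locality fun x => ?_
      obtain ⟨u, hu, hx, h⟩ := hp x
      exact ⟨u, hu, hx, fun hf hf' => (h hf hf').2⟩

/-- The subset diffeology. -/
abbrev subDiffeology {X : Type*} (D : DiffeologicalSpace X) (P : X → Prop) :
    DiffeologicalSpace {x // P x} where
  plots n := {p | (fun x => (p x).1) ∈ D.plots n}
  constant_plots z := D.constant_plots z.1
  plot_reparam hp hf := D.plot_reparam hp hf
  locality hp := by
    refine D.locality fun x => ?_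
    obtain ⟨u, hu, hx, h⟩ := hp x
    exact ⟨u, hu, hx, fun hf hf' => h hf hf'⟩

/-- Smooth maps between diffeological spaces. Between manifolds, and between submanifolds of
manifolds, these are the smooth maps in the usual sense. -/
abbrev SmoothMap {X Y : Type*} (D : DiffeologicalSpace X) (D' : DiffeologicalSpace Y)
    (f : X → Y) : Prop :=
  @Diffeology.DSmooth X Y D D' f

theorem smoothMap_fst {X Y : Type*} (D : DiffeologicalSpace X) (D' : DiffeologicalSpace Y)
    (P : X × Y → Prop) : SmoothMap (subDiffeology (prodDiffeology D D') P) D (fun z => z.1.1) :=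
  fun _ _ hp => hp.1

theorem smoothMap_snd {X Y : Type*} (D : DiffeologicalSpace X) (D' : DiffeologicalSpace Y)
    (P : X × Y → Prop) : SmoothMap (subDiffeology (prodDiffeology D D') P) D' (fun z => z.1.2) :=
  fun _ _ hp => hp.2

theorem smoothMap_of_contMDiff {E E' X Y : Type*} [NormedAddCommGroup E] [NormedSpace ℝ E]
    [NormedAddCommGroup E'] [NormedSpace ℝ E'] [TopologicalSpace X] [ChartedSpace E X]
    [TopologicalSpace Y] [ChartedSpace E' Y] {f : X → Y}
    (hf : ContMDiff 𝓘(ℝ, E) 𝓘(ℝ, E') ∞ f) :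
    SmoothMap (manifoldDiffeology E X) (manifoldDiffeology E' Y) f :=
  fun _ _ hp => hf.comp hp

/-! ## Differential forms -/

/-- A smooth differential `k`-form, given by its pullbacks along all smooth parametrizations
`p : ℝⁿ → X`, which are smooth `k`-forms on `ℝⁿ`, compatible with reparametrization. On a smooth
manifold (or submanifold) this is the same thing as an ordinary smooth `k`-form: such a form is
determined by, and can be glued from, its expressions in charts. -/
@[ext]
structure DForm {X : Type*} (D : DiffeologicalSpace X) (k : ℕ) where
  /-- the pullback of the form along a plot -/
  along : ∀ (n : ℕ) (p : EuclideanSpace ℝ (Fin n) → X), p ∈ D.plots n →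
    EuclideanSpace ℝ (Fin n) → EuclideanSpace ℝ (Fin n) [⋀^Fin k]→L[ℝ] ℝ
  smooth : ∀ (n : ℕ) (p : EuclideanSpace ℝ (Fin n) → X) (hp : p ∈ D.plots n),
    ContDiff ℝ ∞ (along n p hp)
  reparam : ∀ (m n : ℕ) (p : EuclideanSpace ℝ (Fin n) → X) (hp : p ∈ D.plots n)
    (f : EuclideanSpace ℝ (Fin m) → EuclideanSpace ℝ (Fin n)) (hf : ContDiff ℝ ∞ f)
    (x : EuclideanSpace ℝ (Fin m)),
    along m (p ∘ f) (D.plot_reparam hp hf) x =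
      (along n p hp (f x)).compContinuousLinearMap (fderiv ℝ f x)

namespace DForm

variable {X Y : Type*} {D : DiffeologicalSpace X} {D' : DiffeologicalSpace Y} {k : ℕ}

instance : Zero (DForm D k) where
  zero :=
    { along := fun _ _ _ _ => 0
      smooth := fun _ _ _ => contDiff_const
      reparam := fun _ _ _ _ _ _ _ => by ext; simp }

instance : Add (DForm D k) where
  add α β :=
    { along := fun n p hp x => α.along n p hp x + β.along n p hp x
      smooth := fun n p hp => (α.smooth n p hp).add (β.smooth n p hp)
      reparam := fun m n p hp f hf x => by
        rw [α.reparam m n p hp f hf x, β.reparam m n p hp f hf x]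
        ext; simp }

instance : Neg (DForm D k) where
  neg α :=
    { along := fun n p hp x => -α.along n p hp x
      smooth := fun n p hp => (α.smooth n p hp).neg
      reparam := fun m n p hp f hf x => by
        rw [α.reparam m n p hp f hf x]
        ext; simp }

instance : Sub (DForm D k) where
  sub α β := α + -β

/-- The exterior derivative. -/
def d (α : DForm D k) : DForm D (k + 1) where
  along n p hp := extDeriv (α.along n p hp)
  smooth n p hp := by
    have h : ContDiff ℝ ∞ (fderiv ℝ (α.along n p hp)) :=
      (α.smooth n p hp).fderiv_right (by simp)
    exact (ContinuousAlternatingMap.alternatizeUncurryFinCLM ℝ (EuclideanSpace ℝ (Fin n))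
      ℝ).contDiff.comp h
  reparam m n p hp f hf x := by
    have h : α.along m (p ∘ f) (D.plot_reparam hp hf) =
        fun x => (α.along n p hp (f x)).compContinuousLinearMap (fderiv ℝ f x) :=
      funext fun x => α.reparam m n p hp f hf x
    rw [h]
    exact extDeriv_pullback (r := ∞)
      ((α.smooth n p hp).contDiffAt.differentiableAt (by simp)) hf.contDiffAt
      (by simpa using (WithTop.coe_le_coe.2 le_top : ((2 : ℕ∞) : WithTop ℕ∞) ≤ ∞))

/-- The pullback `f^*α` along a smooth map. -/
def pullback (α : DForm D' k) (f : X → Y) (hf : SmoothMap D D' f) : DForm D k where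
  along n p hp := α.along n (f ∘ p) (hf n p hp)
  smooth n p hp := α.smooth n (f ∘ p) (hf n p hp)
  reparam m n p hp g hg x := α.reparam m n (f ∘ p) (hf n p hp) g hg x

end DForm

/-! ## Lie groupoids -/

section Groupoid

variable (EM : Type*) [NormedAddCommGroup EM] [NormedSpace ℝ EM]
  (M : Type*) [TopologicalSpace M] [ChartedSpace EM M]
  (EG : Type*) [NormedAddCommGroup EG] [NormedSpace ℝ EG]
  (G : Type*) [TopologicalSpace G] [ChartedSpace EG G]

/-- A Lie groupoid `G ⇉ M`, where `G` and `M` are manifolds modelled on `EG` and `EM`. The product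
`g h` is defined when `tgt g = src h`, so an arrow `g` is read as going from `src g` to `tgt g`
and arrows are composed from left to right. -/
@[ext]
structure LieGroupoid where
  src : G → M
  tgt : G → M
  unit : M → G
  inv : G → G
  mul : (g h : G) → tgt g = src h → G
  src_mul : ∀ g h hgh, src (mul g h hgh) = src g
  tgt_mul : ∀ g h hgh, tgt (mul g h hgh) = tgt h
  mul_assoc : ∀ g h k (hgh : tgt g = src h) (hhk : tgt h = src k),
    mul (mul g h hgh) k ((tgt_mul g h hgh).trans hhk) =
      mul g (mul h k hhk) (hgh.trans (src_mul h k hhk).symm)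
  src_unit : ∀ x, src (unit x) = x
  tgt_unit : ∀ x, tgt (unit x) = x
  unit_mul : ∀ g, mul (unit (src g)) g (tgt_unit (src g)) = g
  mul_unit : ∀ g, mul g (unit (tgt g)) (src_unit (tgt g)).symm = g
  src_inv : ∀ g, src (inv g) = tgt g
  tgt_inv : ∀ g, tgt (inv g) = src g
  mul_inv : ∀ g, mul g (inv g) (src_inv g).symm = unit (src g)
  inv_mul : ∀ g, mul (inv g) g (tgt_inv g) = unit (tgt g)
  submersion_src : Manifold.IsSubmersion 𝓘(ℝ, EG) 𝓘(ℝ, EM) ∞ src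
  submersion_tgt : Manifold.IsSubmersion 𝓘(ℝ, EG) 𝓘(ℝ, EM) ∞ tgt
  contMDiff_unit : ContMDiff 𝓘(ℝ, EM) 𝓘(ℝ, EG) ∞ unit
  contMDiff_inv : ContMDiff 𝓘(ℝ, EG) 𝓘(ℝ, EG) ∞ inv
  /-- the product is smooth on the submanifold of composable pairs -/
  smooth_mul : SmoothMap
    (subDiffeology (prodDiffeology (manifoldDiffeology EG G) (manifoldDiffeology EG G))
      (fun z => tgt z.1 = src z.2))
    (manifoldDiffeology EG G) (fun z => mul z.1.1 z.1.2 z.2)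

end Groupoid

namespace LieGroupoid

variable {EM : Type*} [NormedAddCommGroup EM] [NormedSpace ℝ EM]
  {M : Type*} [TopologicalSpace M] [ChartedSpace EM M]
  {EG : Type*} [NormedAddCommGroup EG] [NormedSpace ℝ EG]
  {G : Type*} [TopologicalSpace G] [ChartedSpace EG G]
  (𝒢 : LieGroupoid EM M EG G)

/-- The source fibres are connected. -/
def SourceConnected : Prop := ∀ x : M, IsConnected (𝒢.src ⁻¹' {x})

/-- The space `G₂` of composable pairs `(g, h)`. -/
abbrev Comp₂ : Type _ := {z : G × G // 𝒢.tgt z.1 = 𝒢.src z.2}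

/-- The space `G₃` of composable triples `(g, h, k)`. -/
abbrev Comp₃ : Type _ :=
  {z : G × G × G // 𝒢.tgt z.1 = 𝒢.src z.2.1 ∧ 𝒢.tgt z.2.1 = 𝒢.src z.2.2}

/-- The smooth structure of `G₂` as a submanifold of `G × G`. -/
abbrev smooth₂ : DiffeologicalSpace 𝒢.Comp₂ :=
  subDiffeology (prodDiffeology (manifoldDiffeology EG G) (manifoldDiffeology EG G)) _

/-- The smooth structure of `G₃` as a submanifold of `G × G × G`. -/
abbrev smooth₃ : DiffeologicalSpace 𝒢.Comp₃ :=
  subDiffeology (prodDiffeology (manifoldDiffeology EG G)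
    (prodDiffeology (manifoldDiffeology EG G) (manifoldDiffeology EG G))) _

/-- The face maps `G₂ → G`. -/
def face₂ : Fin 3 → 𝒢.Comp₂ → G
  | 0, z => z.1.2
  | 1, z => 𝒢.mul z.1.1 z.1.2 z.2
  | 2, z => z.1.1

theorem smooth_face₂ (i : Fin 3) :
    SmoothMap 𝒢.smooth₂ (manifoldDiffeology EG G) (𝒢.face₂ i) := by
  fin_cases i
  · exact fun n p hp => hp.2
  · exact 𝒢.smooth_mul
  · exact fun n p hp => hp.1

/-- The face maps `G₃ → G₂`. -/
def face₃ : Fin 4 → 𝒢.Comp₃ → 𝒢.Comp₂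
  | 0, z => ⟨(z.1.2.1, z.1.2.2), z.2.2⟩
  | 1, z => ⟨(𝒢.mul z.1.1 z.1.2.1 z.2.1, z.1.2.2), (𝒢.tgt_mul _ _ _).trans z.2.2⟩
  | 2, z => ⟨(z.1.1, 𝒢.mul z.1.2.1 z.1.2.2 z.2.2), z.2.1.trans (𝒢.src_mul _ _ _).symm⟩
  | 3, z => ⟨(z.1.1, z.1.2.1), z.2.1⟩

theorem smooth_face₃ (i : Fin 4) : SmoothMap 𝒢.smooth₃ 𝒢.smooth₂ (𝒢.face₃ i) := by
  fin_cases i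
  · exact fun n p hp => ⟨hp.2.1, hp.2.2⟩
  · exact fun n p hp => ⟨𝒢.smooth_mul n
      (fun x => ⟨((p x).1.1, (p x).1.2.1), (p x).2.1⟩) ⟨hp.1, hp.2.1⟩, hp.2.2⟩
  · exact fun n p hp => ⟨hp.1, 𝒢.smooth_mul n
      (fun x => ⟨((p x).1.2.1, (p x).1.2.2), (p x).2.2⟩) ⟨hp.2.1, hp.2.2⟩⟩
  · exact fun n p hp => ⟨hp.1, hp.2.1⟩

/-- `∂ : Ω^k(G) → Ω^k(G₂)`, the alternating sum of the pullbacks along the face maps. -/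
def del₁ {k : ℕ} (α : DForm (manifoldDiffeology EG G) k) : DForm 𝒢.smooth₂ k :=
  α.pullback (𝒢.face₂ 0) (𝒢.smooth_face₂ 0) - α.pullback (𝒢.face₂ 1) (𝒢.smooth_face₂ 1)
    + α.pullback (𝒢.face₂ 2) (𝒢.smooth_face₂ 2)

/-- `∂ : Ω^k(G₂) → Ω^k(G₃)`, the alternating sum of the pullbacks along the face maps. -/
def del₂ {k : ℕ} (α : DForm 𝒢.smooth₂ k) : DForm 𝒢.smooth₃ k :=
  α.pullback (𝒢.face₃ 0) (𝒢.smooth_face₃ 0) - α.pullback (𝒢.face₃ 1) (𝒢.smooth_face₃ 1)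
    + α.pullback (𝒢.face₃ 2) (𝒢.smooth_face₃ 2) - α.pullback (𝒢.face₃ 3) (𝒢.smooth_face₃ 3)

/-- `η + κ`, with `η ∈ Ω¹(G₂)` and `κ ∈ Ω²(G)`, is a 3-cocycle for the total differential
`δ = (-1)^p d + ∂` on the forms on `G_p`: the components of `δ(η + κ)` in `Ω¹(G₃)`, `Ω²(G₂)` and
`Ω³(G)` are `∂η`, `dη + ∂κ` and `-dκ`. -/
structure IsThreeCocycle (η : DForm 𝒢.smooth₂ 1) (κ : DForm (manifoldDiffeology EG G) 2) :
    Prop where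
  del_eta : 𝒢.del₂ η = 0
  d_eta_add_del_omega : η.d + 𝒢.del₁ κ = 0
  d_omega : -κ.d = 0

/-- The identity morphism `ε₂ : M → G₂`, `x ↦ (ε x, ε x)`. -/
def unit₂ (x : M) : 𝒢.Comp₂ :=
  ⟨(𝒢.unit x, 𝒢.unit x), (𝒢.tgt_unit x).trans (𝒢.src_unit x).symm⟩

theorem smooth_unit₂ : SmoothMap (manifoldDiffeology EM M) 𝒢.smooth₂ 𝒢.unit₂ :=
  fun _ _ hp => ⟨𝒢.contMDiff_unit.comp hp, 𝒢.contMDiff_unit.comp hp⟩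

end LieGroupoid

/-! ## Circle bundles with connection -/

section Bundle

variable {EG : Type*} [NormedAddCommGroup EG] [NormedSpace ℝ EG]
  {G : Type*} [TopologicalSpace G] [ChartedSpace EG G]
  {ER : Type*} [NormedAddCommGroup ER] [NormedSpace ℝ ER]
  {R : Type*} [TopologicalSpace R] [ChartedSpace ER R] [MulAction Circle R]

variable (EG ER) in
/-- `π : R → G` is a smooth (left) principal circle bundle: the action is smooth, `π` is smooth and
invariant, and over a neighbourhood `U` of every point there is an equivariant diffeomorphism
`U × S¹ ≃ π⁻¹ U`, `(u, z) ↦ z • σ u`, with inverse `r ↦ (π r, φ r)`. -/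
structure IsPrincipalCircleBundle (π : R → G) : Prop where
  smooth_smul : ContMDiffSMul (𝓡 1) 𝓘(ℝ, ER) ∞ Circle R
  smooth_proj : ContMDiff 𝓘(ℝ, ER) 𝓘(ℝ, EG) ∞ π
  proj_smul : ∀ (z : Circle) (r : R), π (z • r) = π r
  locally_trivial : ∀ g : G, ∃ U : Set G, IsOpen U ∧ g ∈ U ∧ ∃ (σ : G → R) (φ : R → Circle),
    ContMDiffOn 𝓘(ℝ, EG) 𝓘(ℝ, ER) ∞ σ U ∧ ContMDiffOn 𝓘(ℝ, ER) (𝓡 1) ∞ φ (π ⁻¹' U) ∧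
    (∀ u ∈ U, π (σ u) = u) ∧ (∀ u ∈ U, ∀ z : Circle, φ (z • σ u) = z) ∧
    (∀ r, π r ∈ U → φ r • σ (π r) = r)

/-- Translation by a fixed element of the circle is smooth. -/
theorem IsPrincipalCircleBundle.smoothMap_smul {π : R → G}
    (hπ : IsPrincipalCircleBundle EG ER π) (z : Circle) :
    SmoothMap (manifoldDiffeology ER R) (manifoldDiffeology ER R) (fun r => z • r) := by
  have := hπ.smooth_smul
  exact smoothMap_of_contMDiff
    ((ContMDiffSMul.contMDiff_smul (I := 𝓡 1) (I' := 𝓘(ℝ, ER)) (n := ∞) (G := Circle)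
      (M := R)).comp (contMDiff_const.prodMk contMDiff_id))

/-- The orbit map `t ↦ e^{2πit} • r` is smooth. -/
theorem IsPrincipalCircleBundle.orbit_mem_plots {π : R → G}
    (hπ : IsPrincipalCircleBundle EG ER π) (r : R) :
    (fun t : EuclideanSpace ℝ (Fin 1) => Circle.exp (2 * Real.pi * t 0) • r) ∈
      (manifoldDiffeology ER R).plots 1 := by
  have := hπ.smooth_smul
  have h1 : ContDiff ℝ ∞ (fun t : EuclideanSpace ℝ (Fin 1) => 2 * Real.pi * t 0) := by
    fun_prop
  exact (ContMDiffSMul.contMDiff_smul (I := 𝓡 1) (I' := 𝓘(ℝ, ER)) (n := ∞) (G := Circle)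
    (M := R)).comp ((contMDiff_circleExp.comp h1.contMDiff).prodMk contMDiff_const)

/-- `θ` is a connection form on the principal circle bundle `π : R → G`: it is invariant, and it
restricts to `dt` on the orbits `t ↦ e^{2πit} • r`. So `S¹` is identified with `ℝ/ℤ`, and the
curvature has integral periods. -/
structure IsConnection {π : R → G} (hπ : IsPrincipalCircleBundle EG ER π)
    (θ : DForm (manifoldDiffeology ER R) 1) : Prop where
  invariant : ∀ z : Circle, θ.pullback (fun r => z • r) (hπ.smoothMap_smul z) = θ
  vertical : ∀ (r : R) (t v : EuclideanSpace ℝ (Fin 1)),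
    θ.along 1 _ (hπ.orbit_mem_plots r) t (fun _ => v) = v 0

/-- The closed 2-form `κ` on the base is the curvature of `θ`: `dθ = π^*κ`. -/
def HasCurvature {π : R → G} (hπ : IsPrincipalCircleBundle EG ER π)
    (θ : DForm (manifoldDiffeology ER R) 1) (κ : DForm (manifoldDiffeology EG G) 2) : Prop :=
  θ.d = κ.pullback π (smoothMap_of_contMDiff hπ.smooth_proj)

end Bundle

/-- The connection form `ψ` on `q : P → B` has no holonomy: every smooth horizontal path that
starts and ends in the same fibre is closed. -/
def HolonomyFree {P B : Type*} (D : DiffeologicalSpace P) (q : P → B) (ψ : DForm D 1) : Prop :=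
  ∀ (c : EuclideanSpace ℝ (Fin 1) → P) (hc : c ∈ D.plots 1), (∀ t, ψ.along 1 c hc t = 0) →
    ∀ a b, q (c a) = q (c b) → c a = c b

/-! ## Central extensions -/

section Extension

variable {EM : Type*} [NormedAddCommGroup EM] [NormedSpace ℝ EM]
  {M : Type*} [TopologicalSpace M] [ChartedSpace EM M]
  {EG : Type*} [NormedAddCommGroup EG] [NormedSpace ℝ EG]
  {G : Type*} [TopologicalSpace G] [ChartedSpace EG G]
  {ER : Type*} [NormedAddCommGroup ER] [NormedSpace ℝ ER]
  {R : Type*} [TopologicalSpace R] [ChartedSpace ER R] [MulAction Circle R]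

/-- The total space of the restriction `ε^*R` of the bundle `R → G` along the unit map. -/
abbrev UnitBundle (𝒢 : LieGroupoid EM M EG G) (π : R → G) : Type _ :=
  {z : M × R // 𝒢.unit z.1 = π z.2}

variable (ER) in
/-- The smooth structure of `ε^*R` as a submanifold of `M × R`. -/
abbrev unitBundleSmooth (𝒢 : LieGroupoid EM M EG G) (π : R → G) :
    DiffeologicalSpace (UnitBundle 𝒢 π) :=
  subDiffeology (prodDiffeology (manifoldDiffeology EM M) (manifoldDiffeology ER R))
    (fun z => 𝒢.unit z.1 = π z.2)

/-- The 1-form `ε^*θ + π^*ε₂^*η` on `ε^*R`. -/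
def unitConnection (𝒢 : LieGroupoid EM M EG G) (π : R → G)
    (θ : DForm (manifoldDiffeology ER R) 1) (η : DForm 𝒢.smooth₂ 1) :
    DForm (unitBundleSmooth ER 𝒢 π) 1 :=
  θ.pullback (fun z : UnitBundle 𝒢 π => z.1.2) (smoothMap_snd _ _ _) +
    (η.pullback 𝒢.unit₂ 𝒢.smooth_unit₂).pullback (fun z : UnitBundle 𝒢 π => z.1.1)
      (smoothMap_fst _ _ _)

/-- `e : M → R` is (the second component of) a smooth global section of `ε^*R → M` that is
horizontal for the connection `ε^*θ + π^*ε₂^*η`. -/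
def IsHorizontalUnit (𝒢 : LieGroupoid EM M EG G) (π : R → G)
    (θ : DForm (manifoldDiffeology ER R) 1) (η : DForm 𝒢.smooth₂ 1) (e : M → R) : Prop :=
  ∃ (he : ∀ x, 𝒢.unit x = π (e x))
    (hs : SmoothMap (manifoldDiffeology EM M) (unitBundleSmooth ER 𝒢 π)
      (fun x => (⟨(x, e x), he x⟩ : UnitBundle 𝒢 π))),
    (unitConnection 𝒢 π θ η).pullback _ hs = 0

/-- The Lie groupoid `K = (R ⇉ M)` together with `π : R → G` and the circle action on `R` is an
`S¹`-central extension of `𝒢 = (G ⇉ M)`: `(π, id)` is a morphism of Lie groupoids, `π` is a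
principal circle bundle, and `(s • x)(t • y) = st • (xy)`. -/
structure IsCentralExtension (𝒢 : LieGroupoid EM M EG G) (π : R → G)
    (K : LieGroupoid EM M ER R) : Prop where
  principal : IsPrincipalCircleBundle EG ER π
  src_proj : ∀ r, 𝒢.src (π r) = K.src r
  tgt_proj : ∀ r, 𝒢.tgt (π r) = K.tgt r
  proj_unit : ∀ x, π (K.unit x) = 𝒢.unit x
  proj_mul : ∀ (x y : R) (hxy : K.tgt x = K.src y), π (K.mul x y hxy) =
    𝒢.mul (π x) (π y) ((tgt_proj x).trans (hxy.trans (src_proj y).symm))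
  smul_mul_smul : ∀ (s t : Circle) (x y : R) (hxy : K.tgt x = K.src y),
    K.mul (s • x) (t • y) (by
      rw [← tgt_proj, ← src_proj, principal.proj_smul, principal.proj_smul, tgt_proj, src_proj,
        hxy]) =
      (s * t) • K.mul x y hxy

namespace IsCentralExtension

variable {𝒢 : LieGroupoid EM M EG G} {π : R → G} {K : LieGroupoid EM M ER R}

/-- The map `R₂ → G₂` induced by `π`. -/
def proj₂ (h : IsCentralExtension 𝒢 π K) (z : K.Comp₂) : 𝒢.Comp₂ :=
  ⟨(π z.1.1, π z.1.2), (h.tgt_proj _).trans (z.2.trans (h.src_proj _).symm)⟩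

theorem smooth_proj₂ (h : IsCentralExtension 𝒢 π K) :
    SmoothMap K.smooth₂ 𝒢.smooth₂ h.proj₂ :=
  fun _ _ hp => ⟨h.principal.smooth_proj.comp hp.1, h.principal.smooth_proj.comp hp.2⟩

/-- `η + κ` is the pseudo-curvature of the connection form `θ` on the central extension `R`. With
`δ = (-1)^p d + ∂` this says `π^*(η + κ) = -δθ`, where `-δθ` has the components `-∂θ ∈ Ω¹(R₂)` and
`dθ ∈ Ω²(R)`; the overall sign is the one for which the component `κ` in `Ω²(G)` is the curvature
of `θ`. -/
def HasPseudoCurvature (h : IsCentralExtension 𝒢 π K) (θ : DForm (manifoldDiffeology ER R) 1)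
    (η : DForm 𝒢.smooth₂ 1) (κ : DForm (manifoldDiffeology EG G) 2) : Prop :=
  IsConnection h.principal θ ∧
  η.pullback h.proj₂ h.smooth_proj₂ = -K.del₁ θ ∧
  κ.pullback π (smoothMap_of_contMDiff h.principal.smooth_proj) = θ.d

end IsCentralExtension

end Extension

end

/-! The condition `π^*η = -∂θ` says that along every family of composable pairs the product of `R`
satisfies `θ(xy) = θ(x) + θ(y) + η(πx, πy)`. So the product has to be a horizontal section of a
circle bundle: the pullback of `R` along the multiplication of `𝒢`, over the pairs in `R` with
composable images, with `θ` corrected by the 1-form on the right (`pairForm`). The equation `dη + ∂κ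
= 0` makes this connection flat (`d_pairForm`). Hence every plot of pairs has a horizontal lift with
a prescribed value at one point, and only one: locally by the Poincaré lemma, globally by unique
continuation (`exists_isLift`, `IsLift.unique`).

The law `x · e = x` fixes the product on the pairs `(x, e)`, and every pair with first factor `x` is
reached from there by moving the second factor in a connected source fibre. `IsProd` is the relation
obtained in this way. What has to be excluded is holonomy, which would make it multivalued. By
flatness, transport in the first factor commutes with transport in the second (`IsProd.move_left`).
So the first factor can be moved to a unit along its target fibre, which is connected because
inversion exchanges source and target fibres. At a unit the transport is `e · y = y`, without
holonomy (`IsProd.eq_of_unit_left`), and `IsProd.unique` follows. Both unit laws are horizontal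
because `e` is and because `∂η = 0` evaluates `η` on pairs containing a unit.

For smoothness, the relation must persist along families in which both factors vary
(`IsProdLift.isProd`). This holds near units and is carried along source fibres by neighbourhoods
adapted to the source submersion; the pointwise products along a plot are then a horizontal lift.
Associativity holds because, as functions of the third factor, both bracketings have the same
connection form by `∂η = 0` and agree at a unit. A competing groupoid structure with unit `e` and
the same pseudo-curvature has a horizontal product with the same values at units, hence the same
product. The section `e` itself exists because `ε^*R` is flat: it is transported from one chosen
point over each path component of `M`, consistently since there is no holonomy. -/

open Topology Filter

/-! ## Calculus of forms along plots -/

/-- The standard Euclidean space of dimension `n`, the domain of plots. -/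
abbrev Euc (n : ℕ) : Type := EuclideanSpace ℝ (Fin n)

/-- Every neighbourhood of a point contains the image of a smooth map that is the identity near
that point. -/
theorem exists_contDiff_eventuallyEq_id {n : ℕ} {x : Euc n} {u : Set (Euc n)} (hu : u ∈ 𝓝 x) :
    ∃ f : Euc n → Euc n, ContDiff ℝ ∞ f ∧ f =ᶠ[𝓝 x] id ∧ ∀ y, f y ∈ u := by
  obtain ⟨r, hr, hru⟩ := Metric.mem_nhds_iff.1 hu
  -- The map `y ↦ x + b y • (y - x)` is the identity where `b = 1` and collapses everything outside
  -- the ball of radius `r / 2` to `x`, so its image stays in the ball of radius `r`.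
  let b : ContDiffBump x := ⟨r / 4, r / 2, by positivity, by linarith⟩
  refine ⟨fun y => x + b y • (y - x),
    contDiff_const.add (b.contDiff.smul (contDiff_id.sub contDiff_const)), ?_, fun y => hru ?_⟩
  · filter_upwards [b.eventuallyEq_one] with y hy
    simp [hy]
  · rw [Metric.mem_ball, dist_eq_norm, add_sub_cancel_left, norm_smul,
      Real.norm_of_nonneg b.nonneg]
    by_cases hy : dist y x < r / 2
    · rw [dist_eq_norm] at hy
      calc b y * ‖y - x‖ ≤ 1 * ‖y - x‖ := by
            gcongr
            exact b.le_one
        _ < r := by linarith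
    · have : b y = 0 := b.zero_of_le_dist (not_lt.1 hy)
      simpa [this] using hr

namespace DForm

variable {X Y : Type*} {D : DiffeologicalSpace X} {D' : DiffeologicalSpace Y} {k : ℕ}

theorem along_congr (α : DForm D k) {n : ℕ} {p q : Euc n → X} (hp : p ∈ D.plots n)
    (hq : q ∈ D.plots n) (h : p = q) (x : Euc n) : α.along n p hp x = α.along n q hq x := by
  subst h
  rfl

/-- Locality of forms: after precomposition with a smooth map that is the identity near `x` and
takes values where `p = q`, the two plots coincide, and the derivative of that map at `x` is the
identity. -/
theorem along_congr_of_eventuallyEq (α : DForm D k) {n : ℕ} {p q : Euc n → X}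
    (hp : p ∈ D.plots n) (hq : q ∈ D.plots n) {x : Euc n} (h : p =ᶠ[𝓝 x] q) :
    α.along n p hp x = α.along n q hq x := by
  obtain ⟨f, hf, hfx, hfu⟩ := exists_contDiff_eventuallyEq_id h
  have hpq : p ∘ f = q ∘ f := funext hfu
  have hd : fderiv ℝ f x = ContinuousLinearMap.id ℝ _ := by
    rw [hfx.fderiv_eq, fderiv_id]
  have hx : f x = x := hfx.self_of_nhds
  have h1 := α.reparam n n p hp f hf x
  have h2 := α.reparam n n q hq f hf x
  rw [hd, hx] at h1 h2
  rw [α.along_congr (D.plot_reparam hp hf) (D.plot_reparam hq hf) hpq x] at h1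
  have h3 := h1.symm.trans h2
  ext v
  have := congrArg (fun A => A v) h3
  simpa using this

/-- A constant plot is its own reparametrization by a constant map, whose derivative is zero; in
positive degree this kills the form. -/
theorem along_const (α : DForm D (k + 1)) {n : ℕ} (z : X) (h : (fun _ => z) ∈ D.plots n)
    (x : Euc n) : α.along n (fun _ => z) h x = 0 := by
  have h1 := α.reparam n n (fun _ => z) h (fun _ => (0 : Euc n)) contDiff_const x
  have h2 : α.along n (fun _ => z) h x =
    (α.along n (fun _ => z) h 0).compContinuousLinearMap (fderiv ℝ (fun _ => (0 : Euc n)) x) := h1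
  rw [h2]
  ext v
  have : (fun i : Fin (k + 1) => (0 : Euc n)) = 0 := rfl
  simp only [fderiv_fun_const, ContinuousAlternatingMap.compContinuousLinearMap_apply]
  exact ContinuousAlternatingMap.map_zero _

theorem d_along (α : DForm D k) {n : ℕ} {p : Euc n → X} (hp : p ∈ D.plots n) (x : Euc n) :
    α.d.along n p hp x = extDeriv (α.along n p hp) x := rfl

theorem ext_along {α β : DForm D k}
    (h : ∀ (n : ℕ) (p : Euc n → X) (hp : p ∈ D.plots n) (x : Euc n),
      α.along n p hp x = β.along n p hp x) : α = β := by
  ext n p hp : 4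
  exact funext (h n p hp)

theorem d_add_along (α β : DForm D k) {n : ℕ} {p : Euc n → X} (hp : p ∈ D.plots n) (x : Euc n) :
    (α + β).d.along n p hp x = α.d.along n p hp x + β.d.along n p hp x :=
  extDeriv_add ((α.smooth n p hp).contDiffAt.differentiableAt (by simp))
    ((β.smooth n p hp).contDiffAt.differentiableAt (by simp))

theorem d_neg_along (α : DForm D k) {n : ℕ} {p : Euc n → X} (hp : p ∈ D.plots n) (x : Euc n) :
    (-α).d.along n p hp x = -α.d.along n p hp x := by
  have h := extDeriv_smul (x := x) (-1 : ℝ) (α.along n p hp)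
  simp only [neg_smul, one_smul] at h
  exact h

/-- The value of a 1-form along a plot, as a linear form. -/
noncomputable def lin (α : DForm D 1) {n : ℕ} {p : Euc n → X} (hp : p ∈ D.plots n) (x : Euc n) :
    Euc n →L[ℝ] ℝ :=
  (ContinuousAlternatingMap.ofSubsingleton ℝ (Euc n) ℝ (0 : Fin 1)).symm (α.along n p hp x)

theorem lin_apply (α : DForm D 1) {n : ℕ} {p : Euc n → X} (hp : p ∈ D.plots n) (x v : Euc n) :
    α.lin hp x v = α.along n p hp x (fun _ => v) := rfl

theorem along_eq_ofSubsingleton (α : DForm D 1) {n : ℕ} {p : Euc n → X} (hp : p ∈ D.plots n)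
    (x : Euc n) : α.along n p hp x =
      ContinuousAlternatingMap.ofSubsingleton ℝ (Euc n) ℝ (0 : Fin 1) (α.lin hp x) :=
  ((ContinuousAlternatingMap.ofSubsingleton ℝ (Euc n) ℝ (0 : Fin 1)).apply_symm_apply _).symm

theorem ext_lin {α β : DForm D 1}
    (h : ∀ (n : ℕ) (p : Euc n → X) (hp : p ∈ D.plots n) (x : Euc n), α.lin hp x = β.lin hp x) :
    α = β :=
  ext_along fun n p hp x => by rw [along_eq_ofSubsingleton, along_eq_ofSubsingleton, h]

theorem lin_congr (α : DForm D 1) {n : ℕ} {p q : Euc n → X} (hp : p ∈ D.plots n)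
    (hq : q ∈ D.plots n) (h : p = q) (x : Euc n) : α.lin hp x = α.lin hq x := by
  subst h
  rfl

theorem lin_congr_of_eventuallyEq (α : DForm D 1) {n : ℕ} {p q : Euc n → X}
    (hp : p ∈ D.plots n) (hq : q ∈ D.plots n) {x : Euc n} (h : p =ᶠ[𝓝 x] q) :
    α.lin hp x = α.lin hq x := by
  rw [lin, lin, α.along_congr_of_eventuallyEq hp hq h]

theorem lin_comp (α : DForm D 1) {m n : ℕ} {p : Euc n → X} (hp : p ∈ D.plots n)
    {f : Euc m → Euc n} (hf : ContDiff ℝ ∞ f) (x : Euc m) :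
    α.lin (D.plot_reparam hp hf) x = (α.lin hp (f x)).comp (fderiv ℝ f x) := by
  ext v
  rw [lin_apply, α.reparam m n p hp f hf x]
  rfl

theorem lin_const (α : DForm D 1) {n : ℕ} (z : X) (h : (fun _ => z) ∈ D.plots n) (x : Euc n) :
    α.lin h x = 0 := by
  ext v
  rw [lin_apply, along_const]
  rfl

@[simp]
theorem lin_zero {n : ℕ} {p : Euc n → X} (hp : p ∈ D.plots n) (x : Euc n) :
    (0 : DForm D 1).lin hp x = 0 := rfl

@[simp]
theorem lin_add (α β : DForm D 1) {n : ℕ} {p : Euc n → X} (hp : p ∈ D.plots n) (x : Euc n) :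
    (α + β).lin hp x = α.lin hp x + β.lin hp x := rfl

@[simp]
theorem lin_neg (α : DForm D 1) {n : ℕ} {p : Euc n → X} (hp : p ∈ D.plots n) (x : Euc n) :
    (-α).lin hp x = -α.lin hp x := rfl

@[simp]
theorem lin_sub (α β : DForm D 1) {n : ℕ} {p : Euc n → X} (hp : p ∈ D.plots n) (x : Euc n) :
    (α - β).lin hp x = α.lin hp x - β.lin hp x :=
  (sub_eq_add_neg (α.lin hp x) (β.lin hp x)).symm

theorem contDiff_lin (α : DForm D 1) {n : ℕ} {p : Euc n → X} (hp : p ∈ D.plots n) :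
    ContDiff ℝ ∞ (α.lin hp) :=
  (ContinuousAlternatingMap.ofSubsingletonLIE (𝕜 := ℝ) (E := Euc n) (F := ℝ) (i := (0 : Fin 1))).symm.contDiff.comp
    (α.smooth n p hp)

/-- The exterior derivative of a 1-form in terms of the derivative of its linear forms. -/
theorem d_along_apply (α : DForm D 1) {n : ℕ} {p : Euc n → X} (hp : p ∈ D.plots n)
    (x v w : Euc n) : α.d.along n p hp x ![v, w] =
      fderiv ℝ (α.lin hp) x v w - fderiv ℝ (α.lin hp) x w v := by
  have hd : DifferentiableAt ℝ (α.lin hp) x :=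
    (α.contDiff_lin hp).contDiffAt.differentiableAt (by simp)
  have key : ∀ a b : Euc n, fderiv ℝ (fun y => α.along n p hp y (fun _ => a)) x b =
      fderiv ℝ (α.lin hp) x b a := by
    intro a b
    have : (fun y => α.along n p hp y (fun _ => a)) = fun y => α.lin hp y a := rfl
    rw [this, fderiv_clm_apply hd (by fun_prop)]
    simp
  rw [d_along, extDeriv_apply ((α.smooth n p hp).contDiffAt.differentiableAt (by simp))]
  rw [Fin.sum_univ_two]
  have h0 : (Fin.removeNth 0 ![v, w] : Fin 1 → Euc n) = fun _ => w := by
    ext i; fin_cases i; rfl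
  have h1 : (Fin.removeNth 1 ![v, w] : Fin 1 → Euc n) = fun _ => v := by
    ext i; fin_cases i; rfl
  rw [h0, h1, key, key]
  simp
  ring

end DForm

/-! ## The logarithm on the circle -/

/-- The logarithm `e^{2πit} ↦ t` on the circle, with values in `(-1/2, 1/2]`. -/
noncomputable def circleLog (z : Circle) : ℝ := Complex.arg z / (2 * Real.pi)

theorem exp_circleLog (z : Circle) : Circle.exp (2 * Real.pi * circleLog z) = z := by
  rw [circleLog, mul_div_cancel₀ _ (by positivity), Circle.exp_arg]

theorem circleLog_one : circleLog 1 = 0 := by simp [circleLog]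

theorem contMDiff_circle_coe : ContMDiff (𝓡 1) 𝓘(ℝ, ℂ) ∞ (fun z : Circle => (z : ℂ)) := by
  have : Fact (Module.finrank ℝ ℂ = 1 + 1) := finrank_real_complex_fact'
  exact contMDiff_coe_sphere

/-- The argument is the imaginary part of the complex logarithm, which is smooth away from the
negative real axis. -/
theorem contMDiffAt_circleLog {z : Circle} (hz : (z : ℂ) ∈ Complex.slitPlane) :
    ContMDiffAt (𝓡 1) 𝓘(ℝ, ℝ) ∞ circleLog z := by
  have h1 : ContDiffAt ℝ ∞ (fun w : ℂ => (Complex.log w).im / (2 * Real.pi)) (z : ℂ) := by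
    have : ContDiffAt ℝ ∞ Complex.log (z : ℂ) := (Complex.contDiffAt_log hz).restrict_scalars ℝ
    exact (Complex.imCLM.contDiff.contDiffAt.comp _ this).div_const _
  have h2 := h1.contMDiffAt.comp z contMDiff_circle_coe.contMDiffAt
  refine h2.congr_of_eventuallyEq (Eventually.of_forall fun w => ?_)
  change circleLog w = (Complex.log (w : ℂ)).im / (2 * Real.pi)
  rw [circleLog, Complex.log_im]

/-! ## Circle bundles along plots -/

section Bundle

variable {EG : Type*} [NormedAddCommGroup EG] [NormedSpace ℝ EG]
  {G : Type*} [TopologicalSpace G] [ChartedSpace EG G]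
  {ER : Type*} [NormedAddCommGroup ER] [NormedSpace ℝ ER]
  {R : Type*} [TopologicalSpace R] [ChartedSpace ER R] [MulAction Circle R]
  {π : R → G}

/-- The fibre coordinate `φ` of a local trivialization is equivariant, `φ (z • r) = z * φ r`, so the
action is free. -/
theorem IsPrincipalCircleBundle.smul_right_injective (hπ : IsPrincipalCircleBundle EG ER π)
    (r : R) {z w : Circle} (h : z • r = w • r) : z = w := by
  obtain ⟨U, -, hr, σ, φ, -, -, -, h2, h3⟩ := hπ.locally_trivial (π r)
  have h4 := h3 r hr
  have h5 : ∀ z : Circle, φ (z • r) = z * φ r := fun z => by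
    conv_lhs => rw [← h4, smul_smul]
    rw [h2 _ hr]
  have := congrArg φ h
  rw [h5, h5] at this
  exact mul_right_cancel this

theorem IsPrincipalCircleBundle.exists_smul_eq (hπ : IsPrincipalCircleBundle EG ER π)
    {r r' : R} (h : π r = π r') : ∃ z : Circle, z • r = r' := by
  obtain ⟨U, -, hr, σ, φ, -, -, -, -, h3⟩ := hπ.locally_trivial (π r)
  refine ⟨φ r' * (φ r)⁻¹, ?_⟩
  have h4 := h3 r hr
  have h5 := h3 r' (h ▸ hr)
  rw [← h] at h5
  have h6 : (φ r' * (φ r)⁻¹) • r = (φ r' * (φ r)⁻¹) • φ r • σ (π r) := by rw [h4]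
  rw [h6, smul_smul, inv_mul_cancel_right, h5]

theorem IsPrincipalCircleBundle.smul_mem_plots (hπ : IsPrincipalCircleBundle EG ER π) {n : ℕ}
    {z : Euc n → Circle} (hz : ContMDiff 𝓘(ℝ, Euc n) (𝓡 1) ∞ z) {q : Euc n → R}
    (hq : q ∈ (manifoldDiffeology ER R).plots n) :
    (fun y => z y • q y) ∈ (manifoldDiffeology ER R).plots n := by
  have := hπ.smooth_smul
  exact (ContMDiffSMul.contMDiff_smul (I := 𝓡 1) (I' := 𝓘(ℝ, ER)) (n := ∞) (G := Circle)
    (M := R)).comp (hz.prodMk hq)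

theorem contMDiff_exp_two_pi {n : ℕ} {u : Euc n → ℝ} (hu : ContDiff ℝ ∞ u) :
    ContMDiff 𝓘(ℝ, Euc n) (𝓡 1) ∞ (fun y => Circle.exp (2 * Real.pi * u y)) :=
  contMDiff_circleExp.comp (contDiff_const.mul hu).contMDiff

/-- Two plots over the same plot of the base differ locally by a smooth circle-valued function. -/
theorem IsPrincipalCircleBundle.exists_ratio (hπ : IsPrincipalCircleBundle EG ER π) {n : ℕ}
    {q q' : Euc n → R} (hq : q ∈ (manifoldDiffeology ER R).plots n)
    (hq' : q' ∈ (manifoldDiffeology ER R).plots n) {y₀ : Euc n}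
    (h : ∀ᶠ y in 𝓝 y₀, π (q y) = π (q' y)) :
    ∃ z : Euc n → Circle, ∀ᶠ y in 𝓝 y₀,
      ContMDiffAt 𝓘(ℝ, Euc n) (𝓡 1) ∞ z y ∧ q' y = z y • q y := by
  obtain ⟨U, hU, hr, σ, φ, -, hφ, -, -, h3⟩ := hπ.locally_trivial (π (q y₀))
  have hcont : ∀ {p : Euc n → R}, p ∈ (manifoldDiffeology ER R).plots n →
      Continuous (fun y => π (p y)) := fun hp =>
    hπ.smooth_proj.continuous.comp (ContMDiff.continuous hp)
  have hUp : IsOpen (π ⁻¹' U) := hU.preimage hπ.smooth_proj.continuous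
  refine ⟨fun y => φ (q' y) * (φ (q y))⁻¹, ?_⟩
  have e1 : ∀ᶠ y in 𝓝 y₀, π (q y) ∈ U := (hcont hq).continuousAt.eventually_mem (hU.mem_nhds hr)
  filter_upwards [e1, h] with y h1 h2
  constructor
  · have a1 : ContMDiffAt 𝓘(ℝ, Euc n) (𝓡 1) ∞ (fun y => φ (q y)) y :=
      (hφ.contMDiffAt (hUp.mem_nhds h1)).comp y (ContMDiff.contMDiffAt hq)
    have a2 : ContMDiffAt 𝓘(ℝ, Euc n) (𝓡 1) ∞ (fun y => φ (q' y)) y :=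
      (hφ.contMDiffAt (hUp.mem_nhds (by rw [Set.mem_preimage, ← h2]; exact h1))).comp y
        (ContMDiff.contMDiffAt hq')
    exact a2.mul a1.inv
  · have b1 := h3 (q y) h1
    have b2 := h3 (q' y) (h2 ▸ h1)
    rw [← h2] at b2
    have b3 : (φ (q' y) * (φ (q y))⁻¹) • q y =
        (φ (q' y) * (φ (q y))⁻¹) • φ (q y) • σ (π (q y)) := by rw [b1]
    rw [b3, smul_smul, inv_mul_cancel_right, b2]

variable {hπ : IsPrincipalCircleBundle EG ER π} {θ : DForm (manifoldDiffeology ER R) 1}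

theorem IsConnection.lin_const_smul (hθ : IsConnection hπ θ) {n : ℕ} (z : Circle) {q : Euc n → R}
    (hq : q ∈ (manifoldDiffeology ER R).plots n)
    (hzq : (fun y => z • q y) ∈ (manifoldDiffeology ER R).plots n) (y : Euc n) :
    θ.lin hzq y = θ.lin hq y := by
  have := congrArg (fun α => DForm.lin α hq y) (hθ.invariant z)
  exact this

/-- The product rule for a connection form. -/
theorem IsConnection.lin_exp_smul (hθ : IsConnection hπ θ) {n : ℕ} {u : Euc n → ℝ}
    (hu : ContDiff ℝ ∞ u) {q : Euc n → R} (hq : q ∈ (manifoldDiffeology ER R).plots n)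
    (hzq : (fun y => Circle.exp (2 * Real.pi * u y) • q y) ∈ (manifoldDiffeology ER R).plots n)
    (y : Euc n) : θ.lin hzq y = θ.lin hq y + fderiv ℝ u y := by
  -- The plot `Ψ (t, y) = e^{2πit} • q y` of `ℝ × Euc n`, moved to `Euc (n + 1)` by `L`, contains
  -- all the data. Its restriction to the graph of `u` is the rotated plot, to a slice `t = u y` a
  -- constant rotation of `q`, and to a line `y = const` an orbit.
  let L : (ℝ × Euc n) ≃L[ℝ] Euc (n + 1) := ContinuousLinearEquiv.ofFinrankEq (by
    simp [Module.finrank_prod, add_comm])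
  let Ψ : Euc (n + 1) → R := fun w => Circle.exp (2 * Real.pi * (L.symm w).1) • q (L.symm w).2
  have hΨ : Ψ ∈ (manifoldDiffeology ER R).plots (n + 1) :=
    hπ.smul_mem_plots (contMDiff_exp_two_pi (u := fun w => (L.symm w).1) (by fun_prop))
      ((manifoldDiffeology ER R).plot_reparam hq (f := fun w => (L.symm w).2) (by fun_prop))
  have hud : DifferentiableAt ℝ u y := hu.contDiffAt.differentiableAt (by simp)
  have hf : ContDiff ℝ ∞ (fun y => L (u y, y)) := by fun_prop
  have hg : ContDiff ℝ ∞ (fun y' => L (u y, y')) := by fun_prop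
  have hh : ContDiff ℝ ∞ (fun t : Euc 1 => L (t 0, y)) := by fun_prop
  have h1 := θ.lin_comp hΨ hf y
  have h2 := θ.lin_comp hΨ hg y
  have e1 : Ψ ∘ (fun y => L (u y, y)) = fun y => Circle.exp (2 * Real.pi * u y) • q y := by
    ext y'; simp [Ψ]
  have e2 : Ψ ∘ (fun y' => L (u y, y')) = fun y' => Circle.exp (2 * Real.pi * u y) • q y' := by
    ext y'; simp [Ψ]
  have e3 : Ψ ∘ (fun t : Euc 1 => L (t 0, y)) =
      fun t : Euc 1 => Circle.exp (2 * Real.pi * t 0) • q y := by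
    ext y'; simp [Ψ]
  have d1 : HasFDerivAt (fun y => L (u y, y))
      ((L : (ℝ × Euc n) →L[ℝ] Euc (n + 1)).comp
        ((fderiv ℝ u y).prod (ContinuousLinearMap.id ℝ (Euc n)))) y :=
    L.hasFDerivAt.comp y (hud.hasFDerivAt.prodMk (hasFDerivAt_id y))
  have d2 : HasFDerivAt (fun y' => L (u y, y'))
      ((L : (ℝ × Euc n) →L[ℝ] Euc (n + 1)).comp
        ((0 : Euc n →L[ℝ] ℝ).prod (ContinuousLinearMap.id ℝ (Euc n)))) y :=
    L.hasFDerivAt.comp y ((hasFDerivAt_const (u y) y).prodMk (hasFDerivAt_id y))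
  have d3 : ∀ t : Euc 1, HasFDerivAt (fun t : Euc 1 => L (t 0, y))
      ((L : (ℝ × Euc n) →L[ℝ] Euc (n + 1)).comp
        ((EuclideanSpace.proj (0 : Fin 1)).prod (0 : Euc 1 →L[ℝ] Euc n))) t := fun t =>
    L.hasFDerivAt.comp t ((EuclideanSpace.proj (𝕜 := ℝ) (0 : Fin 1)).hasFDerivAt.prodMk
      (hasFDerivAt_const y t))
  rw [d1.fderiv] at h1
  rw [d2.fderiv] at h2
  have k1 : θ.lin hzq y = _ := (θ.lin_congr hzq _ e1.symm y).trans h1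
  have hzc : (fun y' => Circle.exp (2 * Real.pi * u y) • q y') ∈
      (manifoldDiffeology ER R).plots n := hπ.smul_mem_plots contMDiff_const hq
  have k2 : θ.lin hq y = _ :=
    (hθ.lin_const_smul _ hq hzc y).symm.trans ((θ.lin_congr hzc _ e2.symm y).trans h2)
  rw [k1, k2]
  ext v
  let τ : Euc 1 := EuclideanSpace.single 0 (fderiv ℝ u y v)
  let t₀ : Euc 1 := EuclideanSpace.single 0 (u y)
  have h3 := θ.lin_comp hΨ hh t₀
  rw [(d3 t₀).fderiv] at h3
  have k3 : θ.lin (hπ.orbit_mem_plots (q y)) t₀ = _ := (θ.lin_congr _ _ e3.symm t₀).trans h3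
  have k4 := congrArg (fun A => A τ) k3
  have k5 : θ.lin (hπ.orbit_mem_plots (q y)) t₀ τ = fderiv ℝ u y v :=
    (hθ.vertical (q y) t₀ τ).trans (by simp [τ])
  simp only [k5] at k4
  have ht : t₀ 0 = u y := by simp [t₀]
  have hτ : (EuclideanSpace.proj (0 : Fin 1) : Euc 1 →L[ℝ] ℝ) τ = fderiv ℝ u y v := by
    simp [τ]
  simp only [ContinuousLinearMap.comp_apply, add_apply, ContinuousLinearMap.prod_apply, zero_apply,
    ContinuousLinearMap.id_apply, ContinuousLinearEquiv.coe_coe,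
    ht, hτ] at k4 ⊢
  -- A tangent vector of the graph is a slice vector plus an orbit vector: invariance evaluates `θ`
  -- on the first, the normalization on orbits evaluates it on the second.
  have hsplit : L (fderiv ℝ u y v, v) = L (0, v) + L (fderiv ℝ u y v, 0) := by
    rw [← map_add]; simp
  rw [hsplit, map_add, ← k4]

/-- Two plots over the same plot of the base on which the connection form takes the same values
differ locally by a constant. -/
theorem IsConnection.eventually_eq_smul (hθ : IsConnection hπ θ) {n : ℕ} {q q' : Euc n → R}
    (hq : q ∈ (manifoldDiffeology ER R).plots n) (hq' : q' ∈ (manifoldDiffeology ER R).plots n)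
    {y₀ : Euc n} (h : ∀ᶠ y in 𝓝 y₀, π (q y) = π (q' y))
    (hlin : ∀ᶠ y in 𝓝 y₀, θ.lin hq y = θ.lin hq' y) :
    ∃ z : Circle, ∀ᶠ y in 𝓝 y₀, q' y = z • q y := by
  obtain ⟨z, hz⟩ := hπ.exists_ratio hq hq' h
  have hzc := hz.self_of_nhds.1.continuousAt
  -- Divided by its value at `y₀`, the ratio is close to `1`, where it has a smooth logarithm `u`;
  -- the map `b` below makes `u` smooth on all of `Euc n`.
  have hslit : ∀ᶠ y in 𝓝 y₀, ((z y * (z y₀)⁻¹ : Circle) : ℂ) ∈ Complex.slitPlane := by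
    have : ContinuousAt (fun y => ((z y * (z y₀)⁻¹ : Circle) : ℂ)) y₀ :=
      contMDiff_circle_coe.continuous.continuousAt.comp (hzc.mul continuousAt_const)
    refine this.eventually_mem (Complex.isOpen_slitPlane.mem_nhds ?_)
    simp
  obtain ⟨b, hb, hbid, hbm⟩ := exists_contDiff_eventuallyEq_id ((hz.and hslit).and hlin)
  let u : Euc n → ℝ := fun y => circleLog (z (b y) * (z y₀)⁻¹)
  have hu : ContDiff ℝ ∞ u := by
    rw [← contMDiff_iff_contDiff]
    intro y
    obtain ⟨⟨⟨h1, -⟩, h2⟩, -⟩ := hbm y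
    have h3 : ContMDiffAt 𝓘(ℝ, Euc n) (𝓡 1) ∞ (fun y => z (b y) * (z y₀)⁻¹) y :=
      (h1.comp y hb.contMDiff.contMDiffAt).mul contMDiffAt_const
    exact (contMDiffAt_circleLog h2).comp y h3
  have hqb := (manifoldDiffeology ER R).plot_reparam hq hb
  have hqb' := (manifoldDiffeology ER R).plot_reparam hq' hb
  have hzq : (fun y => z y₀ • (q ∘ b) y) ∈ (manifoldDiffeology ER R).plots n :=
    hπ.smul_mem_plots contMDiff_const hqb
  have hezq := hπ.smul_mem_plots (contMDiff_exp_two_pi hu) hzq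
  have heq : q' ∘ b = fun y => Circle.exp (2 * Real.pi * u y) • z y₀ • (q ∘ b) y := by
    ext y
    have := (hbm y).1.1.2
    simp only [Function.comp_apply, u, exp_circleLog, smul_smul, inv_mul_cancel_right, this]
  -- By the product rule `du` is the difference of the values of `θ` along the two plots, which
  -- vanishes by hypothesis.
  have hd : ∀ y, fderiv ℝ u y = 0 := fun y => by
    have h1 := hθ.lin_exp_smul hu hzq hezq y
    rw [hθ.lin_const_smul _ hqb hzq, ← θ.lin_congr hqb' hezq heq y, θ.lin_comp hq hb,
      θ.lin_comp hq' hb, (hbm y).2] at h1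
    simpa using h1
  have hconst : ∀ y, u y = 0 := fun y => by
    rw [is_const_of_fderiv_eq_zero (hu.differentiable (by simp)) hd y y₀]
    have : b y₀ = y₀ := hbid.self_of_nhds
    simp [u, this, circleLog_one]
  refine ⟨z y₀, ?_⟩
  filter_upwards [hbid] with y hy
  have := congrFun heq y
  simpa [hconst, show b y = y from hy] using this

end Bundle

/-! ## Gluing local solutions with unique continuation -/

section Gluing

variable {V Y : Type*} {good : (V → Y) → V → Prop}

/-- `good f v` stands for "`f` is a solution near `v`". Unique continuation splits `S` into two
relatively open pieces, where the solutions agree locally and where they differ locally. -/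
theorem eqOn_of_isPreconnected [TopologicalSpace V]
    (huniq : ∀ f g v, good f v → good g v → (∀ᶠ w in 𝓝 v, f w = g w) ∨ ∀ᶠ w in 𝓝 v, f w ≠ g w)
    {f g : V → Y} {S : Set V} (hS : IsPreconnected S) (hf : ∀ v ∈ S, good f v)
    (hg : ∀ v ∈ S, good g v) {w : V} (hw : w ∈ S) (hfg : f w = g w) : Set.EqOn f g S := by
  intro v hv
  by_contra hne
  obtain ⟨x, -, hx1, hx2⟩ := hS {v | ∀ᶠ w in 𝓝 v, f w = g w} {v | ∀ᶠ w in 𝓝 v, f w ≠ g w}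
    (isOpen_iff_mem_nhds.2 fun _ h => eventually_eventually_nhds.2 h)
    (isOpen_iff_mem_nhds.2 fun _ h => eventually_eventually_nhds.2 h)
    (fun x hx => huniq f g x (hf x hx) (hg x hx))
    ⟨w, hw, (huniq f g w (hf w hw) (hg w hw)).resolve_right fun h => h.self_of_nhds hfg⟩
    ⟨v, hv, (huniq f g v (hf v hv) (hg v hv)).resolve_left fun h => hne h.self_of_nhds⟩
  exact hx2.self_of_nhds hx1.self_of_nhds

variable [NormedAddCommGroup V] [NormedSpace ℝ V]

/-- Local solutions with unique continuation can be continued to the whole vector space. -/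
theorem exists_global_solution
    (hcongr : ∀ f g v, good f v → f =ᶠ[𝓝 v] g → good g v)
    (huniq : ∀ f g v, good f v → good g v → (∀ᶠ w in 𝓝 v, f w = g w) ∨ ∀ᶠ w in 𝓝 v, f w ≠ g w)
    (hex : ∀ v, ∃ B ∈ 𝓝 v, ∀ w ∈ B, ∀ f, good f w → ∃ g, g w = f w ∧ ∀ x ∈ B, good g x)
    {f₀ : V → Y} (hf₀ : good f₀ 0) : ∃ f, f 0 = f₀ 0 ∧ ∀ v, good f v := by
  -- Solutions on star-shaped open neighbourhoods of `0`. Intersections of such sets are connected,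
  -- so any two of these solutions agree on their overlap and all glue to one solution `F` on the
  -- union `Cs`.
  let P : Set V → (V → Y) → Prop := fun C f =>
    IsOpen C ∧ StarConvex ℝ 0 C ∧ (0 : V) ∈ C ∧ (∀ v ∈ C, good f v) ∧ f 0 = f₀ 0
  have hPeq : ∀ {C C' f f'}, P C f → P C' f' → Set.EqOn f f' (C ∩ C') := by
    rintro C C' f f' ⟨-, h2, h3, h4, h5⟩ ⟨-, k2, k3, k4, k5⟩
    exact eqOn_of_isPreconnected huniq
      ((h2.inter k2).isPathConnected ⟨h3, k3⟩).isConnected.isPreconnected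
      (fun v hv => h4 v hv.1) (fun v hv => k4 v hv.2) ⟨h3, k3⟩ (h5.trans k5.symm)
  let Cs : Set V := {v | ∃ C f, P C f ∧ v ∈ C}
  classical
  let F : V → Y := fun v => if h : ∃ C f, P C f ∧ v ∈ C then h.choose_spec.choose v else f₀ 0
  have hF : ∀ {C f}, P C f → Set.EqOn F f C := by
    intro C f hP v hv
    have h : ∃ C f, P C f ∧ v ∈ C := ⟨C, f, hP, hv⟩
    have hs := h.choose_spec.choose_spec
    simp only [F, dif_pos h]
    exact hPeq hs.1 hP ⟨hs.2, hv⟩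
  have hCso : IsOpen Cs := isOpen_iff_mem_nhds.2 fun v ⟨C, f, hP, hv⟩ =>
    mem_of_superset (hP.1.mem_nhds hv) fun w hw => ⟨C, f, hP, hw⟩
  have hCss : StarConvex ℝ 0 Cs := fun v ⟨C, f, hP, hv⟩ a b ha hb hab =>
    ⟨C, f, hP, hP.2.1 hv ha hb hab⟩
  have hCsm : ∀ {v}, v ∈ Cs → ∀ {t : ℝ}, 0 ≤ t → t ≤ 1 → t • v ∈ Cs := by
    intro v hv t h0 h1
    have := hCss hv (sub_nonneg.2 h1) h0 (by ring)
    simpa using this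
  have hFgood : ∀ v ∈ Cs, good F v := fun v ⟨C, f, hP, hv⟩ =>
    hcongr f F v (hP.2.2.2.1 v hv) (mem_of_superset (hP.1.mem_nhds hv) fun w hw => (hF hP hw).symm)
  have h0Cs : (0 : V) ∈ Cs := by
    obtain ⟨B, hB, hB'⟩ := hex 0
    obtain ⟨g, hg, hg'⟩ := hB' 0 (mem_of_mem_nhds hB) f₀ hf₀
    obtain ⟨ε, hε, hεB⟩ := Metric.mem_nhds_iff.1 hB
    exact ⟨Metric.ball 0 ε, g, ⟨Metric.isOpen_ball,
      (convex_ball 0 ε).starConvex (Metric.mem_ball_self hε), Metric.mem_ball_self hε,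
      fun v hv => hg' v (hεB hv), hg⟩, Metric.mem_ball_self hε⟩
  have hF0 : F 0 = f₀ 0 := by
    obtain ⟨C, f, hP, hv⟩ := h0Cs
    rw [hF hP hv, hP.2.2.2.2]
  refine ⟨F, hF0, fun y => hFgood y ?_⟩
  by_contra hy
  -- the first point of the segment from `0` to `y` outside `Cs`
  let T : Set ℝ := {t | 0 ≤ t ∧ t • y ∉ Cs}
  have hTc : IsClosed T := isClosed_Ici.inter
    (hCso.isClosed_compl.preimage (continuous_id.smul continuous_const))
  have hTb : BddBelow T := ⟨0, fun t ht => ht.1⟩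
  have hT : sInf T ∈ T := hTc.csInf_mem ⟨1, zero_le_one, by simpa using hy⟩ hTb
  set s := sInf T with hs
  have hs0 : 0 < s := by
    rcases hT.1.eq_or_lt with h | h
    · exact absurd h0Cs (by simpa [← h] using hT.2)
    · exact h
  have hlt : ∀ t, 0 ≤ t → t < s → t • y ∈ Cs := fun t h0 hts => by
    by_contra hc
    exact absurd (csInf_le hTb ⟨h0, hc⟩) (not_le.2 hts)
  obtain ⟨B, hB, hB'⟩ := hex (s • y)
  obtain ⟨ε, hε, hεB⟩ := Metric.mem_nhds_iff.1 hB
  -- The point `ρ • s • y` lies just before the exit point `s • y`: still in `Cs`, already in the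
  -- ball where a local solution `g` with the same value there is available.
  obtain ⟨ρ, hρ0, hρ1, hρB⟩ : ∃ ρ : ℝ, 0 < ρ ∧ ρ < 1 ∧ ρ • s • y ∈ Metric.ball (s • y) ε := by
    have hc : ContinuousAt (fun ρ : ℝ => ρ • s • y) 1 :=
      (continuous_id.smul continuous_const).continuousAt
    have h1 : ∀ᶠ ρ : ℝ in 𝓝[<] 1, ρ • s • y ∈ Metric.ball (s • y) ε :=
      nhdsWithin_le_nhds (hc.eventually_mem (by simpa using Metric.ball_mem_nhds _ hε))
    have h2 : ∀ᶠ ρ : ℝ in 𝓝[<] 1, ρ ∈ Set.Ioo (0 : ℝ) 1 :=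
      Ioo_mem_nhdsLT one_pos
    obtain ⟨ρ, h3, h4⟩ := (h1.and h2).exists
    exact ⟨ρ, h4.1, h4.2, h3⟩
  have hwCs : ρ • s • y ∈ Cs := by
    rw [smul_smul]
    exact hlt _ (by positivity) (by nlinarith)
  obtain ⟨g, hgw, hg⟩ := hB' _ (hεB hρB) F (hFgood _ hwCs)
  obtain ⟨δ, hδ, hδB⟩ := Metric.mem_nhds_iff.1
    ((hCso.inter Metric.isOpen_ball).mem_nhds ⟨hwCs, hρB⟩)
  have hgF : Set.EqOn F g (Metric.ball (ρ • s • y) δ) :=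
    eqOn_of_isPreconnected huniq (convex_ball _ _).isPreconnected
      (fun v hv => hFgood v (hδB hv).1) (fun v hv => hg v (hεB (hδB hv).2))
      (Metric.mem_ball_self hδ) hgw.symm
  -- The radial sweep, from scale `ρ` to scale `1`, of a small ball around `ρ • s • y`. It contains
  -- `s • y`, and `Cs ∪ S` is again star-shaped, since scaling a point of `S` down leads into the
  -- small ball, hence into `Cs`.
  let S : Set V := {v | ∃ a : ℝ, ρ ≤ a ∧ a ≤ 1 ∧
    ∃ w ∈ Metric.ball (s • y) ε, ρ • w ∈ Metric.ball (ρ • s • y) δ ∧ v = a • w}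
  have hSo : IsOpen S := by
    refine isOpen_iff_mem_nhds.2 ?_
    rintro v ⟨a, ha1, ha2, w, hw, hw', rfl⟩
    have ha : a ≠ 0 := (hρ0.trans_le ha1).ne'
    have hc : ContinuousAt (fun v : V => a⁻¹ • v) (a • w) :=
      (continuous_const_smul _).continuousAt
    have hc' : ContinuousAt (fun v : V => ρ • a⁻¹ • v) (a • w) :=
      ((continuous_const_smul _).comp (continuous_const_smul _)).continuousAt
    filter_upwards [hc.eventually_mem (Metric.isOpen_ball.mem_nhds (by
      simpa [smul_smul, inv_mul_cancel₀ ha] using hw)),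
      hc'.eventually_mem ((Metric.isOpen_ball (x := ρ • s • y) (ε := δ)).mem_nhds (by
      simpa only [smul_smul, mul_assoc, inv_mul_cancel₀ ha, mul_one] using hw'))] with v h1 h2
    exact ⟨a, ha1, ha2, a⁻¹ • v, h1, h2, by rw [smul_smul, mul_inv_cancel₀ ha, one_smul]⟩
  have hSball : ∀ w ∈ Metric.ball (s • y) ε, ρ • w ∈ Metric.ball (ρ • s • y) δ →
      ∀ a : ℝ, ρ ≤ a → a ≤ 1 → a • w ∈ Metric.ball (s • y) ε := by
    intro w hw hw' a ha1 ha2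
    have h1 := (hδB hw').2
    have h2 : (1 - a) / (1 - ρ) + (a - ρ) / (1 - ρ) = 1 := by
      have : 1 - ρ ≠ 0 := by linarith
      field_simp
      ring
    have h3 := convex_ball (s • y) ε h1 hw (div_nonneg (by linarith) (by linarith))
      (div_nonneg (by linarith) (by linarith)) h2
    have h4 : ((1 - a) / (1 - ρ)) • ρ • w + ((a - ρ) / (1 - ρ)) • w = a • w := by
      rw [smul_smul, ← add_smul]
      congr 1
      have : 1 - ρ ≠ 0 := by linarith
      field_simp
      ring
    rwa [h4] at h3
  -- The radial segment from `ρ • w` to `a • w` lies in `Cs` and in `B`. At its inner end `F = g`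
  -- because that end is in the small ball, so they agree along the whole segment.
  have hagree : ∀ v ∈ S, v ∈ Cs → F v = g v := by
    rintro v ⟨a, ha1, ha2, w, hw, hw', rfl⟩ hv
    have hseg : ∀ x ∈ (fun b : ℝ => b • w) '' Set.Icc ρ a, x ∈ Cs ∧ x ∈ B := by
      rintro x ⟨b, ⟨hb1, hb2⟩, rfl⟩
      refine ⟨?_, hεB (hSball w hw hw' b hb1 (hb2.trans ha2))⟩
      have ha : 0 < a := hρ0.trans_le ha1
      have := hCsm hv (t := b / a) (div_nonneg (hρ0.le.trans hb1) ha.le)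
        ((div_le_one ha).2 hb2)
      rwa [smul_smul, div_mul_cancel₀ _ ha.ne'] at this
    refine eqOn_of_isPreconnected huniq (S := (fun b : ℝ => b • w) '' Set.Icc ρ a)
      (isPreconnected_Icc.image _ (continuous_id.smul continuous_const).continuousOn)
      (fun x hx => hFgood x (hseg x hx).1) (fun x hx => hg x (hseg x hx).2)
      ⟨ρ, ⟨le_rfl, ha1⟩, rfl⟩ (hgF hw') ⟨a, ⟨ha1, le_rfl⟩, rfl⟩
  -- `F` and `g` glue to a solution on `Cs ∪ S`, which contains `s • y`; so `s • y` belongs to `Cs`,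
  -- a contradiction.
  refine hT.2 ⟨Cs ∪ S, fun v => if v ∈ Cs then F v else g v, ⟨hCso.union hSo, ?_, Or.inl h0Cs,
    ?_, ?_⟩, Or.inr ⟨1, hρ1.le, le_rfl, s • y, Metric.mem_ball_self hε, Metric.mem_ball_self hδ,
      (one_smul _ _).symm⟩⟩
  · rintro v hv b c hb hc hbc
    have hc1 : c ≤ 1 := by linarith
    rw [smul_zero, zero_add]
    rcases hv with hv | ⟨a, ha1, ha2, w, hw, hw', rfl⟩
    · exact Or.inl (hCsm hv hc hc1)
    · rcases le_total ρ (c * a) with h | h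
      · exact Or.inr ⟨c * a, h, by nlinarith, w, hw, hw', smul_smul _ _ _⟩
      · left
        have := hCsm (hδB hw').1 (t := c * a / ρ)
          (div_nonneg (mul_nonneg hc (hρ0.le.trans ha1)) hρ0.le) ((div_le_one hρ0).2 h)
        rwa [smul_smul, div_mul_cancel₀ _ hρ0.ne', ← smul_smul] at this
  · rintro v (hv | hv)
    · exact hcongr F _ v (hFgood v hv)
        (mem_of_superset (hCso.mem_nhds hv) fun w hw => (if_pos hw).symm)
    · have hvB : v ∈ B := by
        obtain ⟨a, ha1, ha2, w, hw, hw', rfl⟩ := hv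
        exact hεB (hSball w hw hw' a ha1 ha2)
      refine hcongr g _ v (hg v hvB) (mem_of_superset (hSo.mem_nhds hv) fun w hw => ?_)
      by_cases h : w ∈ Cs
      · exact ((if_pos h).trans (hagree w hw h)).symm
      · exact (if_neg h).symm
  · exact (if_pos h0Cs).trans hF0

end Gluing

/-! ## Lifts to a circle bundle with prescribed connection -/

section Lift

variable {G ER : Type*} [NormedAddCommGroup ER] [NormedSpace ℝ ER]
  {R : Type*} [TopologicalSpace R] [ChartedSpace ER R]
  {X : Type*} {D : DiffeologicalSpace X}

/-- `q` is a plot of `R` over the plot `f ∘ p` of `G`, and the connection form `θ` restricts along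
`q` to the same form as `β` along `p`. -/
structure IsLift (π : R → G) (θ : DForm (manifoldDiffeology ER R) 1) (f : X → G) (β : DForm D 1)
    {n : ℕ} (p : Euc n → X) (q : Euc n → R) : Prop where
  mem_base : p ∈ D.plots n
  mem : q ∈ (manifoldDiffeology ER R).plots n
  proj : ∀ y, π (q y) = f (p y)
  lin_eq : ∀ y, θ.lin mem y = β.lin mem_base y

variable {π : R → G} {θ : DForm (manifoldDiffeology ER R) 1} {f : X → G} {β : DForm D 1} {n : ℕ}

theorem IsLift.comp {p : Euc n → X} {q : Euc n → R} (h : IsLift π θ f β p q) {m : ℕ}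
    {g : Euc m → Euc n} (hg : ContDiff ℝ ∞ g) : IsLift π θ f β (p ∘ g) (q ∘ g) where
  mem_base := D.plot_reparam h.mem_base hg
  mem := (manifoldDiffeology ER R).plot_reparam h.mem hg
  proj y := h.proj (g y)
  lin_eq y := by rw [θ.lin_comp h.mem hg, β.lin_comp h.mem_base hg, h.lin_eq]

/-- `q` agrees near `y` with a plot of `R` that lifts `F` and along which `θ` is `α`. -/
def IsLiftAt (π : R → G) (θ : DForm (manifoldDiffeology ER R) 1) {n : ℕ} (F : Euc n → G)
    (α : Euc n → Euc n →L[ℝ] ℝ) (q : Euc n → R) (y : Euc n) : Prop :=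
  ∃ (q' : Euc n → R) (hq' : q' ∈ (manifoldDiffeology ER R).plots n), q' =ᶠ[𝓝 y] q ∧
    ∀ᶠ x in 𝓝 y, π (q' x) = F x ∧ θ.lin hq' x = α x

theorem IsLiftAt.congr {F : Euc n → G} {α : Euc n → Euc n →L[ℝ] ℝ} {q q' : Euc n → R} {y : Euc n}
    (h : IsLiftAt π θ F α q y) (hq : q =ᶠ[𝓝 y] q') : IsLiftAt π θ F α q' y := by
  obtain ⟨q₁, h1, h2, h3⟩ := h
  exact ⟨q₁, h1, h2.trans hq, h3⟩

theorem IsLift.isLiftAt {p : Euc n → X} {q : Euc n → R} (h : IsLift π θ f β p q) (y : Euc n) :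
    IsLiftAt π θ (fun x => f (p x)) (β.lin h.mem_base) q y :=
  ⟨q, h.mem, EventuallyEq.rfl, Eventually.of_forall fun x => ⟨h.proj x, h.lin_eq x⟩⟩

variable {EG : Type*} [NormedAddCommGroup EG] [NormedSpace ℝ EG] [TopologicalSpace G]
  [ChartedSpace EG G] [MulAction Circle R] {hπ : IsPrincipalCircleBundle EG ER π}

theorem IsLift.smul (hθ : IsConnection hπ θ) {p : Euc n → X} {q : Euc n → R}
    (h : IsLift π θ f β p q) (z : Circle) : IsLift π θ f β p (fun y => z • q y) where
  mem_base := h.mem_base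
  mem := hπ.smul_mem_plots contMDiff_const h.mem
  proj y := (hπ.proj_smul z _).trans (h.proj y)
  lin_eq y := (hθ.lin_const_smul z h.mem _ y).trans (h.lin_eq y)

/-- Unique continuation for lifts: locally two of them differ by a constant rotation `z`, and the
action is free, so they coincide if `z = 1` and differ everywhere nearby otherwise. -/
theorem IsLiftAt.eventually_eq_or_ne (hθ : IsConnection hπ θ) {F : Euc n → G}
    {α : Euc n → Euc n →L[ℝ] ℝ} {q q' : Euc n → R} {y : Euc n} (h : IsLiftAt π θ F α q y)
    (h' : IsLiftAt π θ F α q' y) : (∀ᶠ x in 𝓝 y, q x = q' x) ∨ ∀ᶠ x in 𝓝 y, q x ≠ q' x := by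
  obtain ⟨q₁, h1, h2, h3⟩ := h
  obtain ⟨q₁', h1', h2', h3'⟩ := h'
  obtain ⟨z, hz⟩ := hθ.eventually_eq_smul h1 h1'
    (by filter_upwards [h3, h3'] with x hx hx'; rw [hx.1, hx'.1])
    (by filter_upwards [h3, h3'] with x hx hx'; rw [hx.2, hx'.2])
  by_cases h1z : z = 1
  · left
    filter_upwards [hz, h2, h2'] with x a b c
    rw [← b, ← c, a, h1z, one_smul]
  · right
    filter_upwards [hz, h2, h2'] with x a b c
    rw [← b, ← c, a]
    intro h
    exact h1z (hπ.smul_right_injective (q₁ x) (by rw [← h, one_smul]))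

/-- A lift is determined by its value at one point. -/
theorem IsLift.unique (hθ : IsConnection hπ θ) {p : Euc n → X} {q q' : Euc n → R}
    (h : IsLift π θ f β p q) (h' : IsLift π θ f β p q') {y₀ : Euc n} (hy : q y₀ = q' y₀) :
    q = q' :=
  funext fun y => eqOn_of_isPreconnected
    (good := IsLiftAt π θ (fun x => f (p x)) (β.lin h.mem_base))
    (fun _ _ _ => IsLiftAt.eventually_eq_or_ne hθ) isPreconnected_univ
    (fun v _ => h.isLiftAt v) (fun v _ => h'.isLiftAt v) (Set.mem_univ y₀) hy (Set.mem_univ y)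

variable {κ : DForm (manifoldDiffeology EG G) 2}

/-- Local existence of lifts. -/
theorem exists_eventually_lift (hθ : IsConnection hπ θ) (hκ : HasCurvature hπ θ κ)
    (hf : SmoothMap D (manifoldDiffeology EG G) f) (hβ : β.d = κ.pullback f hf)
    {p : Euc n → X} (hp : p ∈ D.plots n) (y₀ : Euc n) :
    ∃ q, ∀ᶠ y in 𝓝 y₀, IsLiftAt π θ (fun x => f (p x)) (β.lin hp) q y := by
  obtain ⟨U, hU, hr, σ, φ, hσ, -, hπσ, -⟩ := hπ.locally_trivial (f (p y₀))
  have hfp : ContMDiff 𝓘(ℝ, Euc n) 𝓘(ℝ, EG) ∞ (f ∘ p) := hf n p hp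
  obtain ⟨b, hb, hbid, hbm⟩ := exists_contDiff_eventuallyEq_id
    ((hU.preimage hfp.continuous).mem_nhds (x := y₀) hr)
  have hpb := D.plot_reparam hp hb
  let s : Euc n → R := fun y => σ (f (p (b y)))
  have hs : s ∈ (manifoldDiffeology ER R).plots n := fun y =>
    (hσ.contMDiffAt (hU.mem_nhds (hbm y))).comp y ((hfp.comp hb.contMDiff).contMDiffAt)
  have hπs : π ∘ s = f ∘ (p ∘ b) := funext fun y => hπσ _ (hbm y)
  -- Rotating the section `s` by `e^{2πiu}` adds `du` to `θ` along it, so a lift amounts to a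
  -- solution of `du = γ`. The form `γ` is closed because `dβ` and `dθ` are both pullbacks of `κ`
  -- along the same map.
  let γ : Euc n → Euc n →L[ℝ] ℝ := fun y => β.lin hpb y - θ.lin hs y
  have hγ : ContDiff ℝ ∞ γ := (β.contDiff_lin hpb).sub (θ.contDiff_lin hs)
  have hsymm : ∀ y v w, fderiv ℝ γ y v w = fderiv ℝ γ y w v := by
    intro y v w
    have e1 := β.d_along_apply hpb y v w
    have e2 := θ.d_along_apply hs y v w
    have e3 : β.d.along n (p ∘ b) hpb y = κ.along n (f ∘ (p ∘ b)) (hf n _ hpb) y := by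
      rw [hβ]; rfl
    have e4 : θ.d.along n s hs y = κ.along n (f ∘ (p ∘ b)) (hf n _ hpb) y := by
      rw [show θ.d = _ from hκ]
      exact κ.along_congr _ _ hπs y
    rw [e3] at e1
    rw [e4] at e2
    have d1 : DifferentiableAt ℝ (β.lin hpb) y :=
      (β.contDiff_lin hpb).contDiffAt.differentiableAt (by simp)
    have d2 : DifferentiableAt ℝ (θ.lin hs) y :=
      (θ.contDiff_lin hs).contDiffAt.differentiableAt (by simp)
    have e5 : fderiv ℝ γ y = fderiv ℝ (β.lin hpb) y - fderiv ℝ (θ.lin hs) y :=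
      fderiv_sub d1 d2
    rw [e5]
    simp only [sub_apply]
    linarith
  -- The Poincaré lemma on all of `Euc n`; `γ` is defined everywhere because the plot was
  -- reparametrized into the trivializing set by `b`.
  obtain ⟨u, hu⟩ := convex_univ.exists_forall_hasFDerivAt_of_fderiv_symmetric isOpen_univ
    (hγ.differentiable (by simp)).differentiableOn fun y _ => hsymm y
  have hfu : fderiv ℝ u = γ := funext fun y => (hu y (Set.mem_univ y)).fderiv
  have huc : ContDiff ℝ ∞ u := contDiff_infty_iff_fderiv.2
    ⟨fun y => (hu y (Set.mem_univ y)).differentiableAt, hfu ▸ hγ⟩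
  have hq := hπ.smul_mem_plots (contMDiff_exp_two_pi huc) hs
  refine ⟨fun y => Circle.exp (2 * Real.pi * u y) • s y, ?_⟩
  filter_upwards [eventually_eventually_nhds.2 hbid] with y hy
  refine ⟨_, hq, EventuallyEq.rfl, ?_⟩
  filter_upwards [eventually_eventually_nhds.2 hy] with x hx
  constructor
  · rw [hπ.proj_smul]
    have h1 : b x = x := hx.self_of_nhds
    have := congrFun hπs x
    simpa [h1] using this
  · rw [hθ.lin_exp_smul huc hs hq, hfu]
    have : p ∘ b =ᶠ[𝓝 x] p := hx.mono fun a ha => congrArg p ha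
    simp only [γ]
    rw [add_sub_cancel, β.lin_congr_of_eventuallyEq hpb hp this]

/-- A constant rotation of a local lift is a local lift, so local lifts can be matched to any value
in the fibre. With unique continuation this is the input of `exists_global_solution`. -/
theorem exists_isLift_zero (hθ : IsConnection hπ θ) (hκ : HasCurvature hπ θ κ)
    (hf : SmoothMap D (manifoldDiffeology EG G) f) (hβ : β.d = κ.pullback f hf)
    {p : Euc n → X} (hp : p ∈ D.plots n) {r : R} (hr : π r = f (p 0)) :
    ∃ q, IsLift π θ f β p q ∧ q 0 = r := by
  have hrot : ∀ {q y} (z : Circle), IsLiftAt π θ (fun x => f (p x)) (β.lin hp) q y →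
      IsLiftAt π θ (fun x => f (p x)) (β.lin hp) (fun x => z • q x) y := by
    rintro q y z ⟨q', h1, h2, h3⟩
    refine ⟨fun x => z • q' x, hπ.smul_mem_plots contMDiff_const h1,
      h2.mono fun x hx => congrArg (z • ·) hx, ?_⟩
    filter_upwards [h3] with x hx
    exact ⟨(hπ.proj_smul z _).trans hx.1, (hθ.lin_const_smul z h1 _ x).trans hx.2⟩
  have hproj : ∀ {q y}, IsLiftAt π θ (fun x => f (p x)) (β.lin hp) q y → π (q y) = f (p y) := by
    rintro q y ⟨q', h1, h2, h3⟩
    rw [← h2.self_of_nhds, h3.self_of_nhds.1]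
  obtain ⟨q₀, h₀⟩ := exists_eventually_lift hθ hκ hf hβ hp 0
  obtain ⟨z₀, hz₀⟩ := hπ.exists_smul_eq ((hproj h₀.self_of_nhds).trans hr.symm)
  obtain ⟨q, hq0, hq⟩ := exists_global_solution
    (good := IsLiftAt π θ (fun x => f (p x)) (β.lin hp)) (fun _ _ _ => IsLiftAt.congr)
    (fun _ _ _ => IsLiftAt.eventually_eq_or_ne hθ)
    (fun v => by
      obtain ⟨q₁, h₁⟩ := exists_eventually_lift hθ hκ hf hβ hp v
      refine ⟨_, h₁, fun w hw g hg => ?_⟩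
      obtain ⟨z, hz⟩ := hπ.exists_smul_eq ((hproj hw).trans (hproj hg).symm)
      exact ⟨fun x => z • q₁ x, hz, fun x hx => hrot z hx⟩)
    (hrot z₀ h₀.self_of_nhds)
  have hqp : q ∈ (manifoldDiffeology ER R).plots n := fun y => by
    obtain ⟨q', h1, h2, h3⟩ := hq y
    exact (ContMDiff.contMDiffAt h1).congr_of_eventuallyEq h2.symm
  refine ⟨q, ⟨hp, hqp, fun y => hproj (hq y), fun y => ?_⟩, hq0.trans hz₀⟩
  obtain ⟨q', h1, h2, h3⟩ := hq y
  rw [← θ.lin_congr_of_eventuallyEq h1 hqp h2, h3.self_of_nhds.2]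

/-- **Existence of lifts.** If `dβ = f^*κ`, every plot of `X` lifts to the circle bundle, with
prescribed value at one point. -/
theorem exists_isLift (hθ : IsConnection hπ θ) (hκ : HasCurvature hπ θ κ)
    (hf : SmoothMap D (manifoldDiffeology EG G) f) (hβ : β.d = κ.pullback f hf)
    {p : Euc n → X} (hp : p ∈ D.plots n) (y₀ : Euc n) {r : R} (hr : π r = f (p y₀)) :
    ∃ q, IsLift π θ f β p q ∧ q y₀ = r := by
  have hg : ContDiff ℝ ∞ (fun y : Euc n => y + y₀) := by fun_prop
  have hg' : ContDiff ℝ ∞ (fun y : Euc n => y - y₀) := by fun_prop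
  obtain ⟨q, h1, h2⟩ := exists_isLift_zero hθ hκ hf hβ (D.plot_reparam hp hg) (r := r)
    (by simpa using hr)
  refine ⟨q ∘ fun y => y - y₀, ?_, by simpa using h2⟩
  have h3 := h1.comp hg'
  have h4 : (p ∘ fun y => y + y₀) ∘ (fun y => y - y₀) = p := by ext y; simp
  rwa [h4] at h3

end Lift

/-! ## Smooth maps of manifolds -/

/-- In finite dimensions an inverse chart, restricted by a smooth map into its domain, is a plot,
and `f` is locally its value along this plot composed with the chart. -/
theorem SmoothMap.contMDiff {E E' X Y : Type*} [NormedAddCommGroup E] [NormedSpace ℝ E]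
    [FiniteDimensional ℝ E] [NormedAddCommGroup E'] [NormedSpace ℝ E'] [TopologicalSpace X]
    [ChartedSpace E X] [IsManifold 𝓘(ℝ, E) ∞ X] [TopologicalSpace Y] [ChartedSpace E' Y]
    {f : X → Y} (hf : SmoothMap (manifoldDiffeology E X) (manifoldDiffeology E' Y) f) :
    ContMDiff 𝓘(ℝ, E) 𝓘(ℝ, E') ∞ f := by
  intro x
  let L : Euc (Module.finrank ℝ E) ≃L[ℝ] E := ContinuousLinearEquiv.ofFinrankEq (by simp)
  let φ := chartAt E x
  have hx : x ∈ φ.source := mem_chart_source E x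
  have hφ : ContMDiffOn 𝓘(ℝ, E) 𝓘(ℝ, E) ∞ φ φ.source := contMDiffOn_chart
  have hφs : ContMDiffOn 𝓘(ℝ, E) 𝓘(ℝ, E) ∞ φ.symm φ.target := contMDiffOn_chart_symm
  have hU : L ⁻¹' φ.target ∈ 𝓝 (L.symm (φ x)) :=
    (φ.open_target.preimage L.continuous).mem_nhds (by simpa using φ.map_source hx)
  obtain ⟨b, hb, hbid, hbm⟩ := exists_contDiff_eventuallyEq_id hU
  let p : Euc (Module.finrank ℝ E) → X := fun y => φ.symm (L (b y))
  have hp : ContMDiff 𝓘(ℝ, Euc (Module.finrank ℝ E)) 𝓘(ℝ, E) ∞ p := fun y =>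
    (hφs.contMDiffAt (φ.open_target.mem_nhds (hbm y))).comp y
      (L.contDiff.comp hb).contMDiff.contMDiffAt
  have hfp : ContMDiff 𝓘(ℝ, Euc (Module.finrank ℝ E)) 𝓘(ℝ, E') ∞ (f ∘ p) := hf _ p hp
  have hLφ : ContMDiffAt 𝓘(ℝ, E) 𝓘(ℝ, Euc (Module.finrank ℝ E)) ∞ (fun y => L.symm (φ y)) x :=
    L.symm.contDiff.contMDiff.contMDiffAt.comp x (hφ.contMDiffAt (φ.open_source.mem_nhds hx))
  refine (hfp.contMDiffAt.comp x hLφ).congr_of_eventuallyEq ?_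
  filter_upwards [hLφ.continuousAt.eventually hbid, φ.open_source.mem_nhds hx] with y hy hys
  have h1 : b (L.symm (φ y)) = L.symm (φ y) := hy
  simp only [Function.comp_apply, p, h1, ContinuousLinearEquiv.apply_symm_apply, φ.left_inv hys]

/-! ## Concatenation of lifts -/

section Concatenation

variable {G ER : Type*} [NormedAddCommGroup ER] [NormedSpace ℝ ER]
  {R : Type*} [TopologicalSpace R] [ChartedSpace ER R]
  {E X : Type*} [NormedAddCommGroup E] [NormedSpace ℝ E] [TopologicalSpace X] [ChartedSpace E X]
  {π : R → G} {θ : DForm (manifoldDiffeology ER R) 1} {f : X → G}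
  {β : DForm (manifoldDiffeology E X) 1}

theorem contMDiff_of_eqOn_halfLines {E Y : Type*} [NormedAddCommGroup E] [NormedSpace ℝ E]
    [TopologicalSpace Y] [ChartedSpace E Y] {c c₁ c₂ : Euc 1 → Y}
    (h₁ : ContMDiff 𝓘(ℝ, Euc 1) 𝓘(ℝ, E) ∞ c₁) (h₂ : ContMDiff 𝓘(ℝ, Euc 1) 𝓘(ℝ, E) ∞ c₂)
    (h : ∀ t, c =ᶠ[𝓝 t] c₁ ∨ c =ᶠ[𝓝 t] c₂) : ContMDiff 𝓘(ℝ, Euc 1) 𝓘(ℝ, E) ∞ c := fun t =>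
  (h t).elim (fun ht => h₁.contMDiffAt.congr_of_eventuallyEq ht)
    fun ht => h₂.contMDiffAt.congr_of_eventuallyEq ht

/-- Transitivity of "joined by a lifted curve". Both curves are slowed down so as to be constant
near the joint, which makes the concatenation smooth. -/
theorem IsLift.concat {p p' : Euc 1 → X} {q q' : Euc 1 → R} (h : IsLift π θ f β p q)
    (h' : IsLift π θ f β p' q') {a b a' b' : Euc 1} (hp : p b = p' a') (hq : q b = q' a') :
    ∃ (p'' : Euc 1 → X) (q'' : Euc 1 → R) (s t : Euc 1), IsLift π θ f β p'' q'' ∧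
      p'' s = p a ∧ q'' s = q a ∧ p'' t = p' b' ∧ q'' t = q' b' := by
  -- `φ` runs from `a` to `b` while `t` goes from `-2` to `-1`, and `φ'` from `a'` to `b'` while `t`
  -- goes from `1` to `2`. Around the switch at `0`, on `(-1, 1)`, both are constant.
  let φ : Euc 1 → Euc 1 := fun t => a + Real.smoothTransition (t 0 + 2) • (b - a)
  let φ' : Euc 1 → Euc 1 := fun t => a' + Real.smoothTransition (t 0 - 1) • (b' - a')
  have hφ : ContDiff ℝ ∞ φ := contDiff_const.add
    ((Real.smoothTransition.contDiff.comp (by fun_prop)).smul contDiff_const)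
  have hφ' : ContDiff ℝ ∞ φ' := contDiff_const.add
    ((Real.smoothTransition.contDiff.comp (by fun_prop)).smul contDiff_const)
  have e1 : ∀ t : Euc 1, -1 ≤ t 0 → φ t = b := fun t ht => by
    simp [φ, Real.smoothTransition.one_of_one_le (show 1 ≤ t 0 + 2 by linarith)]
  have e2 : ∀ t : Euc 1, t 0 ≤ 1 → φ' t = a' := fun t ht => by
    simp [φ', Real.smoothTransition.zero_of_nonpos (show t 0 - 1 ≤ 0 by linarith)]
  have hc0 : Continuous (fun t : Euc 1 => t 0) := by fun_prop
  have k1 : ∀ t : Euc 1, t 0 < 1 → ∀ᶠ s : Euc 1 in 𝓝 t, s 0 < 0 ∨ (¬ s 0 < 0 ∧ φ s = b ∧ φ' s = a') := by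
    intro t ht
    filter_upwards [(isOpen_lt hc0 continuous_const).mem_nhds ht] with s hs
    by_cases h0 : s 0 < 0
    · exact Or.inl h0
    · exact Or.inr ⟨h0, e1 s (by linarith), e2 s (le_of_lt hs)⟩
  have k2 : ∀ t : Euc 1, -1 < t 0 → ∀ᶠ s : Euc 1 in 𝓝 t, ¬ s 0 < 0 ∨ (s 0 < 0 ∧ φ s = b ∧ φ' s = a') := by
    intro t ht
    filter_upwards [(isOpen_lt continuous_const hc0).mem_nhds ht] with s hs
    by_cases h0 : s 0 < 0
    · exact Or.inr ⟨h0, e1 s (le_of_lt hs), e2 s (by linarith)⟩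
    · exact Or.inl h0
  let p'' : Euc 1 → X := fun t => if t 0 < 0 then p (φ t) else p' (φ' t)
  let q'' : Euc 1 → R := fun t => if t 0 < 0 then q (φ t) else q' (φ' t)
  have hor : ∀ t : Euc 1, t 0 < 1 ∨ -1 < t 0 := fun t => by
    by_contra! hc
    linarith
  have h1 := h.comp hφ
  have h2 := h'.comp hφ'
  have p1 : ∀ t : Euc 1, t 0 < 1 → p'' =ᶠ[𝓝 t] p ∘ φ := fun t ht => (k1 t ht).mono fun s hs => by
    rcases hs with h | ⟨h, h1, h2⟩ <;> simp [p'', *]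
  have p2 : ∀ t : Euc 1, -1 < t 0 → p'' =ᶠ[𝓝 t] p' ∘ φ' := fun t ht => (k2 t ht).mono fun s hs => by
    rcases hs with h | ⟨h, h1, h2⟩ <;> simp [p'', *]
  have q1 : ∀ t : Euc 1, t 0 < 1 → q'' =ᶠ[𝓝 t] q ∘ φ := fun t ht => (k1 t ht).mono fun s hs => by
    rcases hs with h | ⟨h, h1, h2⟩ <;> simp [q'', *]
  have q2 : ∀ t : Euc 1, -1 < t 0 → q'' =ᶠ[𝓝 t] q' ∘ φ' := fun t ht => (k2 t ht).mono fun s hs => by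
    rcases hs with h | ⟨h, h1, h2⟩ <;> simp [q'', *]
  have hpm : p'' ∈ (manifoldDiffeology E X).plots 1 := contMDiff_of_eqOn_halfLines h1.mem_base
    h2.mem_base fun t => (hor t).imp (p1 t) (p2 t)
  have hqm : q'' ∈ (manifoldDiffeology ER R).plots 1 := contMDiff_of_eqOn_halfLines h1.mem
    h2.mem fun t => (hor t).imp (q1 t) (q2 t)
  refine ⟨p'', q'', EuclideanSpace.single 0 (-2), EuclideanSpace.single 0 2,
    ⟨hpm, hqm, fun t => ?_, fun t => ?_⟩, ?_, ?_, ?_, ?_⟩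
  · by_cases h0 : t 0 < 0
    · simpa [p'', q'', h0] using h.proj (φ t)
    · simpa [p'', q'', h0] using h'.proj (φ' t)
  · rcases hor t with ht | ht
    · rw [θ.lin_congr_of_eventuallyEq hqm h1.mem (q1 t ht),
        β.lin_congr_of_eventuallyEq hpm h1.mem_base (p1 t ht), h1.lin_eq]
    · rw [θ.lin_congr_of_eventuallyEq hqm h2.mem (q2 t ht),
        β.lin_congr_of_eventuallyEq hpm h2.mem_base (p2 t ht), h2.lin_eq]
  all_goals simp [p'', q'', φ, φ']
  all_goals norm_num

end Concatenation

/-! ## Horizontal sections over the units -/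

section Unit

variable {EM : Type*} [NormedAddCommGroup EM] [NormedSpace ℝ EM]
  {M : Type*} [TopologicalSpace M] [ChartedSpace EM M]
  {EG : Type*} [NormedAddCommGroup EG] [NormedSpace ℝ EG]
  {G : Type*} [TopologicalSpace G] [ChartedSpace EG G]
  {ER : Type*} [NormedAddCommGroup ER] [NormedSpace ℝ ER]
  {R : Type*} [TopologicalSpace R] [ChartedSpace ER R]
  {𝒢 : LieGroupoid EM M EG G} {η : DForm 𝒢.smooth₂ 1} {κ : DForm (manifoldDiffeology EG G) 2}

namespace LieGroupoid

variable (𝒢) in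
theorem smooth_unit : SmoothMap (manifoldDiffeology EM M) (manifoldDiffeology EG G) 𝒢.unit :=
  smoothMap_of_contMDiff 𝒢.contMDiff_unit

variable (𝒢) in
theorem unit_mul_unit (x : M) :
    𝒢.mul (𝒢.unit x) (𝒢.unit x) ((𝒢.tgt_unit x).trans (𝒢.src_unit x).symm) = 𝒢.unit x := by
  have h := 𝒢.unit_mul (𝒢.unit x)
  simp only [𝒢.src_unit] at h
  exact h

variable (η) in
/-- The form `-ε₂^*η` on the base, the values of the connection form along horizontal units. -/
noncomputable def unitForm : DForm (manifoldDiffeology EM M) 1 :=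
  -(η.pullback 𝒢.unit₂ 𝒢.smooth_unit₂)

theorem IsThreeCocycle.d_along (h : 𝒢.IsThreeCocycle η κ) {n : ℕ} {p : Euc n → 𝒢.Comp₂}
    (hp : p ∈ 𝒢.smooth₂.plots n) {g₀ g₁ g₂ : Euc n → G}
    (hg₀ : g₀ ∈ (manifoldDiffeology EG G).plots n) (hg₁ : g₁ ∈ (manifoldDiffeology EG G).plots n)
    (hg₂ : g₂ ∈ (manifoldDiffeology EG G).plots n) (h₀ : 𝒢.face₂ 0 ∘ p = g₀)
    (h₁ : 𝒢.face₂ 1 ∘ p = g₁) (h₂ : 𝒢.face₂ 2 ∘ p = g₂) (y : Euc n) :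
    η.d.along n p hp y = -(κ.along n g₀ hg₀ y - κ.along n g₁ hg₁ y + κ.along n g₂ hg₂ y) := by
  subst h₀ h₁ h₂
  have h1 := congrArg (fun α => DForm.along α n p hp y) h.d_eta_add_del_omega
  exact eq_neg_of_add_eq_zero_left h1

/-- All three faces of `(ε x, ε x)` are `ε x`, so the pullback of `dη + ∂κ = 0` along `ε₂` reads
`d(ε₂^*η) = -ε^*κ`. This is the flatness of the connection on `ε^*R`. -/
theorem IsThreeCocycle.d_unitForm (h : 𝒢.IsThreeCocycle η κ) :
    (unitForm η).d = κ.pullback 𝒢.unit 𝒢.smooth_unit := by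
  refine DForm.ext_along fun n p hp y => ?_
  rw [unitForm, DForm.d_neg_along]
  have hu := 𝒢.smooth_unit n p hp
  have h1 := h.d_along (𝒢.smooth_unit₂ n p hp) hu hu hu rfl
    (funext fun y => 𝒢.unit_mul_unit (p y)) rfl y
  rw [sub_self, zero_add] at h1
  exact neg_eq_iff_eq_neg.2 h1

end LieGroupoid

open LieGroupoid

variable {π : R → G} {θ : DForm (manifoldDiffeology ER R) 1}

/-- Horizontality, `θ(e) + ε₂^*η = 0`, is the lift equation for the form `-ε₂^*η`; the theory of
lifts therefore applies to sections of `ε^*R`. -/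
theorem IsHorizontalUnit.isLift {e : M → R} (he : IsHorizontalUnit 𝒢 π θ η e) {n : ℕ}
    {p : Euc n → M} (hp : p ∈ (manifoldDiffeology EM M).plots n) :
    IsLift π θ 𝒢.unit (unitForm η) p (e ∘ p) := by
  obtain ⟨h1, h2, h3⟩ := he
  refine ⟨hp, (h2 n p hp).2, fun y => (h1 (p y)).symm, fun y => ?_⟩
  have := congrArg (fun α => DForm.lin α hp y) h3
  exact eq_neg_of_add_eq_zero_left (show θ.lin (h2 n p hp).2 y +
    (η.pullback 𝒢.unit₂ 𝒢.smooth_unit₂).lin hp y = 0 from this)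

theorem isHorizontalUnit_of_isLift {e : M → R}
    (he : ∀ (n : ℕ) (p : Euc n → M), p ∈ (manifoldDiffeology EM M).plots n →
      IsLift π θ 𝒢.unit (unitForm η) p (e ∘ p)) : IsHorizontalUnit 𝒢 π θ η e := by
  refine ⟨fun x => ?_, fun n p hp => ⟨hp, (he n p hp).mem⟩, DForm.ext_lin fun n p hp y => ?_⟩
  · exact ((he 0 (fun _ => x) ((manifoldDiffeology EM M).constant_plots x)).proj 0).symm
  · have h1 := (he n p hp).lin_eq y
    change θ.lin (he n p hp).mem y + (η.pullback 𝒢.unit₂ 𝒢.smooth_unit₂).lin hp y = 0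
    rw [h1]
    simp [unitForm]

theorem HolonomyFree.eq_of_isLift
    (hol : HolonomyFree (unitBundleSmooth ER 𝒢 π) (fun z => z.1.1) (unitConnection 𝒢 π θ η))
    {p : Euc 1 → M} {q : Euc 1 → R} (h : IsLift π θ 𝒢.unit (unitForm η) p q) {a b : Euc 1}
    (hab : p a = p b) : q a = q b := by
  let c : Euc 1 → UnitBundle 𝒢 π := fun t => ⟨(p t, q t), (h.proj t).symm⟩
  have hc : c ∈ (unitBundleSmooth ER 𝒢 π).plots 1 := ⟨h.mem_base, h.mem⟩
  have h0 : ∀ t, (unitConnection 𝒢 π θ η).along 1 c hc t = 0 := fun t => by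
    have h1 : (unitConnection 𝒢 π θ η).lin hc t = 0 := by
      change θ.lin h.mem t + (η.pullback 𝒢.unit₂ 𝒢.smooth_unit₂).lin h.mem_base t = 0
      rw [h.lin_eq]
      simp [unitForm]
    rw [DForm.along_eq_ofSubsingleton, h1]
    ext v
    simp
  have := hol c hc h0 a b hab
  exact congrArg (fun z => z.1.2) this

variable [MulAction Circle R] {hπ : IsPrincipalCircleBundle EG ER π}

theorem IsPrincipalCircleBundle.surjective (hπ : IsPrincipalCircleBundle EG ER π) (g : G) :
    ∃ r, π r = g := by
  obtain ⟨U, -, hg, σ, φ, -, -, h, -⟩ := hπ.locally_trivial g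
  exact ⟨σ g, h g hg⟩

/-- A flat circle bundle without holonomy has a horizontal section. -/
theorem exists_isHorizontalUnit (hηκ : 𝒢.IsThreeCocycle η κ) (hθ : IsConnection hπ θ)
    (hκ : HasCurvature hπ θ κ)
    (hol : HolonomyFree (unitBundleSmooth ER 𝒢 π) (fun z => z.1.1) (unitConnection 𝒢 π θ η)) :
    ∃ e : M → R, IsHorizontalUnit 𝒢 π θ η e := by
  -- `(x, r)` and `(x', r')` are joined by a horizontal curve in `ε^*R`. Below, the induced relation
  -- on `M` has the smooth path components as its classes.
  let Path : M → R → M → R → Prop := fun x r x' r' =>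
    ∃ (p : Euc 1 → M) (q : Euc 1 → R) (s t : Euc 1), IsLift π θ 𝒢.unit (unitForm η) p q ∧
      p s = x ∧ q s = r ∧ p t = x' ∧ q t = r'
  have hsymm : ∀ {x r x' r'}, Path x r x' r' → Path x' r' x r := by
    rintro x r x' r' ⟨p, q, s, t, h, h1, h2, h3, h4⟩
    exact ⟨p, q, t, s, h, h3, h4, h1, h2⟩
  have htrans : ∀ {x r x' r' x'' r''}, Path x r x' r' → Path x' r' x'' r'' → Path x r x'' r'' := by
    rintro x r x' r' x'' r'' ⟨p, q, s, t, h, rfl, rfl, rfl, rfl⟩ ⟨p', q', s', t', h', h1, h2, rfl, rfl⟩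
    obtain ⟨p'', q'', a, b, hc, h3, h4, h5, h6⟩ := h.concat h' h1.symm h2.symm
    exact ⟨p'', q'', a, b, hc, h3, h4, h5, h6⟩
  have hrot : ∀ {x r x' r'} (z : Circle), Path x r x' r' → Path x (z • r) x' (z • r') := by
    rintro x r x' r' z ⟨p, q, s, t, h, rfl, rfl, rfl, rfl⟩
    exact ⟨p, _, s, t, h.smul hθ z, rfl, rfl, rfl, rfl⟩
  have hproj : ∀ {x r x' r'}, Path x r x' r' → π r = 𝒢.unit x ∧ π r' = 𝒢.unit x' := by
    rintro x r x' r' ⟨p, q, s, t, h, rfl, rfl, rfl, rfl⟩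
    exact ⟨h.proj s, h.proj t⟩
  have huniq : ∀ {x r r'}, Path x r x r' → r = r' := by
    rintro x r r' ⟨p, q, s, t, h, h1, rfl, h2, rfl⟩
    exact hol.eq_of_isLift h (h1.trans h2.symm)
  have hlift : ∀ {n} {p : Euc n → M} (hp : p ∈ (manifoldDiffeology EM M).plots n) (y₀ : Euc n)
      {r : R}, π r = 𝒢.unit (p y₀) → ∃ q, IsLift π θ 𝒢.unit (unitForm η) p q ∧ q y₀ = r :=
    fun hp y₀ _ hr => exists_isLift hθ hκ 𝒢.smooth_unit hηκ.d_unitForm hp y₀ hr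
  choose r₀ hr₀ using fun x => hπ.surjective (𝒢.unit x)
  let S : Setoid M := ⟨fun x x' => ∃ r r', Path x r x' r', ⟨fun x => ?_, fun {x x'} h => ?_,
    fun {x x' x''} h h' => ?_⟩⟩
  rotate_left
  · obtain ⟨q, h, -⟩ := hlift ((manifoldDiffeology EM M).constant_plots (n := 1) x) 0 (hr₀ x)
    exact ⟨q 0, q 0, _, q, 0, 0, h, rfl, rfl, rfl, rfl⟩
  · obtain ⟨r, r', h⟩ := h
    exact ⟨r', r, hsymm h⟩
  · obtain ⟨r, r', h⟩ := h
    obtain ⟨s, s', h'⟩ := h'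
    obtain ⟨z, hz⟩ := hπ.exists_smul_eq ((hproj h').1.trans (hproj h).2.symm)
    exact ⟨r, z • s', htrans h (hz ▸ hrot z h')⟩
  -- One base point per path component, with a chosen point `r₀` over it; `e x` is the transport of
  -- that point to `x`.
  let rep : M → M := fun x => (Quotient.mk S x).out
  have hrep : ∀ x, ∃ r, Path (rep x) (r₀ (rep x)) x r := fun x => by
    obtain ⟨r, r', h⟩ : S.r (rep x) x := Quotient.exact (Quotient.out_eq (Quotient.mk S x))
    obtain ⟨z, hz⟩ := hπ.exists_smul_eq ((hproj h).1.trans (hr₀ _).symm)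
    exact ⟨z • r', hz ▸ hrot z h⟩
  choose e he using hrep
  refine ⟨e, isHorizontalUnit_of_isLift fun n p hp => ?_⟩
  obtain ⟨q, hq, hq0⟩ := hlift hp 0 (hproj (he (p 0))).2
  -- Smoothness of `e`: along the segment from `0` to `y` the lift `q` is a horizontal curve from `e
  -- (p 0)`, and without holonomy its endpoint must be the transported value `e (p y)`.
  have heq : e ∘ p = q := by
    ext y
    have hline : ContDiff ℝ ∞ (fun t : Euc 1 => t 0 • y) := by fun_prop
    have h1 : Path (p 0) (e (p 0)) (p y) (q y) :=
      ⟨_, _, 0, EuclideanSpace.single 0 1, hq.comp hline, by simp, by simp [hq0], by simp, by simp⟩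
    have h2 : rep (p y) = rep (p 0) :=
      congrArg Quotient.out (Quotient.sound (s := S) ⟨_, _, hsymm h1⟩)
    have h3 := he (p y)
    rw [h2] at h3
    exact huniq (htrans (hsymm h3) (htrans (he (p 0)) h1))
  rw [heq]
  exact hq

end Unit

/-! ## Submersions out of the total space of a circle bundle -/

theorem circleLog_exp {t : ℝ} (h₁ : -(1 / 2) < t) (h₂ : t < 1 / 2) :
    circleLog (Circle.exp (2 * Real.pi * t)) = t := by
  have := Real.pi_pos
  rw [circleLog, Circle.arg_exp (by nlinarith) (by nlinarith)]
  field_simp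

theorem exp_mem_slitPlane {t : ℝ} (h₁ : -(1 / 2) < t) (h₂ : t < 1 / 2) :
    (Circle.exp (2 * Real.pi * t) : ℂ) ∈ Complex.slitPlane := by
  have := Real.pi_pos
  rw [Complex.mem_slitPlane_iff_arg, Circle.arg_exp (by nlinarith) (by nlinarith)]
  exact ⟨by nlinarith, Circle.coe_ne_zero _⟩

theorem circleLog_mem_Ioo {z : Circle} (hz : (z : ℂ) ∈ Complex.slitPlane) :
    circleLog z ∈ Set.Ioo (-(1 / 2) : ℝ) (1 / 2) := by
  have hpi := Real.pi_pos
  have h1 := Complex.neg_pi_lt_arg (z : ℂ)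
  have h2 := (Complex.arg_le_pi (z : ℂ)).lt_of_ne (Complex.mem_slitPlane_iff_arg.1 hz).1
  rw [circleLog]
  constructor
  · rw [lt_div_iff₀ (by positivity)]
    linarith
  · rw [div_lt_iff₀ (by positivity)]
    linarith

section Submersion

variable {EM : Type*} [NormedAddCommGroup EM] [NormedSpace ℝ EM]
  {M : Type*} [TopologicalSpace M] [ChartedSpace EM M]
  {EG : Type*} [NormedAddCommGroup EG] [NormedSpace ℝ EG]
  {G : Type*} [TopologicalSpace G] [ChartedSpace EG G]
  {ER : Type*} [NormedAddCommGroup ER] [NormedSpace ℝ ER]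
  {R : Type*} [TopologicalSpace R] [ChartedSpace ER R] [MulAction Circle R]
  {π : R → G}

theorem IsPrincipalCircleBundle.contMDiffOn_smul (hπ : IsPrincipalCircleBundle EG ER π)
    {E X : Type*} [NormedAddCommGroup E] [NormedSpace ℝ E] [TopologicalSpace X]
    [ChartedSpace E X] {z : X → Circle} {r : X → R} {s : Set X}
    (hz : ContMDiffOn 𝓘(ℝ, E) (𝓡 1) ∞ z s) (hr : ContMDiffOn 𝓘(ℝ, E) 𝓘(ℝ, ER) ∞ r s) :
    ContMDiffOn 𝓘(ℝ, E) 𝓘(ℝ, ER) ∞ (fun x => z x • r x) s := by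
  have := hπ.smooth_smul
  exact (ContMDiffSMul.contMDiff_smul (I := 𝓡 1) (I' := 𝓘(ℝ, ER)) (n := ∞) (G := Circle)
    (M := R)).comp_contMDiffOn (hz.prodMk hr)

/-- A chart of the base gives a local diffeomorphism of the total space with `EG × ℝ`. -/
theorem IsPrincipalCircleBundle.exists_partialDiffeomorph (hπ : IsPrincipalCircleBundle EG ER π)
    {ψ : OpenPartialHomeomorph G EG} (hψ : ψ ∈ IsManifold.maximalAtlas 𝓘(ℝ, EG) ∞ G) {r₀ : R}
    (hr₀ : π r₀ ∈ ψ.source) : ∃ Φ : PartialDiffeomorph 𝓘(ℝ, ER) 𝓘(ℝ, EG × ℝ) R (EG × ℝ) ∞,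
      r₀ ∈ Φ.source ∧ (∀ r ∈ Φ.source, π r ∈ ψ.source) ∧ ∀ r ∈ Φ.source, (Φ r).1 = ψ (π r) := by
  obtain ⟨U, hU, hr, σ, φ, hσ, hφ, hπσ, hφσ, hσφ⟩ := hπ.locally_trivial (π r₀)
  have hψc := contMDiffOn_of_mem_maximalAtlas hψ
  have hψs := contMDiffOn_symm_of_mem_maximalAtlas hψ
  have hsrc : ContMDiffOn 𝓘(ℝ, ER) (𝓡 1) ∞ (fun r => φ r * (φ r₀)⁻¹) (π ⁻¹' U) :=
    hφ.mul contMDiffOn_const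
  have hcoe : Continuous (fun z : Circle => (z : ℂ)) := contMDiff_circle_coe.continuous
  have hWo : IsOpen ((fun v : EG × ℝ => v.1) ⁻¹' (ψ.target ∩ ψ.symm ⁻¹' U)) :=
    (ψ.isOpen_inter_preimage_symm hU).preimage continuous_fst
  -- The fibre coordinate is divided by its value at `r₀`, so that `r₀` gets logarithm `0`; removing
  -- the antipodal points leaves the interval `(-1/2, 1/2)`.
  refine ⟨{
    toFun := fun r => (ψ (π r), circleLog (φ r * (φ r₀)⁻¹))
    invFun := fun v => (Circle.exp (2 * Real.pi * v.2) * φ r₀) • σ (ψ.symm v.1)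
    source := (π ⁻¹' U ∩ (fun r => φ r * (φ r₀)⁻¹) ⁻¹' {z | (z : ℂ) ∈ Complex.slitPlane}) ∩
      π ⁻¹' ψ.source
    target := (fun v : EG × ℝ => v.1) ⁻¹' (ψ.target ∩ ψ.symm ⁻¹' U) ∩
      (fun v : EG × ℝ => v.2) ⁻¹' Set.Ioo (-(1 / 2) : ℝ) (1 / 2)
    map_source' := ?_
    map_target' := ?_
    left_inv' := ?_
    right_inv' := ?_
    open_source := ?_
    open_target := ?_
    contMDiffOn_toFun := ?_
    contMDiffOn_invFun := ?_ }, ?_, ?_, ?_⟩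
  · rintro r ⟨⟨h1, h2⟩, h3⟩
    refine ⟨⟨ψ.map_source h3, ?_⟩, circleLog_mem_Ioo h2⟩
    rw [Set.mem_preimage, ψ.left_inv h3]
    exact h1
  · rintro v ⟨⟨h1, h2⟩, h3⟩
    have h4 : π ((Circle.exp (2 * Real.pi * v.2) * φ r₀) • σ (ψ.symm v.1)) = ψ.symm v.1 := by
      rw [hπ.proj_smul, hπσ _ h2]
    refine ⟨⟨?_, ?_⟩, ?_⟩
    · rw [Set.mem_preimage, h4]
      exact h2
    · simp only [Set.mem_preimage, Set.mem_ofPred_eq]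
      rw [hφσ _ h2, mul_inv_cancel_right]
      exact exp_mem_slitPlane h3.1 h3.2
    · rw [Set.mem_preimage, h4]
      exact ψ.map_target h1
  · rintro r ⟨⟨h1, h2⟩, h3⟩
    simp only
    rw [exp_circleLog, inv_mul_cancel_right, ψ.left_inv h3, hσφ r h1]
  · rintro v ⟨⟨h1, h2⟩, h3⟩
    refine Prod.ext ?_ ?_
    · simp only
      rw [hπ.proj_smul, hπσ _ h2, ψ.right_inv h1]
    · simp only
      rw [hφσ _ h2, mul_inv_cancel_right, circleLog_exp h3.1 h3.2]
  · refine (hsrc.continuousOn.isOpen_inter_preimage (hU.preimage hπ.smooth_proj.continuous)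
      (Complex.isOpen_slitPlane.preimage hcoe)).inter
      (ψ.open_source.preimage hπ.smooth_proj.continuous)
  · exact hWo.inter (isOpen_Ioo.preimage continuous_snd)
  · refine ContMDiffOn.prodMk_space ?_ ?_
    · exact hψc.comp hπ.smooth_proj.contMDiffOn fun r hr => hr.2
    · intro r hr
      have h1 : ContMDiffAt 𝓘(ℝ, ER) (𝓡 1) ∞ (fun r => φ r * (φ r₀)⁻¹) r :=
        hsrc.contMDiffAt ((hU.preimage hπ.smooth_proj.continuous).mem_nhds hr.1.1)
      exact ((contMDiffAt_circleLog hr.1.2).comp r h1).contMDiffWithinAt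
  · refine hπ.contMDiffOn_smul ?_ ?_
    · have h1 : ContMDiff 𝓘(ℝ, EG × ℝ) 𝓘(ℝ, ℝ) ∞ (fun v : EG × ℝ => 2 * Real.pi * v.2) :=
        (contDiff_const.mul contDiff_snd).contMDiff
      exact ((contMDiff_circleExp.comp h1).mul contMDiff_const).contMDiffOn
    · refine hσ.comp (hψs.comp contDiff_fst.contMDiff.contMDiffOn fun v hv => hv.1.1)
        fun v hv => hv.1.2
  · refine ⟨⟨hr, ?_⟩, hr₀⟩
    simp
  · exact fun r hr => hr.2
  · exact fun r hr => rfl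

/-- The composition of a submersion with the projection of a circle bundle is a submersion. -/
theorem IsPrincipalCircleBundle.isSubmersion_comp [IsManifold 𝓘(ℝ, ER) ∞ R]
    (hπ : IsPrincipalCircleBundle EG ER π) {f : G → M}
    (hf : Manifold.IsSubmersion 𝓘(ℝ, EG) 𝓘(ℝ, EM) ∞ f) :
    Manifold.IsSubmersion 𝓘(ℝ, ER) 𝓘(ℝ, EM) ∞ (fun r => f (π r)) := by
  obtain ⟨F, _, _, hF⟩ := hf
  -- The circle direction adds a factor `ℝ` to the complement `F` of the submersion `f`.
  refine Manifold.IsSubmersionOfComplement.isSubmersion (F := F × ℝ) fun r₀ => ?_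
  have h := hF (π r₀)
  obtain ⟨Φ, h1, h2, h3⟩ := hπ.exists_partialDiffeomorph h.domChart_mem_maximalAtlas
    h.mem_domChart_source
  -- A chart of `R` must take values in `ER`. The derivative of the local diffeomorphism at `r₀`
  -- identifies this model space with `EG × ℝ`.
  let L : ER ≃L[ℝ] (EG × ℝ) :=
    (show IsLocalDiffeomorphAt 𝓘(ℝ, ER) 𝓘(ℝ, EG × ℝ) ∞ Φ r₀ from
      ⟨Φ, h1, Set.eqOn_refl _ _⟩).mfderivToContinuousLinearEquiv (by simp)
  let Ψ : OpenPartialHomeomorph R ER :=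
    Φ.toOpenPartialHomeomorph.trans L.symm.toHomeomorph.toOpenPartialHomeomorph
  have hΨ : Ψ ∈ IsManifold.maximalAtlas 𝓘(ℝ, ER) ∞ R := by
    refine Ψ.mem_maximalAtlas_of_contMDiffOn ?_ ?_
    · exact L.symm.contDiff.contMDiff.comp_contMDiffOn
        (Φ.contMDiffOn_toFun.mono fun r hr => hr.1)
    · exact Φ.contMDiffOn_invFun.comp L.contDiff.contMDiff.contMDiffOn fun v hv => hv.2
  refine Manifold.IsSubmersionAtOfComplement.mk_of_charts
    (L.trans ((h.equiv.prodCongr (ContinuousLinearEquiv.refl ℝ ℝ)).trans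
      (ContinuousLinearEquiv.prodAssoc ℝ EM F ℝ))) Ψ h.codChart ?_ h.mem_codChart_source hΨ
    h.codChart_mem_maximalAtlas ?_ ?_
  · exact ⟨h1, trivial⟩
  · intro r hr
    exact h.source_subset_preimage_source (h2 r hr.1)
  · intro v hv
    have hv' : L v ∈ Φ.target := by simpa [Ψ] using hv
    have h4 : Φ.invFun (L v) ∈ Φ.source := Φ.map_target' hv'
    have h5 : h.domChart (π (Φ.invFun (L v))) = (L v).1 := by
      rw [← h3 _ h4, Φ.right_inv' hv']
    have h8 : (L v).1 ∈ (h.domChart.extend 𝓘(ℝ, EG)).target := by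
      rw [← h5]
      simpa using h.domChart.map_source (h2 _ h4)
    have h6 := h.writtenInCharts h8
    have h7 : (h.domChart.extend 𝓘(ℝ, EG)).symm (L v).1 = π (Φ.invFun (L v)) := by
      rw [← h5]
      simpa using h.domChart.left_inv (h2 _ h4)
    simp only [Function.comp_apply, h7] at h6
    exact h6

end Submersion

/-! ## Curves and families in the fibres of a submersion -/

/-- The point of `Euc 1` with coordinate `t`. -/
noncomputable def pt (t : ℝ) : Euc 1 := EuclideanSpace.single 0 t

/-- The point of `Euc 2` with coordinates `s`, `t`. -/
noncomputable def pt₂ (s t : ℝ) : Euc 2 := EuclideanSpace.single 0 s + EuclideanSpace.single 1 t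

@[simp]
theorem pt_apply (t : ℝ) : pt t 0 = t := by simp [pt]

@[simp]
theorem pt_eta (t : Euc 1) : pt (t 0) = t := by
  ext i
  fin_cases i
  simp

@[simp]
theorem pt₂_zero (s t : ℝ) : pt₂ s t 0 = s := by simp [pt₂]

@[simp]
theorem pt₂_one (s t : ℝ) : pt₂ s t 1 = t := by simp [pt₂]

theorem contDiff_pt : ContDiff ℝ ∞ pt := by
  rw [contDiff_euclidean]
  intro i
  fin_cases i
  have h : (fun t => pt t 0) = id := funext pt_apply
  change ContDiff ℝ ∞ (fun t => pt t 0)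
  rw [h]
  exact contDiff_id

theorem contDiff_pt₂_left (t : ℝ) : ContDiff ℝ ∞ (fun s : Euc 1 => pt₂ (s 0) t) := by
  rw [contDiff_euclidean]
  intro i
  fin_cases i <;> simp <;> fun_prop

theorem contDiff_pt₂_right (s : ℝ) : ContDiff ℝ ∞ (fun t : Euc 1 => pt₂ s (t 0)) := by
  rw [contDiff_euclidean]
  intro i
  fin_cases i <;> simp <;> fun_prop

section Box

variable {EM : Type*} [NormedAddCommGroup EM] [NormedSpace ℝ EM]
  {M : Type*} [TopologicalSpace M] [ChartedSpace EM M]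
  {ER : Type*} [NormedAddCommGroup ER] [NormedSpace ℝ ER]
  {R : Type*} [TopologicalSpace R] [ChartedSpace ER R]

/-- Neighbourhoods adapted to a submersion: curves in them with the same image are joined by a
family of curves with the same image, and curves in the base lift to them. -/
structure IsBox (f : R → M) (N : Set R) : Prop where
  isOpen : IsOpen N
  join : ∀ a b : Euc 1 → R, a ∈ (manifoldDiffeology ER R).plots 1 →
    b ∈ (manifoldDiffeology ER R).plots 1 → (∀ t, a t ∈ N) → (∀ t, b t ∈ N) →
    (∀ t, f (a t) = f (b t)) → ∃ Λ ∈ (manifoldDiffeology ER R).plots 2,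
      (∀ w, f (Λ w) = f (a (pt (w 1)))) ∧ (∀ t, Λ (pt₂ 0 t) = a (pt t)) ∧
      ∀ t, Λ (pt₂ 1 t) = b (pt t)
  lift : ∀ x ∈ (manifoldDiffeology EM M).plots 1, ∀ t₀, ∀ r ∈ N, f r = x t₀ →
    ∃ b : Euc 1 → Euc 1, ContDiff ℝ ∞ b ∧ b =ᶠ[𝓝 t₀] id ∧
      ∃ a ∈ (manifoldDiffeology ER R).plots 1, (∀ t, a t ∈ N) ∧ (∀ t, f (a t) = x (b t)) ∧ a t₀ = r

/-- In adapted charts `f` is the projection `B × C → B` of a product of balls. Curves over the same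
base curve are joined by convex combination in `C`, and a base curve is lifted with constant
`C`-coordinate, after a reparametrization keeping it in `B`. -/
theorem exists_isBox {f : R → M} (hf : Manifold.IsSubmersion 𝓘(ℝ, ER) 𝓘(ℝ, EM) ∞ f) (r₀ : R) :
    ∃ N, r₀ ∈ N ∧ IsBox (EM := EM) (ER := ER) f N := by
  obtain ⟨F, _, _, hF⟩ := hf
  have h := hF r₀
  let φ := h.domChart
  let χ := h.codChart
  let L := h.equiv
  have hφ : ContMDiffOn 𝓘(ℝ, ER) 𝓘(ℝ, ER) ∞ φ φ.source :=
    contMDiffOn_of_mem_maximalAtlas h.domChart_mem_maximalAtlas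
  have hφs : ContMDiffOn 𝓘(ℝ, ER) 𝓘(ℝ, ER) ∞ φ.symm φ.target :=
    contMDiffOn_symm_of_mem_maximalAtlas h.domChart_mem_maximalAtlas
  have hχ : ContMDiffOn 𝓘(ℝ, EM) 𝓘(ℝ, EM) ∞ χ χ.source :=
    contMDiffOn_of_mem_maximalAtlas h.codChart_mem_maximalAtlas
  have hsrc : ∀ r ∈ φ.source, f r ∈ χ.source := fun r hr => h.source_subset_preimage_source hr
  have hχf : ∀ v ∈ φ.target, χ (f (φ.symm v)) = (L v).1 := fun v hv => by
    have := h.writtenInCharts (by simpa using hv)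
    simpa using this
  have hfφ : ∀ v ∈ φ.target, f (φ.symm v) = χ.symm (L v).1 := fun v hv => by
    rw [← hχf v hv, χ.left_inv (hsrc _ (φ.map_target hv))]
  have hχr : ∀ r ∈ φ.source, χ (f r) = (L (φ r)).1 := fun r hr => by
    rw [← hχf _ (φ.map_source hr), φ.left_inv hr]
  obtain ⟨ε, hε, hεs⟩ : ∃ ε > 0, Metric.ball (L (φ r₀)).1 ε ×ˢ Metric.ball (L (φ r₀)).2 ε ⊆
      L.symm ⁻¹' φ.target := by
    obtain ⟨ε, hε, hεs⟩ := Metric.isOpen_iff.1 (φ.open_target.preimage L.symm.continuous)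
      (L (φ r₀)) (by simpa using φ.map_source h.mem_domChart_source)
    exact ⟨ε, hε, by rwa [ball_prod_same]⟩
  set B := Metric.ball (L (φ r₀)).1 ε
  set C := Metric.ball (L (φ r₀)).2 ε
  have hBC : ∀ m ∈ B, ∀ v ∈ C, L.symm (m, v) ∈ φ.target := fun m hm v hv => hεs ⟨hm, hv⟩
  have hmem : ∀ m ∈ B, ∀ v ∈ C, φ.symm (L.symm (m, v)) ∈ φ.source ∩ φ ⁻¹' (L ⁻¹' (B ×ˢ C)) :=
    fun m hm v hv => by
      refine ⟨φ.map_target (hBC m hm v hv), ?_⟩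
      rw [Set.mem_preimage, φ.right_inv (hBC m hm v hv), Set.mem_preimage, L.apply_symm_apply]
      exact ⟨hm, hv⟩
  have hsmooth : ∀ {n : ℕ} {m : Euc n → EM} {v : Euc n → F}, ContDiff ℝ ∞ m → ContDiff ℝ ∞ v →
      (∀ t, m t ∈ B) → (∀ t, v t ∈ C) →
      (fun t => φ.symm (L.symm (m t, v t))) ∈ (manifoldDiffeology ER R).plots n :=
    fun hm hv hmB hvC t => (hφs.contMDiffAt (φ.open_target.mem_nhds (hBC _ (hmB t) _ (hvC t)))).comp t
      (L.symm.contDiff.comp (hm.prodMk hv)).contMDiff.contMDiffAt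
  have hcoord : ∀ {n : ℕ} {a : Euc n → R}, a ∈ (manifoldDiffeology ER R).plots n →
      (∀ t, a t ∈ φ.source) → ContDiff ℝ ∞ (fun t => L (φ (a t))) := fun ha has =>
    L.contDiff.comp (contMDiff_iff_contDiff.1 fun t =>
      (hφ.contMDiffAt (φ.open_source.mem_nhds (has t))).comp t (ContMDiff.contMDiffAt ha))
  refine ⟨φ.source ∩ φ ⁻¹' (L ⁻¹' (B ×ˢ C)), ⟨h.mem_domChart_source,
    Metric.mem_ball_self hε, Metric.mem_ball_self hε⟩, ?_, ?_, ?_⟩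
  · exact φ.isOpen_inter_preimage ((Metric.isOpen_ball.prod Metric.isOpen_ball).preimage
      L.continuous)
  · intro a b ha hb haN hbN hab
    have hca := hcoord ha fun t => (haN t).1
    have hcb := hcoord hb fun t => (hbN t).1
    have hab1 : ∀ t, (L (φ (a t))).1 = (L (φ (b t))).1 := fun t => by
      rw [← hχr _ (haN t).1, ← hχr _ (hbN t).1, hab]
    let m : Euc 2 → EM := fun w => (L (φ (a (pt (w 1))))).1
    let v : Euc 2 → F := fun w => (1 - Real.smoothTransition (w 0)) • (L (φ (a (pt (w 1))))).2 +
      Real.smoothTransition (w 0) • (L (φ (b (pt (w 1))))).2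
    have hpt : ContDiff ℝ ∞ (fun w : Euc 2 => pt (w 1)) := contDiff_pt.comp (by fun_prop)
    have hst : ContDiff ℝ ∞ (fun w : Euc 2 => Real.smoothTransition (w 0)) :=
      Real.smoothTransition.contDiff.comp (by fun_prop)
    have hm : ContDiff ℝ ∞ m := contDiff_fst.comp (hca.comp hpt)
    have hv : ContDiff ℝ ∞ v := ((contDiff_const.sub hst).smul
      (contDiff_snd.comp (hca.comp hpt))).add (hst.smul (contDiff_snd.comp (hcb.comp hpt)))
    have hmB : ∀ w, m w ∈ B := fun w => (haN _).2.1
    have hvC : ∀ w, v w ∈ C := fun w => convex_ball _ _ (haN _).2.2 (hbN _).2.2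
      (sub_nonneg.2 (Real.smoothTransition.le_one _)) (Real.smoothTransition.nonneg _) (by ring)
    have hrec : ∀ {r : R}, r ∈ φ.source → φ.symm (L.symm ((L (φ r)).1, (L (φ r)).2)) = r :=
      fun {r} hr => by
        rw [Prod.mk.eta, L.symm_apply_apply, φ.left_inv hr]
    refine ⟨_, hsmooth hm hv hmB hvC, fun w => ?_, fun t => ?_, fun t => ?_⟩
    · rw [hfφ _ (hBC _ (hmB w) _ (hvC w)), L.apply_symm_apply]
      simp only [m]
      rw [← hχr _ (haN _).1, χ.left_inv (hsrc _ (haN _).1)]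
    · simp only [m, v, pt₂_zero, pt₂_one, Real.smoothTransition.zero, sub_zero, one_smul, zero_smul,
        add_zero]
      exact hrec (haN _).1
    · simp only [m, v, pt₂_zero, pt₂_one, Real.smoothTransition.one, sub_self, one_smul, zero_smul,
        zero_add]
      rw [hab1]
      exact hrec (hbN _).1
  · intro x hx t₀ r hr hrx
    have hxc : Continuous x := ContMDiff.continuous hx
    have hO : IsOpen (x ⁻¹' (χ.source ∩ χ ⁻¹' B)) :=
      (χ.isOpen_inter_preimage Metric.isOpen_ball).preimage hxc
    have ht₀ : t₀ ∈ x ⁻¹' (χ.source ∩ χ ⁻¹' B) := by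
      rw [Set.mem_preimage, ← hrx]
      refine ⟨hsrc _ hr.1, ?_⟩
      rw [Set.mem_preimage, hχr _ hr.1]
      exact hr.2.1
    obtain ⟨b, hb, hbid, hbm⟩ := exists_contDiff_eventuallyEq_id (hO.mem_nhds ht₀)
    have hm : ContDiff ℝ ∞ (fun t => χ (x (b t))) := contMDiff_iff_contDiff.1 fun t =>
      (hχ.contMDiffAt (χ.open_source.mem_nhds (hbm t).1)).comp t
        ((ContMDiff.comp hx hb.contMDiff).contMDiffAt)
    have hbt : b t₀ = t₀ := hbid.self_of_nhds
    refine ⟨b, hb, hbid, _, hsmooth hm (contDiff_const (c := (L (φ r)).2)) (fun t => (hbm t).2)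
      (fun t => hr.2.2), fun t => hmem _ (hbm t).2 _ hr.2.2, fun t => ?_, ?_⟩
    · rw [hfφ _ (hBC _ (hbm t).2 _ hr.2.2), L.apply_symm_apply, χ.left_inv (hbm t).1]
    · rw [hbt, ← hrx, hχr _ hr.1, Prod.mk.eta, L.symm_apply_apply, φ.left_inv hr.1]

end Box

/-! ## Induction along connected fibres -/

section FibreInduction

variable {EM : Type*} [NormedAddCommGroup EM] [NormedSpace ℝ EM]
  {M : Type*} [TopologicalSpace M] [ChartedSpace EM M]
  {EG : Type*} [NormedAddCommGroup EG] [NormedSpace ℝ EG]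
  {G : Type*} [TopologicalSpace G] [ChartedSpace EG G]
  {ER : Type*} [NormedAddCommGroup ER] [NormedSpace ℝ ER]
  {R : Type*} [TopologicalSpace R] [ChartedSpace ER R] [MulAction Circle R]
  {π : R → G} {f : G → M} {x : M}

theorem IsPreconnected.induction_of_locally {X : Type*} [TopologicalSpace X] {S : Set X}
    (hS : IsPreconnected S) {P : X → Prop}
    (h : ∀ x ∈ S, ∃ N ∈ 𝓝 x, ∀ y ∈ N ∩ S, ∀ z ∈ N ∩ S, P y → P z) {x y : X} (hx : x ∈ S)
    (hy : y ∈ S) (hPx : P x) : P y := by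
  refine hS.induction₂' (fun a b => P a → P b) (fun a ha => ?_) (fun a b c _ _ _ h1 h2 h3 => h2 (h1 h3))
    hx hy hPx
  obtain ⟨N, hN, hP⟩ := h a ha
  filter_upwards [mem_nhdsWithin_of_mem_nhds hN, self_mem_nhdsWithin] with b hb hbS
  exact ⟨hP a ⟨mem_of_mem_nhds hN, ha⟩ b ⟨hb, hbS⟩, hP b ⟨hb, hbS⟩ a ⟨mem_of_mem_nhds hN, ha⟩⟩

/-- A locally constant property passes along the circle orbits, which are connected, and along local
sections over the connected fibre of `f`; together these reach the whole fibre of `f ∘ π`. -/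
theorem IsPrincipalCircleBundle.fibre_induction {M : Type*} {f : G → M} {x : M}
    (hπ : IsPrincipalCircleBundle EG ER π) (hx : IsPreconnected (f ⁻¹' {x})) {P : R → Prop}
    (hP : ∀ r, f (π r) = x → ∃ N ∈ 𝓝 r, ∀ r₁ ∈ N, ∀ r₂ ∈ N, f (π r₁) = x → f (π r₂) = x →
      P r₁ → P r₂) {r r' : R} (hr : f (π r) = x) (hr' : f (π r') = x) (h : P r) : P r' := by
  have hcircle : ∀ r, f (π r) = x → ∀ z : Circle, P r → P (z • r) := by
    intro r hr z h
    have hc : Continuous (fun z : Circle => z • r) := by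
      have := hπ.smooth_smul
      exact ((ContMDiffSMul.contMDiff_smul (I := 𝓡 1) (I' := 𝓘(ℝ, ER)) (n := ∞) (G := Circle)
        (M := R)).comp (contMDiff_id.prodMk contMDiff_const)).continuous
    refine isPreconnected_univ.induction_of_locally (P := fun z : Circle => P (z • r))
      (fun w _ => ?_) (Set.mem_univ 1) (Set.mem_univ z) (by simpa using h)
    obtain ⟨N, hN, hNP⟩ := hP (w • r) (by rw [hπ.proj_smul, hr])
    exact ⟨_, hc.continuousAt hN, fun y hy z hz => hNP _ hy.1 _ hz.1 (by rw [hπ.proj_smul, hr])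
      (by rw [hπ.proj_smul, hr])⟩
  have hfib : ∀ {r r'}, f (π r) = x → π r = π r' → P r → P r' := fun {r r'} hr h hp => by
    obtain ⟨z, rfl⟩ := hπ.exists_smul_eq h
    exact hcircle r hr z hp
  obtain ⟨r'', h1, h2⟩ : ∃ r'', π r'' = π r' ∧ P r'' := by
    refine hx.induction_of_locally (P := fun g => ∃ r'', π r'' = g ∧ P r'') (fun g hg => ?_)
      hr hr' ⟨r, rfl, h⟩
    obtain ⟨U, hU, hgU, σ, φ, hσ, -, hπσ, -⟩ := hπ.locally_trivial g
    obtain ⟨N, hN, hNP⟩ := hP (σ g) (by rw [hπσ g hgU]; exact hg)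
    refine ⟨U ∩ σ ⁻¹' N, inter_mem (hU.mem_nhds hgU)
      ((hσ.continuousOn.continuousAt (hU.mem_nhds hgU)) hN), ?_⟩
    rintro g₁ ⟨⟨h1, h1'⟩, h1x⟩ g₂ ⟨⟨h2, h2'⟩, h2x⟩ ⟨r₁, rfl, hr₁⟩
    refine ⟨σ g₂, hπσ _ h2, hNP _ h1' _ h2' ?_ ?_ (hfib h1x (hπσ _ h1).symm hr₁)⟩
    · rw [hπσ _ h1]
      exact h1x
    · rw [hπσ _ h2]
      exact h2x
  exact hfib (by rw [h1, hr']) h1 h2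

/-- A property of points of the total space that is invariant along smooth curves in a connected
fibre holds on the whole fibre if it holds at one point. -/
theorem IsPrincipalCircleBundle.fibre_curve_induction [IsManifold 𝓘(ℝ, ER) ∞ R]
    (hπ : IsPrincipalCircleBundle EG ER π)
    (hf : Manifold.IsSubmersion 𝓘(ℝ, EG) 𝓘(ℝ, EM) ∞ f) (hx : IsPreconnected (f ⁻¹' {x}))
    {P : R → Prop} (hP : ∀ c ∈ (manifoldDiffeology ER R).plots 1, (∀ t, f (π (c t)) = x) →
      ∀ s t, P (c s) → P (c t)) {r r' : R} (hr : f (π r) = x) (hr' : f (π r') = x) (h : P r) :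
    P r' := by
  refine hπ.fibre_induction hx (fun r₀ _ => ?_) hr hr' h
  obtain ⟨N, hN, hbox⟩ := exists_isBox (hπ.isSubmersion_comp hf) r₀
  refine ⟨N, hbox.isOpen.mem_nhds hN, fun r₁ h1 r₂ h2 h1x h2x hPr => ?_⟩
  -- Two points of a box in the same fibre, viewed as constant curves: the family joining them
  -- restricts to a curve inside the fibre from `r₁` to `r₂`.
  obtain ⟨Λ, hΛ, hfΛ, h0, h1'⟩ := hbox.join (fun _ => r₁) (fun _ => r₂)
    ((manifoldDiffeology ER R).constant_plots r₁) ((manifoldDiffeology ER R).constant_plots r₂)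
    (fun _ => h1) (fun _ => h2) (fun _ => h1x.trans h2x.symm)
  have := hP _ ((manifoldDiffeology ER R).plot_reparam hΛ (contDiff_pt₂_left 0))
    (fun t => (hfΛ _).trans h1x) (pt 0) (pt 1)
  simp only [Function.comp_apply, pt_apply, h0, h1'] at this
  exact this hPr

end FibreInduction

/-! ## Elementary consequences of the groupoid axioms -/

namespace LieGroupoid

variable {EM : Type*} [NormedAddCommGroup EM] [NormedSpace ℝ EM]
  {M : Type*} [TopologicalSpace M] [ChartedSpace EM M]
  {EG : Type*} [NormedAddCommGroup EG] [NormedSpace ℝ EG]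
  {G : Type*} [TopologicalSpace G] [ChartedSpace EG G]
  (𝒢 : LieGroupoid EM M EG G)

theorem mul_congr {g g' h h' : G} (hg : g = g') (hh : h = h') (w : 𝒢.tgt g = 𝒢.src h)
    (w' : 𝒢.tgt g' = 𝒢.src h') : 𝒢.mul g h w = 𝒢.mul g' h' w' := by
  subst hg hh
  rfl

theorem unit_mul' {x : M} {g : G} (h : 𝒢.tgt (𝒢.unit x) = 𝒢.src g) : 𝒢.mul (𝒢.unit x) g h = g := by
  obtain rfl : x = 𝒢.src g := (𝒢.tgt_unit x).symm.trans h
  exact 𝒢.unit_mul g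

theorem mul_unit' {x : M} {g : G} (h : 𝒢.tgt g = 𝒢.src (𝒢.unit x)) : 𝒢.mul g (𝒢.unit x) h = g := by
  obtain rfl : 𝒢.tgt g = x := h.trans (𝒢.src_unit x)
  exact 𝒢.mul_unit g

theorem inv_inv (g : G) : 𝒢.inv (𝒢.inv g) = g := by
  have h1 := 𝒢.mul_assoc g (𝒢.inv g) (𝒢.inv (𝒢.inv g)) (𝒢.src_inv g).symm (𝒢.src_inv _).symm
  rw [𝒢.mul_congr (𝒢.mul_inv g) rfl _ (by rw [𝒢.tgt_unit, 𝒢.src_inv, 𝒢.tgt_inv]),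
    𝒢.mul_congr rfl (𝒢.mul_inv (𝒢.inv g)) _ (by rw [𝒢.src_unit, 𝒢.src_inv]), 𝒢.unit_mul',
    𝒢.mul_unit'] at h1
  exact h1

theorem isPreconnected_src {𝒢 : LieGroupoid EM M EG G} (h : 𝒢.SourceConnected) (x : M) :
    IsPreconnected (𝒢.src ⁻¹' {x}) := (h x).isPreconnected

/-- Inversion maps source fibres onto target fibres. -/
theorem isPreconnected_tgt {𝒢 : LieGroupoid EM M EG G} (h : 𝒢.SourceConnected) (x : M) :
    IsPreconnected (𝒢.tgt ⁻¹' {x}) := by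
  have : 𝒢.tgt ⁻¹' {x} = 𝒢.inv '' (𝒢.src ⁻¹' {x}) := by
    ext g
    constructor
    · intro hg
      exact ⟨𝒢.inv g, (𝒢.src_inv g).trans hg, 𝒢.inv_inv g⟩
    · rintro ⟨g, hg, rfl⟩
      exact (𝒢.tgt_inv g).trans hg
  rw [this]
  exact (h x).isPreconnected.image _ 𝒢.contMDiff_inv.continuous.continuousOn

end LieGroupoid

/-! ## The horizontal multiplication relation -/

section Product

variable {EM : Type*} [NormedAddCommGroup EM] [NormedSpace ℝ EM]
  {M : Type*} [TopologicalSpace M] [ChartedSpace EM M]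
  {EG : Type*} [NormedAddCommGroup EG] [NormedSpace ℝ EG]
  {G : Type*} [TopologicalSpace G] [ChartedSpace EG G]
  {ER : Type*} [NormedAddCommGroup ER] [NormedSpace ℝ ER]
  {R : Type*} [TopologicalSpace R] [ChartedSpace ER R]

/-- The plots `a`, `b`, `q` of `R` satisfy `π q = π a · π b` and
`θ(q) = θ(a) + θ(b) + η(π a, π b)`. -/
structure IsProdLift (𝒢 : LieGroupoid EM M EG G) (π : R → G)
    (θ : DForm (manifoldDiffeology ER R) 1) (η : DForm 𝒢.smooth₂ 1) {n : ℕ} (a b q : Euc n → R) :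
    Prop where
  comp : ∀ y, 𝒢.tgt (π (a y)) = 𝒢.src (π (b y))
  mem_left : a ∈ (manifoldDiffeology ER R).plots n
  mem_right : b ∈ (manifoldDiffeology ER R).plots n
  mem : q ∈ (manifoldDiffeology ER R).plots n
  mem_pair : (fun y => (⟨(π (a y), π (b y)), comp y⟩ : 𝒢.Comp₂)) ∈ 𝒢.smooth₂.plots n
  proj : ∀ y, π (q y) = 𝒢.mul (π (a y)) (π (b y)) (comp y)
  lin_eq : ∀ y, θ.lin mem y = θ.lin mem_left y + θ.lin mem_right y + η.lin mem_pair y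

/-- The relation "`r₃` is the product of `r₁` and `r₂`", obtained from the unit law by parallel
transport in the second factor along the source fibres. -/
inductive IsProd (𝒢 : LieGroupoid EM M EG G) (π : R → G) (θ : DForm (manifoldDiffeology ER R) 1)
    (η : DForm 𝒢.smooth₂ 1) (e : M → R) (r : R) : R → R → Prop
  | unit : IsProd 𝒢 π θ η e r (e (𝒢.tgt (π r))) r
  | move {c q : Euc 1 → R} (h : IsProdLift 𝒢 π θ η (fun _ => r) c q) (s t : Euc 1) :
      IsProd 𝒢 π θ η e r (c s) (q s) → IsProd 𝒢 π θ η e r (c t) (q t)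

variable {𝒢 : LieGroupoid EM M EG G} {π : R → G} {θ : DForm (manifoldDiffeology ER R) 1}
  {η : DForm 𝒢.smooth₂ 1} {κ : DForm (manifoldDiffeology EG G) 2} {e : M → R} {n : ℕ}

theorem IsProdLift.reparam {a b q : Euc n → R} (h : IsProdLift 𝒢 π θ η a b q) {m : ℕ}
    {g : Euc m → Euc n} (hg : ContDiff ℝ ∞ g) : IsProdLift 𝒢 π θ η (a ∘ g) (b ∘ g) (q ∘ g) where
  comp y := h.comp (g y)
  mem_left := (manifoldDiffeology ER R).plot_reparam h.mem_left hg
  mem_right := (manifoldDiffeology ER R).plot_reparam h.mem_right hg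
  mem := (manifoldDiffeology ER R).plot_reparam h.mem hg
  mem_pair := 𝒢.smooth₂.plot_reparam h.mem_pair hg
  proj y := h.proj (g y)
  lin_eq y := by
    have h1 := η.lin_comp h.mem_pair hg y
    have h2 := congrArg (fun A => A.comp (fderiv ℝ g y)) (h.lin_eq (g y))
    simp only [ContinuousLinearMap.add_comp] at h2
    rw [θ.lin_comp h.mem hg, θ.lin_comp h.mem_left hg, θ.lin_comp h.mem_right hg, h2]
    exact congrArg _ h1.symm

/-- The cocycle condition `∂η = 0` along plots. -/
theorem LieGroupoid.IsThreeCocycle.lin_eq (h : 𝒢.IsThreeCocycle η κ) {p : Euc n → 𝒢.Comp₃}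
    (hp : p ∈ 𝒢.smooth₃.plots n) {p₀ p₁ p₂ p₃ : Euc n → 𝒢.Comp₂} (h₀ : p₀ ∈ 𝒢.smooth₂.plots n)
    (h₁ : p₁ ∈ 𝒢.smooth₂.plots n) (h₂ : p₂ ∈ 𝒢.smooth₂.plots n) (h₃ : p₃ ∈ 𝒢.smooth₂.plots n)
    (e₀ : 𝒢.face₃ 0 ∘ p = p₀) (e₁ : 𝒢.face₃ 1 ∘ p = p₁) (e₂ : 𝒢.face₃ 2 ∘ p = p₂)
    (e₃ : 𝒢.face₃ 3 ∘ p = p₃) (y : Euc n) :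
    η.lin h₀ y + η.lin h₂ y = η.lin h₁ y + η.lin h₃ y := by
  subst e₀ e₁ e₂ e₃
  have h4 := congrArg (fun α => DForm.lin α hp y) h.del_eta
  have h5 : η.lin h₀ y - η.lin h₁ y + η.lin h₂ y - η.lin h₃ y = 0 := by
    simp only [LieGroupoid.del₂, DForm.lin_sub, DForm.lin_add, DForm.lin_zero] at h4
    exact h4
  rw [← sub_eq_zero, ← h5]
  abel

/-- On the triples `(g, 1, 1)` three of the four faces are `(g, 1)` and the remaining one is `(1,
1)`, so `∂η = 0` gives `η(g, 1) = η(1, 1)`. Symmetrically, `(1, 1, g)` gives `lin_unit_left`. -/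
theorem LieGroupoid.IsThreeCocycle.lin_unit_right (h : 𝒢.IsThreeCocycle η κ) {g : Euc n → G}
    (hg : g ∈ (manifoldDiffeology EG G).plots n)
    {p : Euc n → 𝒢.Comp₂} (hp : p ∈ 𝒢.smooth₂.plots n)
    (h₁ : ∀ y, (p y).1.1 = g y) (h₂ : ∀ y, (p y).1.2 = 𝒢.unit (𝒢.tgt (g y)))
    (hx : (fun y => 𝒢.tgt (g y)) ∈ (manifoldDiffeology EM M).plots n) (y : Euc n) :
    η.lin hp y = -(LieGroupoid.unitForm η).lin hx y := by
  have hu := 𝒢.smooth_unit n _ hx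
  obtain rfl : p = fun y => ⟨(g y, 𝒢.unit (𝒢.tgt (g y))), (𝒢.src_unit _).symm⟩ :=
    funext fun y => Subtype.ext (Prod.ext (h₁ y) (h₂ y))
  have h3 := h.lin_eq (p := fun y => ⟨(g y, 𝒢.unit (𝒢.tgt (g y)), 𝒢.unit (𝒢.tgt (g y))),
    (𝒢.src_unit _).symm, (𝒢.tgt_unit _).trans (𝒢.src_unit _).symm⟩) ⟨hg, hu, hu⟩
    (𝒢.smooth_unit₂ n _ hx) hp hp hp rfl
    (funext fun y => Subtype.ext (Prod.ext (𝒢.mul_unit (g y)) rfl))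
    (funext fun y => Subtype.ext (Prod.ext rfl (𝒢.unit_mul_unit _))) rfl y
  rw [add_left_inj] at h3
  rw [← h3, LieGroupoid.unitForm, DForm.lin_neg, neg_neg]
  rfl

theorem LieGroupoid.IsThreeCocycle.lin_unit_left (h : 𝒢.IsThreeCocycle η κ) {g : Euc n → G}
    (hg : g ∈ (manifoldDiffeology EG G).plots n)
    {p : Euc n → 𝒢.Comp₂} (hp : p ∈ 𝒢.smooth₂.plots n)
    (h₁ : ∀ y, (p y).1.1 = 𝒢.unit (𝒢.src (g y))) (h₂ : ∀ y, (p y).1.2 = g y)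
    (hx : (fun y => 𝒢.src (g y)) ∈ (manifoldDiffeology EM M).plots n) (y : Euc n) :
    η.lin hp y = -(LieGroupoid.unitForm η).lin hx y := by
  have hu := 𝒢.smooth_unit n _ hx
  obtain rfl : p = fun y => ⟨(𝒢.unit (𝒢.src (g y)), g y), 𝒢.tgt_unit _⟩ :=
    funext fun y => Subtype.ext (Prod.ext (h₁ y) (h₂ y))
  have h3 := h.lin_eq (p := fun y => ⟨(𝒢.unit (𝒢.src (g y)), 𝒢.unit (𝒢.src (g y)), g y),
    (𝒢.tgt_unit _).trans (𝒢.src_unit _).symm, 𝒢.tgt_unit _⟩) ⟨hu, hu, hg⟩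
    hp hp hp (𝒢.smooth_unit₂ n _ hx) rfl
    (funext fun y => Subtype.ext (Prod.ext (𝒢.unit_mul_unit _) rfl))
    (funext fun y => Subtype.ext (Prod.ext rfl (𝒢.unit_mul (g y)))) rfl y
  rw [add_right_inj] at h3
  rw [h3, LieGroupoid.unitForm, DForm.lin_neg, neg_neg]
  rfl

variable [MulAction Circle R] {hπ : IsPrincipalCircleBundle EG ER π}

theorem IsPrincipalCircleBundle.pair_mem_plots (hπ : IsPrincipalCircleBundle EG ER π)
    {a b : Euc n → R} (ha : a ∈ (manifoldDiffeology ER R).plots n)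
    (hb : b ∈ (manifoldDiffeology ER R).plots n) (h : ∀ y, 𝒢.tgt (π (a y)) = 𝒢.src (π (b y))) :
    (fun y => (⟨(π (a y), π (b y)), h y⟩ : 𝒢.Comp₂)) ∈ 𝒢.smooth₂.plots n :=
  ⟨hπ.smooth_proj.comp ha, hπ.smooth_proj.comp hb⟩

/-! ### The flat circle bundle over composable pairs -/

section Pairs

variable (𝒢 π ER) in
/-- The smooth structure on the pairs in `R` with composable images in `G`. -/
abbrev pairsSmooth :
    DiffeologicalSpace {z : R × R // 𝒢.tgt (π z.1) = 𝒢.src (π z.2)} :=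
  subDiffeology (prodDiffeology (manifoldDiffeology ER R) (manifoldDiffeology ER R)) _

theorem IsPrincipalCircleBundle.smooth_pairProj (hπ : IsPrincipalCircleBundle EG ER π) :
    SmoothMap (pairsSmooth ER 𝒢 π) 𝒢.smooth₂ (fun z => ⟨(π z.1.1, π z.1.2), z.2⟩) :=
  fun _ _ hp => ⟨hπ.smooth_proj.comp hp.1, hπ.smooth_proj.comp hp.2⟩

/-- The form `θ(r₁) + θ(r₂) + η(π r₁, π r₂)`. -/
noncomputable def pairForm (hπ : IsPrincipalCircleBundle EG ER π)
    (θ : DForm (manifoldDiffeology ER R) 1) (η : DForm 𝒢.smooth₂ 1) :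
    DForm (pairsSmooth ER 𝒢 π) 1 :=
  θ.pullback (fun z => z.1.1) (smoothMap_fst _ _ _) +
    θ.pullback (fun z => z.1.2) (smoothMap_snd _ _ _) + η.pullback _ hπ.smooth_pairProj

theorem IsPrincipalCircleBundle.smooth_pairMul (hπ : IsPrincipalCircleBundle EG ER π) :
    SmoothMap (pairsSmooth ER 𝒢 π) (manifoldDiffeology EG G)
      (fun z => 𝒢.mul (π z.1.1) (π z.1.2) z.2) :=
  fun n p hp => 𝒢.smooth_mul n _ (hπ.smooth_pairProj n p hp)

/-- Flatness: `dη = -∂κ` cancels the curvatures `κ` at the two factors that come from `dθ` and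
leaves `κ` at the product, which is the integrability condition of `exists_isLift`. -/
theorem d_pairForm (hηκ : 𝒢.IsThreeCocycle η κ) (hκ : HasCurvature hπ θ κ) :
    (pairForm hπ θ η).d = κ.pullback _ hπ.smooth_pairMul := by
  refine DForm.ext_along fun n p hp y => ?_
  have h1 := hηκ.d_along (hπ.smooth_pairProj n p hp) (hπ.smooth_proj.comp hp.2)
    (hπ.smooth_pairMul n p hp) (hπ.smooth_proj.comp hp.1) rfl rfl rfl y
  have h2 := congrArg (fun α => DForm.along α n _ hp.1 y) hκ
  have h3 := congrArg (fun α => DForm.along α n _ hp.2 y) hκ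
  rw [pairForm, DForm.d_add_along, DForm.d_add_along]
  change θ.d.along n _ hp.1 y + θ.d.along n _ hp.2 y + η.d.along n _ _ y = _
  rw [h1]
  refine (congrArg₂ (fun A B => A + B + _) h2 h3).trans ?_
  change κ.along n _ (hπ.smooth_proj.comp hp.1) y + κ.along n _ (hπ.smooth_proj.comp hp.2) y +
    -(κ.along n _ (hπ.smooth_proj.comp hp.2) y - κ.along n _ (hπ.smooth_pairMul n p hp) y +
      κ.along n _ (hπ.smooth_proj.comp hp.1) y) = κ.along n _ (hπ.smooth_pairMul n p hp) y
  abel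

theorem IsProdLift.isLift {a b q : Euc n → R} (hπ : IsPrincipalCircleBundle EG ER π)
    (h : IsProdLift 𝒢 π θ η a b q) :
    IsLift (D := pairsSmooth ER 𝒢 π) π θ (fun z => 𝒢.mul (π z.1.1) (π z.1.2) z.2)
      (pairForm hπ θ η) (fun y => ⟨(a y, b y), h.comp y⟩) q :=
  ⟨⟨h.mem_left, h.mem_right⟩, h.mem, h.proj, h.lin_eq⟩

theorem IsProdLift.unique (hθ : IsConnection hπ θ) {a b q q' : Euc n → R}
    (h : IsProdLift 𝒢 π θ η a b q) (h' : IsProdLift 𝒢 π θ η a b q') {y₀ : Euc n}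
    (hy : q y₀ = q' y₀) : q = q' :=
  (h.isLift hπ).unique hθ (h'.isLift hπ) hy

theorem exists_isProdLift (hηκ : 𝒢.IsThreeCocycle η κ) (hθ : IsConnection hπ θ)
    (hκ : HasCurvature hπ θ κ) {a b : Euc n → R} (ha : a ∈ (manifoldDiffeology ER R).plots n)
    (hb : b ∈ (manifoldDiffeology ER R).plots n) (hab : ∀ y, 𝒢.tgt (π (a y)) = 𝒢.src (π (b y)))
    (y₀ : Euc n) {r : R} (hr : π r = 𝒢.mul (π (a y₀)) (π (b y₀)) (hab y₀)) :
    ∃ q, IsProdLift 𝒢 π θ η a b q ∧ q y₀ = r := by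
  obtain ⟨q, hq, hq0⟩ := exists_isLift (D := pairsSmooth ER 𝒢 π)
    (p := fun y => ⟨(a y, b y), hab y⟩) hθ hκ hπ.smooth_pairMul (d_pairForm hηκ hκ) ⟨ha, hb⟩ y₀ hr
  exact ⟨q, ⟨hab, ha, hb, hq.mem, hπ.pair_mem_plots ha hb hab, hq.proj, hq.lin_eq⟩, hq0⟩

end Pairs

theorem IsProdLift.smul_right (hθ : IsConnection hπ θ) {a b q : Euc n → R}
    (h : IsProdLift 𝒢 π θ η a b q) (z : Circle) : IsProdLift 𝒢 π θ η a b (fun y => z • q y) where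
  comp := h.comp
  mem_left := h.mem_left
  mem_right := h.mem_right
  mem := hπ.smul_mem_plots contMDiff_const h.mem
  mem_pair := h.mem_pair
  proj y := (hπ.proj_smul z _).trans (h.proj y)
  lin_eq y := (hθ.lin_const_smul z h.mem _ y).trans (h.lin_eq y)

/-- Products with units on the right. -/
theorem IsHorizontalUnit.isProdLift_right (he : IsHorizontalUnit 𝒢 π θ η e)
    (hηκ : 𝒢.IsThreeCocycle η κ) (hπ : IsPrincipalCircleBundle EG ER π) {a : Euc n → R}
    (ha : a ∈ (manifoldDiffeology ER R).plots n) :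
    IsProdLift 𝒢 π θ η a (fun y => e (𝒢.tgt (π (a y)))) a := by
  have hπa : (fun y => π (a y)) ∈ (manifoldDiffeology EG G).plots n := hπ.smooth_proj.comp ha
  have hx : (fun y => 𝒢.tgt (π (a y))) ∈ (manifoldDiffeology EM M).plots n :=
    𝒢.submersion_tgt.contMDiff.comp hπa
  have hl := he.isLift hx
  have hcomp : ∀ y, 𝒢.tgt (π (a y)) = 𝒢.src (π (e (𝒢.tgt (π (a y))))) := fun y => by
    rw [show π (e (𝒢.tgt (π (a y)))) = _ from hl.proj y, 𝒢.src_unit]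
  refine ⟨hcomp, ha, hl.mem, ha, hπ.pair_mem_plots ha hl.mem hcomp, fun y => ?_, fun y => ?_⟩
  · rw [𝒢.mul_congr rfl (show π (e (𝒢.tgt (π (a y)))) = _ from hl.proj y) _ (𝒢.src_unit _).symm,
      𝒢.mul_unit]
  · rw [hηκ.lin_unit_right hπa _ (fun y => rfl) hl.proj hx]
    have : θ.lin hl.mem y = _ := hl.lin_eq y
    rw [add_assoc, this, add_neg_cancel, add_zero]

/-- Products with units on the left. -/
theorem IsHorizontalUnit.isProdLift_left (he : IsHorizontalUnit 𝒢 π θ η e)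
    (hηκ : 𝒢.IsThreeCocycle η κ) (hπ : IsPrincipalCircleBundle EG ER π) {b : Euc n → R}
    (hb : b ∈ (manifoldDiffeology ER R).plots n) :
    IsProdLift 𝒢 π θ η (fun y => e (𝒢.src (π (b y)))) b b := by
  have hπb : (fun y => π (b y)) ∈ (manifoldDiffeology EG G).plots n := hπ.smooth_proj.comp hb
  have hx : (fun y => 𝒢.src (π (b y))) ∈ (manifoldDiffeology EM M).plots n :=
    𝒢.submersion_src.contMDiff.comp hπb
  have hl := he.isLift hx
  have hcomp : ∀ y, 𝒢.tgt (π (e (𝒢.src (π (b y))))) = 𝒢.src (π (b y)) := fun y => by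
    rw [show π (e (𝒢.src (π (b y)))) = _ from hl.proj y, 𝒢.tgt_unit]
  refine ⟨hcomp, hl.mem, hb, hb, hπ.pair_mem_plots hl.mem hb hcomp, fun y => ?_, fun y => ?_⟩
  · rw [𝒢.mul_congr (show π (e (𝒢.src (π (b y)))) = _ from hl.proj y) rfl _ (𝒢.tgt_unit _),
      𝒢.unit_mul]
  · rw [hηκ.lin_unit_left hπb _ hl.proj (fun y => rfl) hx]
    have : θ.lin hl.mem y = _ := hl.lin_eq y
    rw [this, add_neg_cancel_comm]

end Product

/-! ### Existence and uniqueness of products by parallel transport -/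

section Product

variable {EM : Type*} [NormedAddCommGroup EM] [NormedSpace ℝ EM]
  {M : Type*} [TopologicalSpace M] [ChartedSpace EM M]
  {EG : Type*} [NormedAddCommGroup EG] [NormedSpace ℝ EG]
  {G : Type*} [TopologicalSpace G] [ChartedSpace EG G]
  {ER : Type*} [NormedAddCommGroup ER] [NormedSpace ℝ ER]
  {R : Type*} [TopologicalSpace R] [ChartedSpace ER R] [MulAction Circle R]
  {𝒢 : LieGroupoid EM M EG G} {π : R → G} {hπ : IsPrincipalCircleBundle EG ER π}
  {θ : DForm (manifoldDiffeology ER R) 1}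
  {η : DForm 𝒢.smooth₂ 1} {κ : DForm (manifoldDiffeology EG G) 2} {e : M → R} {n : ℕ}

theorem IsProdLift.smul_left (hθ : IsConnection hπ θ) {a b q : Euc n → R}
    (h : IsProdLift 𝒢 π θ η a b q) (z : Circle) :
    IsProdLift 𝒢 π θ η (fun y => z • a y) b (fun y => z • q y) := by
  have hcomp : ∀ y, 𝒢.tgt (π (z • a y)) = 𝒢.src (π (b y)) := fun y => by
    rw [hπ.proj_smul, h.comp]
  have hza := hπ.smul_mem_plots (z := fun _ => z) contMDiff_const h.mem_left
  refine ⟨hcomp, hza, h.mem_right, hπ.smul_mem_plots contMDiff_const h.mem,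
    hπ.pair_mem_plots hza h.mem_right hcomp, fun y => ?_, fun y => ?_⟩
  · rw [hπ.proj_smul, h.proj]
    exact 𝒢.mul_congr (hπ.proj_smul z _).symm rfl _ _
  · rw [hθ.lin_const_smul z h.mem, hθ.lin_const_smul z h.mem_left, h.lin_eq]
    congr 1
    exact η.lin_congr h.mem_pair (hπ.pair_mem_plots hza h.mem_right hcomp)
      (funext fun y => Subtype.ext (Prod.ext (hπ.proj_smul z _).symm rfl)) y

/-- A variable rotation of the second factor adds the same `du` to both sides of the horizontality
equation, so rotating along a circle orbit is itself a parallel transport. -/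
theorem IsProdLift.exp_smul (hθ : IsConnection hπ θ) {a b q : Euc n → R}
    (h : IsProdLift 𝒢 π θ η a b q) {u : Euc n → ℝ} (hu : ContDiff ℝ ∞ u) :
    IsProdLift 𝒢 π θ η a (fun y => Circle.exp (2 * Real.pi * u y) • b y)
      (fun y => Circle.exp (2 * Real.pi * u y) • q y) := by
  have hcomp : ∀ y, 𝒢.tgt (π (a y)) = 𝒢.src (π (Circle.exp (2 * Real.pi * u y) • b y)) :=
    fun y => by rw [hπ.proj_smul, h.comp]
  have hzb := hπ.smul_mem_plots (contMDiff_exp_two_pi hu) h.mem_right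
  refine ⟨hcomp, h.mem_left, hzb, hπ.smul_mem_plots (contMDiff_exp_two_pi hu) h.mem,
    hπ.pair_mem_plots h.mem_left hzb hcomp, fun y => ?_, fun y => ?_⟩
  · rw [hπ.proj_smul, h.proj]
    exact 𝒢.mul_congr rfl (hπ.proj_smul _ _).symm _ _
  · rw [hθ.lin_exp_smul hu h.mem, hθ.lin_exp_smul hu h.mem_right, h.lin_eq]
    rw [← η.lin_congr h.mem_pair (hπ.pair_mem_plots h.mem_left hzb hcomp)
      (funext fun y => Subtype.ext (Prod.ext rfl (hπ.proj_smul _ _).symm)) y]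
    abel

theorem isProdLift_const (hπ : IsPrincipalCircleBundle EG ER π) {r₁ r₂ r₃ : R}
    (hc : 𝒢.tgt (π r₁) = 𝒢.src (π r₂)) (h : π r₃ = 𝒢.mul (π r₁) (π r₂) hc) :
    IsProdLift 𝒢 π θ η (fun _ : Euc n => r₁) (fun _ => r₂) (fun _ => r₃) := by
  have hp := (manifoldDiffeology ER R).constant_plots (n := n)
  refine ⟨fun _ => hc, hp r₁, hp r₂, hp r₃, hπ.pair_mem_plots (hp _) (hp _) fun _ => hc,
    fun _ => h, fun y => ?_⟩
  rw [θ.lin_const, θ.lin_const, θ.lin_const, η.lin_const]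
  simp

namespace IsProd

variable {r₁ r₂ r₃ : R}

omit [MulAction Circle R] in
theorem proj_eq (he : IsHorizontalUnit 𝒢 π θ η e) (h : IsProd 𝒢 π θ η e r₁ r₂ r₃) :
    ∃ hc, π r₃ = 𝒢.mul (π r₁) (π r₂) hc := by
  induction h with
  | unit =>
    obtain ⟨h, -, -⟩ := he
    rw [← h]
    exact ⟨(𝒢.src_unit _).symm, (𝒢.mul_unit _).symm⟩
  | move h s t _ _ => exact ⟨h.comp t, h.proj t⟩

/-- The relation has no constructor for rotations; a rotation of the second factor is transport
along the curve `t ↦ e^{2πit} • r₂`. -/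
theorem smul_right (he : IsHorizontalUnit 𝒢 π θ η e) (hθ : IsConnection hπ θ)
    (h : IsProd 𝒢 π θ η e r₁ r₂ r₃) (z : Circle) : IsProd 𝒢 π θ η e r₁ (z • r₂) (z • r₃) := by
  obtain ⟨hc, h3⟩ := h.proj_eq he
  have h1 := (isProdLift_const (θ := θ) (η := η) (n := 1) hπ hc h3).exp_smul hθ
    (u := fun t => t 0) (by fun_prop)
  have h2 := IsProd.move (e := e) h1 0 (pt (circleLog z)) (by simpa using h)
  simpa [exp_circleLog] using h2

theorem smul_left (hθ : IsConnection hπ θ) (h : IsProd 𝒢 π θ η e r₁ r₂ r₃) (z : Circle) :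
    IsProd 𝒢 π θ η e (z • r₁) r₂ (z • r₃) := by
  induction h with
  | unit =>
    have := IsProd.unit (𝒢 := 𝒢) (π := π) (θ := θ) (η := η) (e := e) (r := z • r₁)
    rwa [hπ.proj_smul] at this
  | move h s t _ ih => exact IsProd.move (h.smul_left hθ z) s t ih

/-- For a unit as first factor, `e x · c = c` is a horizontal solution along every admissible curve
`c`; uniqueness of lifts leaves no room for holonomy. -/
theorem eq_of_unit_left (he : IsHorizontalUnit 𝒢 π θ η e) (hηκ : 𝒢.IsThreeCocycle η κ)
    (hθ : IsConnection hπ θ) {x : M} (h : IsProd 𝒢 π θ η e (e x) r₂ r₃) : r₃ = r₂ := by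
  have hex : 𝒢.tgt (π (e x)) = x := by
    obtain ⟨h, -, -⟩ := he
    rw [← h, 𝒢.tgt_unit]
  induction h with
  | unit => rw [hex]
  | @move c q h s t _ ih =>
    have h1 := he.isProdLift_left hηκ hπ h.mem_right
    have h2 : (fun y => e (𝒢.src (π (c y)))) = fun _ => e x :=
      funext fun y => by rw [← h.comp y, hex]
    rw [h2] at h1
    exact congrFun (h.unique hθ h1 ih) t

/-- Transports in the two factors commute because the connection is flat, so a derivation of the
relation for `a s₀` can be moved step by step to `a s`. The base case is the horizontality of `a · e
= a`; the target is constant along `a` since the second factor is fixed. -/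
theorem move_left (he : IsHorizontalUnit 𝒢 π θ η e) (hηκ : 𝒢.IsThreeCocycle η κ)
    (hθ : IsConnection hπ θ) (hκ : HasCurvature hπ θ κ) {a q : Euc 1 → R}
    (hq : IsProdLift 𝒢 π θ η a (fun _ => r₂) q) {s₀ : Euc 1} (hs₀ : q s₀ = r₃)
    (h : IsProd 𝒢 π θ η e (a s₀) r₂ r₃) (s : Euc 1) : IsProd 𝒢 π θ η e (a s) r₂ (q s) := by
  have hx : ∀ s, 𝒢.tgt (π (a s)) = 𝒢.tgt (π (a s₀)) := fun s => (hq.comp s).trans (hq.comp s₀).symm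
  have ha := hq.mem_left
  induction h generalizing q s with
  | unit =>
    have h1 := he.isProdLift_right hηκ hπ ha
    simp only [hx] at h1
    rw [hq.unique hθ h1 hs₀, ← hx s]
    exact IsProd.unit
  | @move c q₀ h s₁ t _ ih =>
    let A : Euc 2 → R := fun w => a (pt (w 0))
    let C : Euc 2 → R := fun w => c (pt (w 1))
    have hA : A ∈ (manifoldDiffeology ER R).plots 2 :=
      (manifoldDiffeology ER R).plot_reparam ha (contDiff_pt.comp (by fun_prop))
    have hC : C ∈ (manifoldDiffeology ER R).plots 2 :=
      (manifoldDiffeology ER R).plot_reparam h.mem_right (contDiff_pt.comp (by fun_prop))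
    -- A horizontal lift over the rectangle `(s, t) ↦ (a s, c t)`. By uniqueness of lifts it
    -- restricts to the given transports on two adjacent edges, and the other two edges supply the
    -- moved derivation.
    obtain ⟨Γ, hΓ, hΓ0⟩ := exists_isProdLift hηκ hθ hκ hA hC
      (fun w => (hx _).trans (h.comp _)) (pt₂ (s₀ 0) (s₁ 0)) (r := q₀ s₁)
      (by simpa [A, C] using h.proj s₁)
    have hL : ∀ t : Euc 1, IsProdLift 𝒢 π θ η a (fun _ => c t) (fun v => Γ (pt₂ (v 0) (t 0))) := by
      intro t
      simpa [A, C, Function.comp_def] using hΓ.reparam (contDiff_pt₂_left (t 0))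
    have hR : ∀ s : Euc 1, IsProdLift 𝒢 π θ η (fun _ => a s) c (fun v => Γ (pt₂ (s 0) (v 0))) := by
      intro s
      simpa [A, C, Function.comp_def] using hΓ.reparam (contDiff_pt₂_right (s 0))
    have e1 := (hR s₀).unique hθ h (y₀ := s₁) hΓ0
    have e2 := (hL t).unique hθ hq (y₀ := s₀) ((congrFun e1 t).trans hs₀.symm)
    rw [← e2]
    exact IsProd.move (hR s) s₁ t (ih (hL s₁) hΓ0 s)

variable [IsManifold 𝓘(ℝ, ER) ∞ R]

/-- The admissible second factors form the fibre of `src ∘ π` over `tgt (π r₁)`, which contains the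
unit where the product is known; transport carries solvability along this connected fibre. -/
theorem exists_of_comp (h𝒢 : 𝒢.SourceConnected) (he : IsHorizontalUnit 𝒢 π θ η e)
    (hηκ : 𝒢.IsThreeCocycle η κ) (hθ : IsConnection hπ θ) (hκ : HasCurvature hπ θ κ)
    (hc : 𝒢.tgt (π r₁) = 𝒢.src (π r₂)) : ∃ r₃, IsProd 𝒢 π θ η e r₁ r₂ r₃ := by
  have hex : 𝒢.src (π (e (𝒢.tgt (π r₁)))) = 𝒢.tgt (π r₁) := by
    obtain ⟨h, -, -⟩ := he
    rw [← h, 𝒢.src_unit]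
  refine hπ.fibre_curve_induction (P := fun r₂ => ∃ r₃, IsProd 𝒢 π θ η e r₁ r₂ r₃)
    𝒢.submersion_src (LieGroupoid.isPreconnected_src h𝒢 (𝒢.tgt (π r₁))) (fun c hcm hx s t h => ?_)
    hex hc.symm ⟨r₁, IsProd.unit⟩
  obtain ⟨r₃, h⟩ := h
  obtain ⟨_, h3⟩ := h.proj_eq he
  obtain ⟨q, hq, hq0⟩ := exists_isProdLift hηκ hθ hκ
    ((manifoldDiffeology ER R).constant_plots r₁) hcm (fun t => (hx t).symm) s h3
  exact ⟨q t, IsProd.move hq s t (hq0 ▸ h)⟩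

/-- Absence of holonomy: two values of the product are moved together, with the second factor fixed,
along the target fibre of the first factor to a unit. There both equal the second factor, and
transport back keeps them equal. -/
theorem unique (h𝒢 : 𝒢.SourceConnected) (he : IsHorizontalUnit 𝒢 π θ η e)
    (hηκ : 𝒢.IsThreeCocycle η κ) (hθ : IsConnection hπ θ) (hκ : HasCurvature hπ θ κ) {r₃' : R}
    (h : IsProd 𝒢 π θ η e r₁ r₂ r₃) (h' : IsProd 𝒢 π θ η e r₁ r₂ r₃') : r₃ = r₃' := by
  have hex : 𝒢.tgt (π (e (𝒢.tgt (π r₁)))) = 𝒢.tgt (π r₁) := by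
    obtain ⟨h, -, -⟩ := he
    rw [← h, 𝒢.tgt_unit]
  refine hπ.fibre_curve_induction (P := fun r₁ => ∀ r₂ r₃ r₃', IsProd 𝒢 π θ η e r₁ r₂ r₃ →
    IsProd 𝒢 π θ η e r₁ r₂ r₃' → r₃ = r₃') 𝒢.submersion_tgt
    (LieGroupoid.isPreconnected_tgt h𝒢 (𝒢.tgt (π r₁))) (fun c hcm hx s t ih r₂ r₃ r₃' h h' => ?_)
    hex rfl (fun r₂ r₃ r₃' h h' => ?_) _ _ _ h h'
  · obtain ⟨hc, h3⟩ := h.proj_eq he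
    obtain ⟨_, h3'⟩ := h'.proj_eq he
    have hcomp : ∀ t, 𝒢.tgt (π (c t)) = 𝒢.src (π r₂) := fun t' => by rw [hx, ← hc, hx]
    have hr₂ := (manifoldDiffeology ER R).constant_plots (n := 1) r₂
    obtain ⟨q, hq, hq0⟩ := exists_isProdLift hηκ hθ hκ hcm hr₂ hcomp t h3
    obtain ⟨q', hq', hq0'⟩ := exists_isProdLift hηκ hθ hκ hcm hr₂ hcomp t h3'
    have := ih _ _ _ (h.move_left he hηκ hθ hκ hq hq0 s) (h'.move_left he hηκ hθ hκ hq' hq0' s)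
    rw [← hq0, ← hq0', hq.unique hθ hq' this]
  · rw [h.eq_of_unit_left he hηκ hθ, h'.eq_of_unit_left he hηκ hθ]

end IsProd

/-- Lifting a homotopy of the second factor relative to the source map. -/
theorem IsBox.exists_isProdLift_iff (hηκ : 𝒢.IsThreeCocycle η κ) (hθ : IsConnection hπ θ)
    (hκ : HasCurvature hπ θ κ) {N : Set R}
    (hN : IsBox (EM := EM) (ER := ER) (fun r => 𝒢.src (π r)) N) {a b b' q : Euc 1 → R}
    (h : IsProdLift 𝒢 π θ η a b q) (hb : ∀ t, b t ∈ N)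
    (hbm' : b' ∈ (manifoldDiffeology ER R).plots 1) (hb' : ∀ t, b' t ∈ N)
    (hbb' : ∀ t, 𝒢.src (π (b t)) = 𝒢.src (π (b' t))) :
    ∃ q', IsProdLift 𝒢 π θ η a b' q' ∧
      ∀ t, IsProd 𝒢 π θ η e (a t) (b t) (q t) ↔ IsProd 𝒢 π θ η e (a t) (b' t) (q' t) := by
  obtain ⟨Λ, hΛ, hfΛ, hΛ0, hΛ1⟩ := hN.join b b' h.mem_right hbm' hb hb' hbb'
  let A : Euc 2 → R := fun w => a (pt (w 1))
  have hA : A ∈ (manifoldDiffeology ER R).plots 2 :=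
    (manifoldDiffeology ER R).plot_reparam h.mem_left (contDiff_pt.comp (by fun_prop))
  obtain ⟨Γ, hΓ, hΓ0⟩ := exists_isProdLift hηκ hθ hκ hA hΛ
    (fun w => (h.comp _).trans (hfΛ w).symm) (pt₂ 0 0) (r := q (pt 0))
    (by simpa [A, hΛ0] using h.proj (pt 0))
  have h0 : IsProdLift 𝒢 π θ η a b (fun v => Γ (pt₂ 0 (v 0))) := by
    simpa [A, hΛ0, Function.comp_def] using hΓ.reparam (contDiff_pt₂_right 0)
  have h1 : IsProdLift 𝒢 π θ η a b' (fun v => Γ (pt₂ 1 (v 0))) := by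
    simpa [A, hΛ1, Function.comp_def] using hΓ.reparam (contDiff_pt₂_right 1)
  obtain rfl := h0.unique hθ h (y₀ := pt 0) (by simpa using hΓ0)
  refine ⟨_, h1, fun t => ?_⟩
  -- Along the homotopy parameter the first factor is constant, so this direction of the lift is a
  -- step allowed by `IsProd.move`, although both factors vary with `t`.
  have hS : IsProdLift 𝒢 π θ η (fun _ => a t) (fun s : Euc 1 => Λ (pt₂ (s 0) (t 0)))
      (fun s : Euc 1 => Γ (pt₂ (s 0) (t 0))) := by
    simpa [A, Function.comp_def] using hΓ.reparam (contDiff_pt₂_left (t 0))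
  constructor
  · intro h
    simpa [hΛ1] using IsProd.move (e := e) hS (pt 0) (pt 1) (by simpa [hΛ0] using h)
  · intro h
    simpa [hΛ0] using IsProd.move (e := e) hS (pt 1) (pt 0) (by simpa [hΛ1] using h)

end Product

/-! ### Transport along families in which both factors vary, and associativity -/

section Product

variable {EM : Type*} [NormedAddCommGroup EM] [NormedSpace ℝ EM]
  {M : Type*} [TopologicalSpace M] [ChartedSpace EM M]
  {EG : Type*} [NormedAddCommGroup EG] [NormedSpace ℝ EG]
  {G : Type*} [TopologicalSpace G] [ChartedSpace EG G]
  {ER : Type*} [NormedAddCommGroup ER] [NormedSpace ℝ ER]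
  {R : Type*} [TopologicalSpace R] [ChartedSpace ER R] [IsManifold 𝓘(ℝ, ER) ∞ R]
  [MulAction Circle R]
  {𝒢 : LieGroupoid EM M EG G} {π : R → G} {hπ : IsPrincipalCircleBundle EG ER π}
  {θ : DForm (manifoldDiffeology ER R) 1}
  {η : DForm 𝒢.smooth₂ 1} {κ : DForm (manifoldDiffeology EG G) 2} {e : M → R} {n : ℕ}

/-- Near a unit the second factor `b` can be deformed in a box to the curve of units `e (src b)`.
Along that curve the product is `a`, which is a horizontal lift satisfying the relation everywhere,
and `exists_isProdLift_iff` carries this back to `b`. -/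
theorem IsProdLift.eventually_isProd_of_unit (h𝒢 : 𝒢.SourceConnected)
    (he : IsHorizontalUnit 𝒢 π θ η e) (hηκ : 𝒢.IsThreeCocycle η κ) (hθ : IsConnection hπ θ)
    (hκ : HasCurvature hπ θ κ) {a b q : Euc 1 → R} (h : IsProdLift 𝒢 π θ η a b q) {t₀ : Euc 1}
    {x : M} (hx : b t₀ = e x) (h0 : IsProd 𝒢 π θ η e (a t₀) (b t₀) (q t₀)) :
    ∀ᶠ t in 𝓝 t₀, IsProd 𝒢 π θ η e (a t) (b t) (q t) := by
  have hex : 𝒢.src (π (e x)) = x := by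
    obtain ⟨h, -, -⟩ := he
    rw [← h, 𝒢.src_unit]
  obtain ⟨N, hxN, hN⟩ := exists_isBox (hπ.isSubmersion_comp 𝒢.submersion_src) (e x)
  have hub := (he.isProdLift_left hηκ hπ h.mem_right).mem_left
  have e1 : ∀ᶠ t in 𝓝 t₀, b t ∈ N :=
    (ContMDiff.continuous h.mem_right).continuousAt.eventually_mem
      (hN.isOpen.mem_nhds (hx ▸ hxN))
  have e2 : ∀ᶠ t in 𝓝 t₀, e (𝒢.src (π (b t))) ∈ N :=
    (ContMDiff.continuous hub).continuousAt.eventually_mem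
      (hN.isOpen.mem_nhds (by simpa [hx, hex] using hxN))
  obtain ⟨g, hg, hgid, hgu⟩ := exists_contDiff_eventuallyEq_id (e1.and e2)
  have hg0 : g t₀ = t₀ := hgid.self_of_nhds
  have hag := (h.reparam hg).mem_left
  have hu := he.isProdLift_right hηκ hπ hag
  simp only [Function.comp_apply, h.comp] at hu
  obtain ⟨q', hq', hiff⟩ := hN.exists_isProdLift_iff (e := e) hηκ hθ hκ (h.reparam hg)
    (fun t => (hgu t).1) hu.mem_right (fun t => (hgu t).2) (fun t => by
      obtain ⟨h, -, -⟩ := he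
      simp [← h, 𝒢.src_unit])
  have hunit : ∀ t, IsProd 𝒢 π θ η e (a (g t)) (e (𝒢.src (π (b (g t))))) (a (g t)) := fun t => by
    rw [← h.comp]
    exact IsProd.unit
  have h1 := (hiff t₀).1 (by simpa [hg0] using h0)
  have h2 := h1.unique h𝒢 he hηκ hθ hκ (hunit t₀)
  obtain rfl := hq'.unique hθ hu h2
  filter_upwards [hgid] with t ht
  simpa [show g t = t from ht] using (hiff t).2 (hunit t)

/-- Local invariance for all curves through a point `r` of the second factor is a property of `r`
that passes to nearby points of the same source fibre: a curve through the one is deformed, over the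
same source curve, to a curve through the other. It starts at the unit of the fibre. -/
theorem IsProdLift.eventually_isProd (h𝒢 : 𝒢.SourceConnected)
    (he : IsHorizontalUnit 𝒢 π θ η e) (hηκ : 𝒢.IsThreeCocycle η κ) (hθ : IsConnection hπ θ)
    (hκ : HasCurvature hπ θ κ) {a b q : Euc 1 → R} (h : IsProdLift 𝒢 π θ η a b q) {t₀ : Euc 1}
    (h0 : IsProd 𝒢 π θ η e (a t₀) (b t₀) (q t₀)) :
    ∀ᶠ t in 𝓝 t₀, IsProd 𝒢 π θ η e (a t) (b t) (q t) := by
  have hex : 𝒢.src (π (e (𝒢.src (π (b t₀))))) = 𝒢.src (π (b t₀)) := by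
    obtain ⟨h, -, -⟩ := he
    rw [← h, 𝒢.src_unit]
  refine hπ.fibre_induction (f := 𝒢.src) (P := fun r => ∀ (a b q : Euc 1 → R) (t₀ : Euc 1),
    IsProdLift 𝒢 π θ η a b q → b t₀ = r → IsProd 𝒢 π θ η e (a t₀) (b t₀) (q t₀) →
    ∀ᶠ t in 𝓝 t₀, IsProd 𝒢 π θ η e (a t) (b t) (q t))
    (LieGroupoid.isPreconnected_src h𝒢 (𝒢.src (π (b t₀)))) (fun r _ => ?_) hex rfl
    (fun a b q t₀ h hb h0 => h.eventually_isProd_of_unit h𝒢 he hηκ hθ hκ hb h0) a b q t₀ h rfl h0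
  clear h h0 hex
  obtain ⟨N, hrN, hN⟩ := exists_isBox (hπ.isSubmersion_comp 𝒢.submersion_src) r
  refine ⟨N, hN.isOpen.mem_nhds hrN, fun r₁ h1N r₂ h2N h1x h2x ih a b q t₀ h hb h0 => ?_⟩
  have e1 : ∀ᶠ t in 𝓝 t₀, b t ∈ N :=
    (ContMDiff.continuous h.mem_right).continuousAt.eventually_mem
      (hN.isOpen.mem_nhds (hb ▸ h2N))
  obtain ⟨g, hg, hgid, hgu⟩ := exists_contDiff_eventuallyEq_id e1
  have hg0 : g t₀ = t₀ := hgid.self_of_nhds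
  obtain ⟨β, hβ, hβid, a', ha', ha'N, ha'x, ha'0⟩ := hN.lift (fun t => 𝒢.src (π (b (g t))))
    (𝒢.submersion_src.contMDiff.comp (hπ.smooth_proj.comp (h.reparam hg).mem_right)) t₀ r₁ h1N
    (by rw [h1x, hg0, hb, h2x])
  have hβ0 : β t₀ = t₀ := hβid.self_of_nhds
  obtain ⟨q', hq', hiff⟩ := hN.exists_isProdLift_iff (e := e) hηκ hθ hκ (h.reparam (hg.comp hβ))
    (fun t => hgu _) ha' ha'N (fun t => (ha'x t).symm)
  have h1 := ih _ _ _ t₀ hq' ha'0 ((hiff t₀).1 (by simpa [hβ0, hg0] using h0))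
  have hβg : Tendsto β (𝓝 t₀) (𝓝 t₀) := by simpa [hβ0] using hβ.continuous.tendsto t₀
  filter_upwards [h1, hβid, hβg.eventually hgid] with t h1 h2 h3
  have h4 := (hiff t).2 h1
  have h5 : g (β t) = t := h3.trans h2
  simpa [h5] using h4

/-- At each time some rotation `z • q` satisfies the relation, and by the local result it does so on
a whole neighbourhood. If `q` satisfies it at one nearby time, single-valuedness forces `z = 1`, so
the set of good times is open and closed. -/
theorem IsProdLift.isProd_euc_one (h𝒢 : 𝒢.SourceConnected)
    (he : IsHorizontalUnit 𝒢 π θ η e) (hηκ : 𝒢.IsThreeCocycle η κ) (hθ : IsConnection hπ θ)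
    (hκ : HasCurvature hπ θ κ) {a b q : Euc 1 → R} (h : IsProdLift 𝒢 π θ η a b q) {t₀ : Euc 1}
    (h0 : IsProd 𝒢 π θ η e (a t₀) (b t₀) (q t₀)) (t : Euc 1) :
    IsProd 𝒢 π θ η e (a t) (b t) (q t) := by
  refine isPreconnected_univ.induction_of_locally
    (P := fun t => IsProd 𝒢 π θ η e (a t) (b t) (q t)) (fun t₁ _ => ?_) (Set.mem_univ t₀)
    (Set.mem_univ t) h0
  obtain ⟨r, hr⟩ := IsProd.exists_of_comp h𝒢 he hηκ hθ hκ (h.comp t₁)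
  obtain ⟨_, hr'⟩ := hr.proj_eq he
  obtain ⟨z, rfl⟩ := hπ.exists_smul_eq ((h.proj t₁).trans hr'.symm)
  refine ⟨_, (h.smul_right hθ z).eventually_isProd h𝒢 he hηκ hθ hκ hr, ?_⟩
  rintro y ⟨hy, -⟩ y' ⟨hy', -⟩ h1
  have h2 : z • q y = (1 : Circle) • q y := by
    rw [one_smul]
    exact IsProd.unique h𝒢 he hηκ hθ hκ hy h1
  obtain rfl := hπ.smul_right_injective _ h2
  simpa using hy'

/-- The product relation is invariant under horizontal transport along all plots. -/
theorem IsProdLift.isProd (h𝒢 : 𝒢.SourceConnected)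
    (he : IsHorizontalUnit 𝒢 π θ η e) (hηκ : 𝒢.IsThreeCocycle η κ) (hθ : IsConnection hπ θ)
    (hκ : HasCurvature hπ θ κ) {a b q : Euc n → R} (h : IsProdLift 𝒢 π θ η a b q) {y₀ : Euc n}
    (h0 : IsProd 𝒢 π θ η e (a y₀) (b y₀) (q y₀)) (y : Euc n) :
    IsProd 𝒢 π θ η e (a y) (b y) (q y) := by
  have hl : ContDiff ℝ ∞ (fun t : Euc 1 => y₀ + t 0 • (y - y₀)) := by fun_prop
  have := (h.reparam hl).isProd_euc_one h𝒢 he hηκ hθ hκ (t₀ := pt 0) (by simpa using h0) (pt 1)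
  simpa using this

namespace IsProd

variable {r₁ r₂ r₃ r₁₂ r₂₃ s s' : R}

/-- As the third factor moves in its source fibre, both bracketings are horizontal for the pair
`(r₁₂, c)`: `∂η = 0` on `(g₁, g₂, h)` compares the forms, and `η(g₁, g₂)` drops out because that
pair is constant. They agree when the third factor is a unit. -/
theorem assoc (h𝒢 : 𝒢.SourceConnected) (he : IsHorizontalUnit 𝒢 π θ η e)
    (hηκ : 𝒢.IsThreeCocycle η κ) (hθ : IsConnection hπ θ) (hκ : HasCurvature hπ θ κ)
    (h₁₂ : IsProd 𝒢 π θ η e r₁ r₂ r₁₂) (h₂₃ : IsProd 𝒢 π θ η e r₂ r₃ r₂₃)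
    (hs : IsProd 𝒢 π θ η e r₁₂ r₃ s) (hs' : IsProd 𝒢 π θ η e r₁ r₂₃ s') : s = s' := by
  obtain ⟨hc₂₃, -⟩ := h₂₃.proj_eq he
  obtain ⟨hc₁₂, hr₁₂⟩ := h₁₂.proj_eq he
  have htgt : 𝒢.tgt (π r₁₂) = 𝒢.tgt (π r₂) := by rw [hr₁₂, 𝒢.tgt_mul]
  have hex : 𝒢.src (π (e (𝒢.tgt (π r₂)))) = 𝒢.tgt (π r₂) := by
    obtain ⟨h, -, -⟩ := he
    rw [← h, 𝒢.src_unit]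
  refine hπ.fibre_curve_induction (P := fun r₃ => ∀ r₂₃ s s', IsProd 𝒢 π θ η e r₂ r₃ r₂₃ →
    IsProd 𝒢 π θ η e r₁₂ r₃ s → IsProd 𝒢 π θ η e r₁ r₂₃ s' → s = s') 𝒢.submersion_src
    (LieGroupoid.isPreconnected_src h𝒢 (𝒢.tgt (π r₂)))
    (fun c hcm hx t₁ t ih r₂₃ s s' h₂₃ hs hs' => ?_) hex hc₂₃.symm
    (fun r₂₃ s s' h₂₃ hs hs' => ?_) _ _ _ h₂₃ hs hs'
  · have hcst := (manifoldDiffeology ER R).constant_plots (n := 1)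
    obtain ⟨_, p₂₃⟩ := h₂₃.proj_eq he
    obtain ⟨_, ps⟩ := hs.proj_eq he
    obtain ⟨_, ps'⟩ := hs'.proj_eq he
    obtain ⟨q₂₃, hq₂₃, rfl⟩ := exists_isProdLift hηκ hθ hκ (hcst r₂) hcm
      (fun t => (hx t).symm) t p₂₃
    obtain ⟨q, hq, rfl⟩ := exists_isProdLift hηκ hθ hκ (hcst r₁₂) hcm
      (fun t => htgt.trans (hx t).symm) t ps
    obtain ⟨q', hq', rfl⟩ := exists_isProdLift hηκ hθ hκ (hcst r₁) hq₂₃.mem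
      (fun t => by rw [hq₂₃.proj, 𝒢.src_mul, hc₁₂]) t ps'
    have h1 := ih _ _ _ (IsProd.move hq₂₃ t t₁ h₂₃) (IsProd.move hq t t₁ hs)
      (IsProd.move hq' t t₁ hs')
    refine congrFun (hq.unique hθ (q' := q') ⟨hq.comp, hq.mem_left, hcm, hq'.mem, hq.mem_pair,
      fun y => ?_, fun y => ?_⟩ h1) t
    · rw [hq'.proj, 𝒢.mul_congr rfl (hq₂₃.proj y) _
        (hc₁₂.trans (𝒢.src_mul _ _ _).symm), ← 𝒢.mul_assoc _ _ _ hc₁₂ (hx y).symm]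
      exact 𝒢.mul_congr hr₁₂.symm rfl _ _
    · have hp₁ := hπ.smooth_proj.comp (hcst r₁)
      have hp₂ := hπ.smooth_proj.comp (hcst r₂)
      have h3 := hηκ.lin_eq (p := fun y => ⟨(π r₁, π r₂, π (c y)), hc₁₂, (hx y).symm⟩)
        ⟨hp₁, hp₂, hπ.smooth_proj.comp hcm⟩ hq₂₃.mem_pair hq.mem_pair hq'.mem_pair
        (𝒢.smooth₂.constant_plots ⟨(π r₁, π r₂), hc₁₂⟩) rfl
        (funext fun y => Subtype.ext (Prod.ext hr₁₂.symm rfl))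
        (funext fun y => Subtype.ext (Prod.ext rfl (hq₂₃.proj y).symm)) rfl y
      rw [η.lin_const, add_zero] at h3
      rw [hq'.lin_eq, hq₂₃.lin_eq, θ.lin_const, θ.lin_const, θ.lin_const, ← h3]
      abel
  · have u₂ : IsProd 𝒢 π θ η e r₂ (e (𝒢.tgt (π r₂))) r₂ := IsProd.unit
    have u₁₂ : IsProd 𝒢 π θ η e r₁₂ (e (𝒢.tgt (π r₂))) r₁₂ := htgt ▸ IsProd.unit
    obtain rfl := h₂₃.unique h𝒢 he hηκ hθ hκ u₂
    obtain rfl := hs.unique h𝒢 he hηκ hθ hκ u₁₂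
    exact h₁₂.unique h𝒢 he hηκ hθ hκ hs'

end IsProd

end Product

/-! ## The central extension -/

section Extension

variable {EM : Type*} [NormedAddCommGroup EM] [NormedSpace ℝ EM]
  {M : Type*} [TopologicalSpace M] [ChartedSpace EM M]
  {EG : Type*} [NormedAddCommGroup EG] [NormedSpace ℝ EG]
  {G : Type*} [TopologicalSpace G] [ChartedSpace EG G]
  {ER : Type*} [NormedAddCommGroup ER] [NormedSpace ℝ ER]
  {R : Type*} [TopologicalSpace R] [ChartedSpace ER R] [MulAction Circle R]

/-- A Lie groupoid is determined by its source, target, unit and product maps. -/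
theorem LieGroupoid.ext_of_mul {K K' : LieGroupoid EM M EG G} (hsrc : K.src = K'.src)
    (htgt : K.tgt = K'.tgt) (hunit : K.unit = K'.unit)
    (hmul : ∀ g h w w', K.mul g h w = K'.mul g h w') : K = K' := by
  have hinv : K.inv = K'.inv := by
    funext g
    have w₁ : K.tgt (K'.inv g) = K.src g := by rw [htgt, hsrc, K'.tgt_inv]
    have h1 := K.mul_assoc (K'.inv g) g (K.inv g) w₁ (K.src_inv g).symm
    rw [K.mul_congr ((hmul _ _ w₁ (K'.tgt_inv g)).trans (K'.inv_mul g)) rfl _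
        (by rw [htgt, K'.tgt_unit, K.src_inv, htgt]),
      K.mul_congr rfl (K.mul_inv g) _ (by rw [w₁, K.src_unit]), K.mul_unit'] at h1
    simp only [← hunit] at h1
    rwa [K.unit_mul'] at h1
  refine LieGroupoid.ext hsrc htgt hunit hinv ?_
  cases K
  cases K'
  simp only at hsrc htgt hmul
  subst hsrc htgt
  exact heq_of_eq (funext fun g => funext fun h => funext fun w => hmul g h w w)

variable {𝒢 : LieGroupoid EM M EG G} {π : R → G} {hπ : IsPrincipalCircleBundle EG ER π}
  {θ : DForm (manifoldDiffeology ER R) 1}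
  {η : DForm 𝒢.smooth₂ 1} {κ : DForm (manifoldDiffeology EG G) 2} {e : M → R} {n : ℕ}

/-- Read along a plot, `π^*η = -∂θ` is the horizontality equation, so any multiplication with this
pseudo-curvature is a parallel transport. -/
theorem IsCentralExtension.HasPseudoCurvature.isProdLift {K : LieGroupoid EM M ER R}
    {h : IsCentralExtension 𝒢 π K} (hK : h.HasPseudoCurvature θ η κ) {a b : Euc n → R}
    (ha : a ∈ (manifoldDiffeology ER R).plots n) (hb : b ∈ (manifoldDiffeology ER R).plots n)
    (hab : ∀ y, K.tgt (a y) = K.src (b y)) :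
    IsProdLift 𝒢 π θ η a b (fun y => K.mul (a y) (b y) (hab y)) := by
  have hp : (fun y => (⟨(a y, b y), hab y⟩ : K.Comp₂)) ∈ K.smooth₂.plots n := ⟨ha, hb⟩
  have hq := K.smooth_mul n _ hp
  refine ⟨fun y => (h.tgt_proj _).trans ((hab y).trans (h.src_proj _).symm), ha, hb, hq,
    h.smooth_proj₂ n _ hp, fun y => h.proj_mul _ _ _, fun y => ?_⟩
  have h1 := congrArg (fun α => DForm.lin α hp y) hK.2.1
  simp only [LieGroupoid.del₁, DForm.lin_neg, DForm.lin_sub, DForm.lin_add] at h1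
  replace h1 : η.lin (h.smooth_proj₂ n _ hp) y = -(θ.lin hb y - θ.lin hq y + θ.lin ha y) := h1
  have h2 : θ.lin hq y = θ.lin ha y + θ.lin hb y + η.lin (h.smooth_proj₂ n _ hp) y := by
    rw [h1]
    abel
  exact h2

/-- The multiplication of `K` starts from the unit law and is horizontal, so it follows every
derivation of the relation; this gives the uniqueness of `K`. -/
theorem IsProd.eq_mul {K : LieGroupoid EM M ER R} (h : IsCentralExtension 𝒢 π K)
    (hK : h.HasPseudoCurvature θ η κ) {r₁ r₂ r₃ : R} (hr : IsProd 𝒢 π θ η K.unit r₁ r₂ r₃)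
    (w : K.tgt r₁ = K.src r₂) : K.mul r₁ r₂ w = r₃ := by
  induction hr with
  | unit => exact K.mul_unit' _
  | @move c q hl s t _ ih =>
    have hc : ∀ y, K.tgt r₁ = K.src (c y) := fun y => by
      rw [← h.tgt_proj, ← h.src_proj, hl.comp y]
    exact congrFun ((hK.isProdLift hl.mem_left hl.mem_right hc).unique hK.1 hl (ih (hc s))) t

theorem IsProd.smul_smul (he : IsHorizontalUnit 𝒢 π θ η e) (hθ : IsConnection hπ θ)
    {r₁ r₂ r₃ : R} (h : IsProd 𝒢 π θ η e r₁ r₂ r₃) (z w : Circle) :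
    IsProd 𝒢 π θ η e (z • r₁) (w • r₂) ((z * w) • r₃) := by
  rw [mul_smul]
  exact (h.smul_right he hθ w).smul_left hθ z

variable [IsManifold 𝓘(ℝ, ER) ∞ R]

/-- The pseudo-curvature and the unit map determine the product. -/
theorem IsCentralExtension.HasPseudoCurvature.unique (h𝒢 : 𝒢.SourceConnected)
    (he : IsHorizontalUnit 𝒢 π θ η e) (hηκ : 𝒢.IsThreeCocycle η κ) (hθ : IsConnection hπ θ)
    (hκ : HasCurvature hπ θ κ) {K K' : LieGroupoid EM M ER R} (hu : K.unit = e) (hu' : K'.unit = e)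
    {h : IsCentralExtension 𝒢 π K} {h' : IsCentralExtension 𝒢 π K'}
    (hK : h.HasPseudoCurvature θ η κ) (hK' : h'.HasPseudoCurvature θ η κ) : K = K' := by
  refine LieGroupoid.ext_of_mul (funext fun r => by rw [← h.src_proj, ← h'.src_proj])
    (funext fun r => by rw [← h.tgt_proj, ← h'.tgt_proj]) (hu.trans hu'.symm) fun r₁ r₂ w w' => ?_
  obtain ⟨r₃, hr⟩ := IsProd.exists_of_comp (r₁ := r₁) (r₂ := r₂) h𝒢 he hηκ hθ hκ
    (by rw [h.tgt_proj, h.src_proj, w])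
  have hr' := hr
  rw [← hu] at hr
  rw [← hu'] at hr'
  rw [hr.eq_mul h hK, hr'.eq_mul h' hK']

/-- For any point over the inverse arrow the product lies over a unit; a rotation of that point
turns the product into `e`. -/
theorem IsProd.exists_inv (h𝒢 : 𝒢.SourceConnected) (he : IsHorizontalUnit 𝒢 π θ η e)
    (hηκ : 𝒢.IsThreeCocycle η κ) (hθ : IsConnection hπ θ) (hκ : HasCurvature hπ θ κ) (r : R) :
    ∃ r', π r' = 𝒢.inv (π r) ∧ IsProd 𝒢 π θ η e r r' (e (𝒢.src (π r))) := by
  obtain ⟨r', hr'⟩ := hπ.surjective (𝒢.inv (π r))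
  obtain ⟨r₃, h⟩ := IsProd.exists_of_comp (r₁ := r) (r₂ := r') h𝒢 he hηκ hθ hκ
    (by rw [hr', 𝒢.src_inv])
  obtain ⟨hc, h3⟩ := h.proj_eq he
  have h4 : π r₃ = π (e (𝒢.src (π r))) := by
    obtain ⟨hu, -, -⟩ := he
    rw [h3, 𝒢.mul_congr rfl hr' _ (𝒢.src_inv _).symm, 𝒢.mul_inv, hu]
  obtain ⟨z, hz⟩ := hπ.exists_smul_eq h4
  exact ⟨z • r', by rw [hπ.proj_smul, hr'], hz ▸ h.smul_right he hθ z⟩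

/-- Smoothness of the product: the horizontal lift through one pointwise product satisfies the
relation everywhere, and by single-valuedness it is the family of pointwise products. -/
theorem IsProdLift.of_isProd (h𝒢 : 𝒢.SourceConnected)
    (he : IsHorizontalUnit 𝒢 π θ η e) (hηκ : 𝒢.IsThreeCocycle η κ) (hθ : IsConnection hπ θ)
    (hκ : HasCurvature hπ θ κ) {a b q : Euc n → R} (ha : a ∈ (manifoldDiffeology ER R).plots n)
    (hb : b ∈ (manifoldDiffeology ER R).plots n)
    (h : ∀ y, IsProd 𝒢 π θ η e (a y) (b y) (q y)) : IsProdLift 𝒢 π θ η a b q := by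
  obtain ⟨_, h0⟩ := (h 0).proj_eq he
  obtain ⟨q', hq', hq0⟩ := exists_isProdLift hηκ hθ hκ ha hb
    (fun y => ((h y).proj_eq he).choose) 0 h0
  have h1 := hq'.isProd h𝒢 he hηκ hθ hκ (y₀ := 0) (hq0 ▸ h 0)
  obtain rfl : q = q' := funext fun y => (h y).unique h𝒢 he hηκ hθ hκ (h1 y)
  exact hq'

/-- Locally the inverse is `z • σ(g⁻¹)`, where `σ` is a local section and `z` the smooth ratio
between the unit and the product of the given plot with `σ(g⁻¹)`. Uniqueness of products and
freeness of the action identify this with `ι`. -/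
theorem smoothMap_of_isProd_inv (h𝒢 : 𝒢.SourceConnected) (he : IsHorizontalUnit 𝒢 π θ η e)
    (hηκ : 𝒢.IsThreeCocycle η κ) (hθ : IsConnection hπ θ) (hκ : HasCurvature hπ θ κ) {ι : R → R}
    (hι : ∀ r, π (ι r) = 𝒢.inv (π r) ∧ IsProd 𝒢 π θ η e r (ι r) (e (𝒢.src (π r)))) :
    SmoothMap (manifoldDiffeology ER R) (manifoldDiffeology ER R) ι := by
  intro n a ha y₀
  have hga : (fun y => 𝒢.inv (π (a y))) ∈ (manifoldDiffeology EG G).plots n :=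
    𝒢.contMDiff_inv.comp (hπ.smooth_proj.comp ha)
  obtain ⟨U, hU, hg, σ, φ, hσ, -, hπσ, -, -⟩ := hπ.locally_trivial (𝒢.inv (π (a y₀)))
  obtain ⟨g, hgs, hgid, hgU⟩ := exists_contDiff_eventuallyEq_id
    ((ContMDiff.continuous hga).continuousAt.eventually_mem (hU.mem_nhds hg))
  have ha' := (manifoldDiffeology ER R).plot_reparam ha hgs
  have hb : (fun y => σ (𝒢.inv (π (a (g y))))) ∈ (manifoldDiffeology ER R).plots n :=
    hσ.comp_contMDiff (hga.comp hgs.contMDiff) hgU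
  have hcomp : ∀ y, 𝒢.tgt (π (a (g y))) = 𝒢.src (π (σ (𝒢.inv (π (a (g y)))))) := fun y => by
    rw [hπσ _ (hgU y), 𝒢.src_inv]
  choose q hq using fun y => IsProd.exists_of_comp (e := e) h𝒢 he hηκ hθ hκ (hcomp y)
  have hql := IsProdLift.of_isProd h𝒢 he hηκ hθ hκ ha' hb hq
  have hu : (fun y => e (𝒢.src (π (a (g y))))) ∈ (manifoldDiffeology ER R).plots n :=
    (he.isProdLift_left hηκ hπ ha').mem_left
  obtain ⟨z, hz⟩ := hπ.exists_ratio hql.mem hu (y₀ := y₀) (Eventually.of_forall fun y => by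
    obtain ⟨h1, h2⟩ := (hq y).proj_eq he
    obtain ⟨h3, -, -⟩ := he
    rw [h2, ← h3, 𝒢.mul_congr rfl (hπσ _ (hgU y)) _ (𝒢.src_inv _).symm, 𝒢.mul_inv])
  have hsm : ContMDiffAt 𝓘(ℝ, Euc n) 𝓘(ℝ, ER) ∞ (fun y => z y • σ (𝒢.inv (π (a (g y))))) y₀ := by
    have := hπ.smooth_smul
    exact (ContMDiffSMul.contMDiff_smul (I := 𝓡 1) (I' := 𝓘(ℝ, ER)) (n := ∞) (G := Circle)
      (M := R)).contMDiffAt.comp y₀ (hz.self_of_nhds.1.prodMk (ContMDiff.contMDiffAt hb))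
  refine hsm.congr_of_eventuallyEq ?_
  filter_upwards [hz, hgid] with y hzy hgy
  have hgy' : g y = y := hgy
  have h1 := (hq y).smul_right he hθ (z y)
  rw [← hzy.2, hgy'] at h1
  have h2 : π (z y • σ (𝒢.inv (π (a y)))) = π (ι (a y)) := by
    rw [hπ.proj_smul, (hι _).1, hπσ _ (hgy' ▸ hgU y)]
  obtain ⟨w, hw⟩ := hπ.exists_smul_eq h2
  have h3 := h1.smul_right he hθ w
  rw [hw] at h3
  have h4 := h3.unique h𝒢 he hηκ hθ hκ (hι (a y)).2
  obtain rfl : w = 1 := hπ.smul_right_injective _ (h4.trans (one_smul _ _).symm)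
  rw [one_smul] at hw
  simp only [Function.comp_apply, hgy', hw]

variable [FiniteDimensional ℝ EM] [IsManifold 𝓘(ℝ, EM) ∞ M] [FiniteDimensional ℝ ER]

theorem exists_isCentralExtension (h𝒢 : 𝒢.SourceConnected)
    (he : IsHorizontalUnit 𝒢 π θ η e) (hηκ : 𝒢.IsThreeCocycle η κ) (hθ : IsConnection hπ θ)
    (hκ : HasCurvature hπ θ κ) :
    ∃ K : LieGroupoid EM M ER R, K.unit = e ∧
      ∃ h : IsCentralExtension 𝒢 π K, h.HasPseudoCurvature θ η κ := by
  choose mul hmul using fun (r₁ r₂ : R) (hc : 𝒢.tgt (π r₁) = 𝒢.src (π r₂)) =>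
    IsProd.exists_of_comp (e := e) h𝒢 he hηκ hθ hκ hc
  choose inv hinv using fun r => IsProd.exists_inv (r := r) h𝒢 he hηκ hθ hκ
  have heu : ∀ x, 𝒢.unit x = π (e x) := he.choose
  have hproj : ∀ r₁ r₂ hc, π (mul r₁ r₂ hc) = 𝒢.mul (π r₁) (π r₂) hc := fun r₁ r₂ hc =>
    ((hmul r₁ r₂ hc).proj_eq he).choose_spec
  have hlift : ∀ {n : ℕ} {a b : Euc n → R} (_ : a ∈ (manifoldDiffeology ER R).plots n)
      (_ : b ∈ (manifoldDiffeology ER R).plots n) (hc : ∀ y, 𝒢.tgt (π (a y)) = 𝒢.src (π (b y))),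
      IsProdLift 𝒢 π θ η a b (fun y => mul (a y) (b y) (hc y)) := fun ha hb hc =>
    IsProdLift.of_isProd h𝒢 he hηκ hθ hκ ha hb fun y => hmul _ _ _
  have huniq : ∀ {r₁ r₂ r₃ : R} (hc), IsProd 𝒢 π θ η e r₁ r₂ r₃ → mul r₁ r₂ hc = r₃ :=
    fun hc h => (hmul _ _ hc).unique h𝒢 he hηκ hθ hκ h
  have hunit : SmoothMap (manifoldDiffeology EM M) (manifoldDiffeology ER R) e :=
    fun n p hp => (he.isLift hp).mem
  have hsinv : ∀ r, 𝒢.src (π (inv r)) = 𝒢.tgt (π r) := fun r => by rw [(hinv r).1, 𝒢.src_inv]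
  have htinv : ∀ r, 𝒢.tgt (π (inv r)) = 𝒢.src (π r) := fun r => by rw [(hinv r).1, 𝒢.tgt_inv]
  have hru : ∀ r, IsProd 𝒢 π θ η e r (e (𝒢.tgt (π r))) r := fun r => IsProd.unit
  have hlu : ∀ r, IsProd 𝒢 π θ η e (e (𝒢.src (π r))) r r := fun r => by
    have h1 := hmul (e (𝒢.src (π r))) r (by rw [← heu, 𝒢.tgt_unit])
    have h2 := h1.eq_of_unit_left he hηκ hθ
    rwa [h2] at h1
  let K : LieGroupoid EM M ER R :=
    { src := fun r => 𝒢.src (π r)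
      tgt := fun r => 𝒢.tgt (π r)
      unit := e
      inv := inv
      mul := mul
      src_mul := fun r₁ r₂ hc => by rw [hproj, 𝒢.src_mul]
      tgt_mul := fun r₁ r₂ hc => by rw [hproj, 𝒢.tgt_mul]
      mul_assoc := fun r₁ r₂ r₃ h₁₂ h₂₃ =>
        (hmul _ _ h₁₂).assoc h𝒢 he hηκ hθ hκ (hmul _ _ h₂₃) (hmul _ _ _) (hmul _ _ _)
      src_unit := fun x => by rw [← heu, 𝒢.src_unit]
      tgt_unit := fun x => by rw [← heu, 𝒢.tgt_unit]
      unit_mul := fun r => huniq _ (hlu r)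
      mul_unit := fun r => huniq _ (hru r)
      src_inv := hsinv
      tgt_inv := htinv
      mul_inv := fun r => huniq _ (hinv r).2
      -- With `r' = inv r` and `r'' = inv r'`, the two bracketings of `r r' r''` are `e · r'' = r''`
      -- and `r · e = r`. Hence `r'' = r`, and `r' r''` being a unit is the left inverse law.
      inv_mul := fun r => by
        refine huniq _ ?_
        have h1 := (hinv (inv r)).2
        have h2 := hru r
        have h3 := hlu (inv (inv r))
        rw [hsinv] at h1
        rw [hsinv, htinv] at h3
        have h4 := (hinv r).2.assoc h𝒢 he hηκ hθ hκ h1 h3 h2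
        rwa [h4] at h1
      submersion_src := hπ.isSubmersion_comp 𝒢.submersion_src
      submersion_tgt := hπ.isSubmersion_comp 𝒢.submersion_tgt
      contMDiff_unit := hunit.contMDiff
      contMDiff_inv := (smoothMap_of_isProd_inv h𝒢 he hηκ hθ hκ hinv).contMDiff
      smooth_mul := fun n p hp => (hlift hp.1 hp.2 fun y => (p y).2).mem }
  have hK : IsCentralExtension 𝒢 π K :=
    { principal := hπ
      src_proj := fun r => rfl
      tgt_proj := fun r => rfl
      proj_unit := fun x => (heu x).symm
      proj_mul := fun r₁ r₂ hc => hproj r₁ r₂ hc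
      smul_mul_smul := fun z w r₁ r₂ hc => huniq _ ((hmul r₁ r₂ hc).smul_smul he hθ z w) }
  refine ⟨K, rfl, hK, hθ, DForm.ext_lin fun n p hp y => ?_, hκ.symm⟩
  have h1 := hlift hp.1 hp.2 fun y => (p y).2
  simp only [LieGroupoid.del₁, DForm.lin_neg, DForm.lin_sub, DForm.lin_add]
  change η.lin h1.mem_pair y = -(θ.lin h1.mem_right y - θ.lin h1.mem y + θ.lin h1.mem_left y)
  rw [h1.lin_eq]
  abel

end Extension

theorem mainTheorem1
    {EM : Type*} [NormedAddCommGroup EM] [NormedSpace ℝ EM] [FiniteDimensional ℝ EM]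
    {M : Type*} [TopologicalSpace M] [ChartedSpace EM M] [IsManifold 𝓘(ℝ, EM) ∞ M]
    {EG : Type*} [NormedAddCommGroup EG] [NormedSpace ℝ EG] [FiniteDimensional ℝ EG]
    {G : Type*} [TopologicalSpace G] [ChartedSpace EG G] [IsManifold 𝓘(ℝ, EG) ∞ G]
    {ER : Type*} [NormedAddCommGroup ER] [NormedSpace ℝ ER] [FiniteDimensional ℝ ER]
    {R : Type*} [TopologicalSpace R] [ChartedSpace ER R] [IsManifold 𝓘(ℝ, ER) ∞ R]
    [MulAction Circle R]
    (𝒢 : LieGroupoid EM M EG G) (h𝒢 : 𝒢.SourceConnected)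
    (η : DForm 𝒢.smooth₂ 1) (κ : DForm (manifoldDiffeology EG G) 2)
    (hηκ : 𝒢.IsThreeCocycle η κ)
    (π : R → G) (hπ : IsPrincipalCircleBundle EG ER π)
    (θ : DForm (manifoldDiffeology ER R) 1) (hθ : IsConnection hπ θ)
    (hκ : HasCurvature hπ θ κ)
    (hol : HolonomyFree (unitBundleSmooth ER 𝒢 π) (fun z => z.1.1) (unitConnection 𝒢 π θ η)) :
    (∃ e : M → R, IsHorizontalUnit 𝒢 π θ η e) ∧
    ∀ e : M → R, IsHorizontalUnit 𝒢 π θ η e →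
      ∃! K : LieGroupoid EM M ER R, K.unit = e ∧
        ∃ h : IsCentralExtension 𝒢 π K, h.HasPseudoCurvature θ η κ := by
  refine ⟨exists_isHorizontalUnit hηκ hθ hκ hol, fun e he => ?_⟩
  obtain ⟨K, hu, h, hK⟩ := exists_isCentralExtension h𝒢 he hηκ hθ hκ
  refine ⟨K, ⟨hu, h, hK⟩, ?_⟩
  rintro K' ⟨hu', h', hK'⟩
  exact hK'.unique h𝒢 he hηκ hθ hκ hu' hu hK
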